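/- **Setting.** Let $d,n\ge 1$. An environment is a function $\eta:\mathbb{Z}^d\times\mathbb{R}^n\to(-\infty,\infty]$. For $\lambda>0$, a finite $\Lambda\subset\mathbb{Z}^d$ and $\tau:\mathbb{Z}^d\to\mathbb{R}^n$ let $$H^{\eta,\lambda,\Lambda}(\varphi)=\frac12\sum_{\substack{u\sim v\\ \{u,v\}\cap\Lambda\ne\emptyset}}\|\varphi_u-\varphi_v\|^2+\lambda\sum_{v\in\Lambda}\eta_{v,\varphi_v},\qquad \Omega^{\Lambda,\tau}=\{\varphi:\mathbb{Z}^d\to\mathbb{R}^n:\ \varphi_v=\tau_v \text{ for } v\notin\Lambda\},$$ where the first sum is over unordered nearest-neighbour pairs and $\|\cdot\|$ is the Euclidean norm. The ground energy $\mathrm{GE}^{\eta,\lambda,\Lambda,\tau}$ is the minimum of $H^{\eta,\lambda,\Lambda}$ over $\Omega^{\Lambda,\tau}$. Let $\Lambda_L=\{-L,\dots,L\}^d$, $r_v=\min_{w\in\mathbb{Z}^d\setminus\Lambda_L}\|v-w\|_\infty$, and let $\varphi^{\eta,\lambda,\Lambda_L}$ be a minimizer of $H^{\eta,\lambda,\Lambda_L}$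 over $\Omega^{\Lambda_L,0}$ (any choice, if there are several). **Assumptions.** The disorder $\eta$ is random, and the processes $\eta_{v,\cdot}$ are random elements of the space of functions $\mathbb{R}^n\to(-\infty,\infty]$ with some given $\sigma$-algebra; environments carry the product $\sigma$-algebra over $v\in\mathbb{Z}^d$, the $\sigma$-algebra being rich enough for the assumptions below to make sense for the law of $\eta$. * (ExiMin) For all $\lambda>0$, finite $\Lambda$ and $\tau$, almost surely $H^{\eta,\lambda,\Lambda}$ attains a minimum on every non-empty closed subset of $\Omega^{\Lambda,\tau}$; moreover $\mathrm{GE}^{\eta,\lambda,\Lambda,\tau}<\infty$ almost surely. * (Stat) For every $s:\mathbb{Z}^d\to\mathbb{R}^n$ the environment $\eta^s_{v,t}:=\eta_{v,t-s_v}$ has the same distribution as $\eta$. * (Conc), with parameters $K,\kappa>0$. For all $\lambda>0$, all finite $\Lambda\subset\mathbb{Z}^d$ and all $\tau$, $\mathbb{E}|\mathrm{GE}^{\eta,\lambda,\Lambda,\tau}|<\infty$, and for every non-empty $\Delta\subset\Lambda$ and every $\rho>0$, almost surely, $$\mathbb{P}\Big(\big|\mathrm{GE}^{\eta,\lambda,\Lambda,\tau}-\mathbb{E}(\mathrm{GE}^{\eta,\lambda,\Lambda,\tau}\mid\eta_{\Delta^c})\big|\ge\rho\lambda\sqrt{|\Delta|}\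 \Big|\ \eta_{\Delta^c}\Big)\le Ke^{-\kappa\rho^2},$$ where $\eta_{\Delta^c}=(\eta_{v,\cdot})_{v\in\mathbb{Z}^d\setminus\Delta}$. **Theorem 1.1.** There exist $C,c>0$ depending only on $d,n,K,\kappa$ such that, for every disorder $\eta$ satisfying (ExiMin), (Stat) and (Conc) with parameters $K,\kappa$, every integer $L\ge1$ and every $\lambda>0$, the following holds. For each $v\in\Lambda_L$, $\|\varphi^{\eta,\lambda,\Lambda_L}_v\|$ is integrable and $$\mathbb{E}\|\varphi^{\eta,\lambda,\Lambda_L}_v\|\le C\sqrt\lambda\cdot\begin{cases}r_v^{(4-d)/4}& d=1,2,3\\ \log(r_v+1)& d=4\\ 1& d\ge5.\end{cases}$$ Moreover, writing $[x]_*:=x$ if $x>0$ and $[x]_*:=1$ if $x\le0$: for $d=1$ and every $t>0$, $$\mathbb{P}\Big(\forall v\in\Lambda_L:\ \|\varphi^{\eta,\lambda,\Lambda_L}_v\|\le t\sqrt\lambda\,\big[\log\log\tfrac{3L}{r_v}\big]_*^{1/4}\,r_v^{(4-d)/4}\Big)\ge1-Ce^{-ct^4},$$ and for $d\in\{2,3\}$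 and every $t>0$, $$\mathbb{P}\Big(\forall v\in\Lambda_L:\ \|\varphi^{\eta,\lambda,\Lambda_L}_v\|\le t\sqrt\lambda\,\big[\log\tfrac{2L}{r_v}\big]_*^{1/4}\,r_v^{(4-d)/4}\Big)\ge1-Ce^{-ct^4}.$$ (Here $[\cdot]_*$ matters only for small boxes: the argument is positive for all $v\in\Lambda_L$ as soon as $L\ge10$ in the first bound and $L\ge2$ in the second.) -/

import Mathlib

open MeasureTheory ProbabilityTheory

noncomputable section

/-- Configurations (surfaces) `φ : ℤ^d → ℝ^n`; boundary values and shifts have the same type. -/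
abbrev Config (d n : ℕ) : Type := (Fin d → ℤ) → EuclideanSpace ℝ (Fin n)

/-- A potential `ℝ^n → (-∞, ∞]`, the environment seen at a single vertex. It is a `def` so that it
carries no default σ-algebra: the σ-algebra which makes the disorder random is part of the data. -/
def Potential (n : ℕ) : Type := EuclideanSpace ℝ (Fin n) → WithTop ℝ

/-- Environments `η : ℤ^d × ℝ^n → (-∞, ∞]`, written `η v t`. Given a σ-algebra on `Potential n`,
environments carry the product σ-algebra over the vertices. -/
abbrev Environment (d n : ℕ) : Type := (Fin d → ℤ) → Potential n

/-- The shifted environment `η^s_{v,t} = η_{v,t - s_v}`. -/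
def shiftEnv {d n : ℕ} (s : Config d n) (η : Environment d n) : Environment d n :=
  fun v t => η v (t - s v)

/-- The Dirichlet energy `∑ ‖φ_u - φ_v‖²` over the (unordered) nearest-neighbour edges `{u, v}` of
`ℤ^d` that meet `Λ`. Each edge is written uniquely as `{v, v + e_i}`, and it meets `Λ` iff
`v ∈ Λ` or `v ∈ Λ - e_i`. -/
def dirichletEnergy {d n : ℕ} (Λ : Finset (Fin d → ℤ)) (φ : Config d n) : ℝ :=
  ∑ i : Fin d, ∑ v ∈ Λ ∪ Λ.image (fun w => w - Pi.single i 1),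
    ‖φ (v + Pi.single i 1) - φ v‖ ^ 2

/-- The finite-volume Hamiltonian `H^{η,λ,Λ}(φ)`, with values in `(-∞, ∞]`. -/
def hamiltonian {d n : ℕ} (η : Environment d n) (lam : ℝ) (Λ : Finset (Fin d → ℤ))
    (φ : Config d n) : WithTop ℝ :=
  ((1 / 2 * dirichletEnergy Λ φ : ℝ) : WithTop ℝ) + (lam : WithTop ℝ) * ∑ v ∈ Λ, η v (φ v)

/-- The configuration space `Ω^{Λ,τ}` with boundary values `τ` outside `Λ`. -/
def configSpace {d n : ℕ} (Λ : Finset (Fin d → ℤ)) (τ : Config d n) : Set (Config d n) :=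
  {φ | ∀ v, v ∉ Λ → φ v = τ v}

/-- `φ` minimizes `H^{η,λ,Λ}` over `Ω^{Λ,τ}`. -/
def IsGroundConfig {d n : ℕ} (η : Environment d n) (lam : ℝ) (Λ : Finset (Fin d → ℤ))
    (τ φ : Config d n) : Prop :=
  φ ∈ configSpace Λ τ ∧ ∀ ψ ∈ configSpace Λ τ, hamiltonian η lam Λ φ ≤ hamiltonian η lam Λ ψ

open Classical in
/-- The ground energy `GE^{η,λ,Λ,τ}`: the energy of a ground configuration (it does not depend on
which one), and `∞` by convention if there is none. -/
def groundEnergy {d n : ℕ} (η : Environment d n) (lam : ℝ) (Λ : Finset (Fin d → ℤ))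
    (τ : Config d n) : WithTop ℝ :=
  if h : ∃ φ, IsGroundConfig η lam Λ τ φ then hamiltonian η lam Λ h.choose else ⊤

/-- The ground energy as a real number (used where it is almost surely finite). -/
def groundEnergyReal {d n : ℕ} (η : Environment d n) (lam : ℝ) (Λ : Finset (Fin d → ℤ))
    (τ : Config d n) : ℝ :=
  (groundEnergy η lam Λ τ).untopD 0

/-- Assumption (ExiMin) on the law `μ` of the disorder. -/
structure ExiMin {d n : ℕ} [MeasurableSpace (Potential n)] (μ : Measure (Environment d n)) :
    Prop where
  attains_min : ∀ lam : ℝ, 0 < lam → ∀ (Λ : Finset (Fin d → ℤ)) (τ : Config d n),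
    ∀ᵐ η ∂μ, ∀ F : Set (Config d n), F ⊆ configSpace Λ τ → IsClosed F → F.Nonempty →
      ∃ φ ∈ F, ∀ ψ ∈ F, hamiltonian η lam Λ φ ≤ hamiltonian η lam Λ ψ
  groundEnergy_lt_top : ∀ lam : ℝ, 0 < lam → ∀ (Λ : Finset (Fin d → ℤ)) (τ : Config d n),
    ∀ᵐ η ∂μ, groundEnergy η lam Λ τ < ⊤

/-- Assumption (Stat): if `η` has law `μ` then so has `η^s`, for every shift `s`. -/
def Stat {d n : ℕ} [MeasurableSpace (Potential n)] (μ : Measure (Environment d n)) : Prop :=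
  ∀ s : Config d n, IdentDistrib (shiftEnv s) id μ μ

/-- The σ-algebra generated by the collection of processes `η_A = (η_{v,·})_{v ∈ A}`. -/
@[reducible]
def sigmaOf {d n : ℕ} [MeasurableSpace (Potential n)] (A : Set (Fin d → ℤ)) :
    MeasurableSpace (Environment d n) :=
  ⨆ v ∈ A, MeasurableSpace.comap (fun η : Environment d n => η v) inferInstance

/-- Assumption (Conc) with parameters `K, κ`, on the law `μ` of the disorder. (For `Δ = ∅` the
inequality would read `1 ≤ K exp (-κ ρ²)` for all `ρ > 0`, so `Δ` is taken non-empty.) -/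
structure Conc {d n : ℕ} [MeasurableSpace (Potential n)] (μ : Measure (Environment d n))
    (K κ : ℝ) : Prop where
  integrable : ∀ lam : ℝ, 0 < lam → ∀ (Λ : Finset (Fin d → ℤ)) (τ : Config d n),
    Integrable (fun η => groundEnergyReal η lam Λ τ) μ
  concentration : ∀ lam : ℝ, 0 < lam → ∀ (Δ Λ : Finset (Fin d → ℤ)), Δ.Nonempty → Δ ⊆ Λ →
    ∀ (τ : Config d n) (ρ : ℝ), 0 < ρ →
      ∀ᵐ η ∂μ,
        (μ⟦{η' : Environment d n | ρ * lam * √(Δ.card : ℝ) ≤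
            |groundEnergyReal η' lam Λ τ -
              (μ[fun η'' => groundEnergyReal η'' lam Λ τ | sigmaOf (Δ : Set (Fin d → ℤ))ᶜ]) η'|}
          | sigmaOf (Δ : Set (Fin d → ℤ))ᶜ⟧) η ≤ K * Real.exp (-κ * ρ ^ 2)

/-- The box `Λ_L = {-L, …, L}^d`. -/
def box (d L : ℕ) : Finset (Fin d → ℤ) :=
  Finset.Icc (fun _ => -(L : ℤ)) (fun _ => (L : ℤ))

/-- `r_v`, the `ℓ_∞` distance of `v` to the complement of `Λ_L` (the distance of `Fin d → ℤ` is the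
sup distance). -/
def boundaryDist (d L : ℕ) (v : Fin d → ℤ) : ℝ :=
  Metric.infDist v (box d L : Set (Fin d → ℤ))ᶜ

/-- The order of the height bound at distance `r` from the boundary. -/
def heightScale (d : ℕ) (r : ℝ) : ℝ :=
  if d ≤ 3 then r ^ ((4 - (d : ℝ)) / 4) else if d = 4 then Real.log (r + 1) else 1

/-- `x` if it is positive, and `1` otherwise. -/
def positiveOrOne (x : ℝ) : ℝ := if 0 < x then x else 1

end

/-!
Let `Λ` be the box, `φ` the ground configuration and `GE` the ground energy. If a shift `s` vanishes
off `Λ`, then comparing `φ + s` with the minimizer in the shifted environment gives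
`GE(η^s) ≤ GE(η) + (φ, -Δs) + ‖∇s‖² / 2` (`groundEnergyReal_shiftEnv_le`). If moreover `s` is
supported in `Δ ⊆ Λ`, then `GE(η^s)` and `GE(η)` have the same law and the same conditional
expectation given the environment off `Δ`, so by (Conc) they differ by `O(λ √|Δ|)`. Applied to
`s = ± a h` with the best amplitude `a`, this shows that `(φ, -Δh)` is of order
`√λ |Δ|^{1/4} ‖∇h‖`, with tails `exp (-c t⁴)` (`measure_abs_pairing_ge_le`). The same inequality with
`a → 0` squeezes `(φ, -Δh)` between difference quotients of the ground energy whose means agree in the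
limit; hence `φ` is almost everywhere measurable although it is an arbitrary choice of minimizers
(`aemeasurable_pairing`).

To bound `φ_v - φ_w`, the charge `δ_v - δ_w` is split into scales `ℓ = 2^j`
(`exists_multiscale_potentials`). With `P` the simple random walk killed outside `Λ`, and `q_ℓ` a power
of the normalized Dirichlet kernel regarded as a polynomial of degree `O(ℓ)` in `P`, the difference
`q_ℓ - q_{2ℓ}` is divisible by `1 - P`. So `(q_ℓ - q_{2ℓ})(P) (δ_v - δ_w) = -Δh` where `h` is supported
within distance `O(ℓ)` of `v` and `w`, vanishes outside `Λ`, and by an explicit computation in the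
basis of sine modes satisfies `‖∇h‖² = O(ℓ^{2-d} min(1, |v - w| / ℓ)²)`. Killing the walk builds the
boundary condition in: at scales above the distance `D` of `v` to a boundary point `w` one gains the
factor `D / ℓ`. Hence the contribution of scale `ℓ` is of order
`√λ ℓ^{(4-d)/4} min(1, D / ℓ)`, and the sum over scales has the asserted order
(`exists_scaleSum_le_heightScale`). To sum without losing in the tails, the bounds are expressed by
moments `E exp (θ (X / b)⁴)`, for which the scales `b` add up by convexity (`QuarticBound.sum`).
With `w` on the outer boundary, where `φ = 0`, this is the bound on the mean.

For the uniform bounds in dimension at most three, the two-point estimate makes `φ` Hölder of exponent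
`(4-d)/4` at all scales. Each `v` at distance about `2^K` from the boundary is joined to a boundary
point by rounding its distances to the faces to multiples of `2^k` for `k ≤ K`, and a union bound over
all increments along such chains is taken (`exists_maximal_height_bound`). The number of cells at
distance `2^{-j} L` from the boundary grows like `2^{j(d-1)}`, which costs the factor `j^{1/4}`; in
dimension one only the number of values of `j` matters, which leaves `(log j)^{1/4}`.
-/

/-! ### Dirichlet kernel polynomials -/

section DirichletPolynomials

open Polynomial

theorem abs_sin_nat_mul_le (j : ℕ) (x : ℝ) : |Real.sin (j * x)| ≤ j * |Real.sin x| := by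
  induction j with
  | zero => simp
  | succ j ih =>
    have h : ((j + 1 : ℕ) : ℝ) * x = j * x + x := by push_cast; ring
    rw [h, Real.sin_add]
    calc |Real.sin (j * x) * Real.cos x + Real.cos (j * x) * Real.sin x|
        ≤ |Real.sin (j * x)| * |Real.cos x| + |Real.cos (j * x)| * |Real.sin x| := by
          rw [← abs_mul, ← abs_mul]; exact abs_add_le _ _
      _ ≤ j * |Real.sin x| * 1 + 1 * |Real.sin x| := by
          gcongr
          · exact Real.abs_cos_le_one x
          · exact Real.abs_cos_le_one _
      _ = ((j + 1 : ℕ) : ℝ) * |Real.sin x| := by push_cast; ring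

theorem one_sub_cos_nat_mul_le (j : ℕ) (x : ℝ) :
    1 - Real.cos (j * x) ≤ (j : ℝ) ^ 2 * (1 - Real.cos x) := by
  have key : ∀ y : ℝ, 1 - Real.cos y = 2 * |Real.sin (y / 2)| ^ 2 := by
    intro y
    have := Real.cos_sq (y / 2)
    have h2 := Real.sin_sq_add_cos_sq (y / 2)
    rw [sq_abs]
    rw [mul_div_cancel₀ _ (two_ne_zero)] at this
    linarith
  rw [key, key]
  have := abs_sin_nat_mul_le j (x / 2)
  rw [mul_div_assoc]
  have h3 := pow_le_pow_left₀ (abs_nonneg _) this 2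
  nlinarith

theorem sin_half_mul_dirichletSum (n : ℕ) (x : ℝ) :
    Real.sin (x / 2) * (1 + 2 * ∑ j ∈ Finset.range n, Real.cos ((j + 1 : ℕ) * x)) =
      Real.sin ((n + 1 / 2) * x) := by
  induction n with
  | zero => simp; ring_nf
  | succ n ih =>
    rw [Finset.sum_range_succ]
    have h1 : ((n : ℝ) + 1 / 2) * x = ((n + 1 : ℕ) : ℝ) * x - x / 2 := by push_cast; ring
    have h2 : (((n + 1 : ℕ) : ℝ) + 1 / 2) * x = ((n + 1 : ℕ) : ℝ) * x + x / 2 := by ring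
    rw [h1, Real.sin_sub] at ih
    rw [h2, Real.sin_add]
    linear_combination ih

/-- The normalized Dirichlet kernel `sin ((n + 1/2) α) / ((2n + 1) sin (α / 2))` as a polynomial of
degree `n` in `cos α`. -/
noncomputable def dirichletPoly (n : ℕ) : ℝ[X] :=
  C (1 / (2 * n + 1) : ℝ) * (1 + 2 * ∑ j ∈ Finset.range n, Chebyshev.T ℝ ((j + 1 : ℕ) : ℤ))

theorem dirichletPoly_eval_cos (n : ℕ) (x : ℝ) : (dirichletPoly n).eval (Real.cos x) =
    1 / (2 * n + 1) * (1 + 2 * ∑ j ∈ Finset.range n, Real.cos ((j + 1 : ℕ) * x)) := by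
  simp only [dirichletPoly, eval_mul, eval_C, eval_add, eval_one, eval_finsetSum,
    Chebyshev.T_real_cos]
  simp

theorem dirichletPoly_eval_one (n : ℕ) : (dirichletPoly n).eval 1 = 1 := by
  have := dirichletPoly_eval_cos n 0
  simp only [Real.cos_zero, mul_zero] at this
  rw [this]
  simp
  field_simp
  ring

theorem natDegree_dirichletPoly_le (n : ℕ) : (dirichletPoly n).natDegree ≤ n := by
  unfold dirichletPoly
  refine (natDegree_C_mul_le _ _).trans ?_
  refine (natDegree_add_le _ _).trans (max_le (by simp) ?_)
  have h2 : (2 : ℝ[X]) = C 2 := (map_ofNat C 2).symm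
  rw [h2]
  refine (natDegree_C_mul_le _ _).trans ?_
  refine natDegree_sum_le_of_forall_le _ _ fun j hj => ?_
  rw [Chebyshev.natDegree_T]
  have := Finset.mem_range.1 hj
  simp only [Int.natAbs_natCast]
  omega

theorem abs_dirichletPoly_le_one (n : ℕ) {y : ℝ} (h1 : -1 ≤ y) (h2 : y ≤ 1) :
    |(dirichletPoly n).eval y| ≤ 1 := by
  rw [← Real.cos_arccos h1 h2, dirichletPoly_eval_cos, abs_mul, abs_of_pos (by positivity)]
  rw [one_div_mul_eq_div, div_le_one (by positivity)]
  calc |1 + 2 * ∑ j ∈ Finset.range n, Real.cos ((j + 1 : ℕ) * Real.arccos y)|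
      ≤ 1 + 2 * ∑ j ∈ Finset.range n, |Real.cos ((j + 1 : ℕ) * Real.arccos y)| := by
        refine (abs_add_le _ _).trans ?_
        rw [abs_one, abs_mul, abs_two]
        gcongr
        exact Finset.abs_sum_le_sum_abs _ _
    _ ≤ 1 + 2 * ∑ j ∈ Finset.range n, 1 := by
        gcongr
        exact Real.abs_cos_le_one _
    _ = 2 * n + 1 := by simp; ring

theorem dirichletPoly_sq_mul_le (n : ℕ) {y : ℝ} (h1 : -1 ≤ y) (h2 : y ≤ 1) :
    (dirichletPoly n).eval y ^ 2 * ((2 * n + 1) ^ 2 * (1 - y) / 2) ≤ 1 := by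
  set x := Real.arccos y with hx
  have hy : y = Real.cos x := (Real.cos_arccos h1 h2).symm
  have hs : (1 - y) / 2 = Real.sin (x / 2) ^ 2 := by
    have := Real.cos_sq (x / 2)
    have h2 := Real.sin_sq_add_cos_sq (x / 2)
    rw [mul_div_cancel₀ _ (two_ne_zero)] at this
    rw [hy]; linarith
  have hd := sin_half_mul_dirichletSum n x
  have he := dirichletPoly_eval_cos n x
  have : (dirichletPoly n).eval y ^ 2 * ((2 * n + 1) ^ 2 * (1 - y) / 2) =
      Real.sin ((n + 1 / 2) * x) ^ 2 := by
    rw [mul_div_assoc, hs, ← hd, hy, he]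
    have : (2 * (n : ℝ) + 1) ≠ 0 := by positivity
    generalize (1 + 2 * ∑ j ∈ Finset.range n, Real.cos ((j + 1 : ℕ) * x)) = S
    field_simp
  rw [this]
  exact Real.sin_sq_le_one _

theorem one_sub_dirichletPoly_le (n : ℕ) {y : ℝ} (h1 : -1 ≤ y) (h2 : y ≤ 1) :
    1 - (dirichletPoly n).eval y ≤ (n : ℝ) ^ 2 * (1 - y) := by
  set x := Real.arccos y with hx
  have hy : y = Real.cos x := (Real.cos_arccos h1 h2).symm
  rw [hy, dirichletPoly_eval_cos]
  have hn : (0 : ℝ) < 2 * n + 1 := by positivity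
  have hc : 0 ≤ 1 - Real.cos x := by linarith [Real.cos_le_one x]
  have hsum : ∑ j ∈ Finset.range n, (1 - Real.cos ((j + 1 : ℕ) * x)) ≤
      n * ((n : ℝ) ^ 2 * (1 - Real.cos x)) := by
    rw [← nsmul_eq_mul]
    conv_rhs => rw [← Finset.card_range n]
    refine Finset.sum_le_card_nsmul _ _ _ fun j hj => ?_
    refine (one_sub_cos_nat_mul_le _ _).trans ?_
    have : (j + 1 : ℕ) ≤ n := Finset.mem_range.1 hj
    rw [Finset.card_range]
    gcongr
  rw [Finset.sum_sub_distrib] at hsum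
  simp only [Finset.sum_const, Finset.card_range, nsmul_eq_mul, mul_one] at hsum
  have e : 1 - 1 / (2 * (n : ℝ) + 1) * (1 + 2 * ∑ j ∈ Finset.range n, Real.cos ((j + 1 : ℕ) * x)) =
      2 * (n - ∑ j ∈ Finset.range n, Real.cos ((j + 1 : ℕ) * x)) / (2 * n + 1) := by
    generalize ∑ j ∈ Finset.range n, Real.cos ((j + 1 : ℕ) * x) = S
    field_simp; ring
  rw [e, div_le_iff₀ hn]
  nlinarith [mul_nonneg (sq_nonneg (n : ℝ)) hc]

/-- The low-pass filter at scale `2 ^ k`: a polynomial of degree at most `M 2 ^ k`, equal to `1` at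
`1`, which is of order `(4 ^ k (1 - y)) ^ (-M / 2)` away from `1`. -/
noncomputable def scalePoly (M k : ℕ) : ℝ[X] := dirichletPoly (2 ^ k - 1) ^ M

theorem scalePoly_zero (M : ℕ) : scalePoly M 0 = 1 := by
  simp [scalePoly, dirichletPoly]

theorem scalePoly_eval_one (M k : ℕ) : (scalePoly M k).eval 1 = 1 := by
  simp [scalePoly, dirichletPoly_eval_one]

theorem natDegree_scalePoly_le (M k : ℕ) : (scalePoly M k).natDegree ≤ M * 2 ^ k := by
  refine natDegree_pow_le.trans (Nat.mul_le_mul_left _ ?_)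
  exact (natDegree_dirichletPoly_le _).trans (Nat.sub_le _ _)

theorem scalePoly_sq_mul_le (M k : ℕ) {y : ℝ} (h1 : -1 ≤ y) (h2 : y ≤ 1) :
    (scalePoly M k).eval y ^ 2 * (4 ^ k * (1 - y)) ^ M ≤ 2 ^ M := by
  have h := dirichletPoly_sq_mul_le (2 ^ k - 1) h1 h2
  have hk : (1 : ℕ) ≤ 2 ^ k := Nat.one_le_two_pow
  have hc : ((2 ^ k - 1 : ℕ) : ℝ) = 2 ^ k - 1 := by push_cast [hk]; ring
  have hk' : (1 : ℝ) ≤ 2 ^ k := one_le_pow₀ (by norm_num)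
  have h4 : (4 : ℝ) ^ k = (2 ^ k) ^ 2 := by rw [← pow_mul, mul_comm, pow_mul]; norm_num
  have hD : (dirichletPoly (2 ^ k - 1)).eval y ^ 2 * (4 ^ k * (1 - y)) ≤ 2 := by
    have : (4 : ℝ) ^ k ≤ (2 * ((2 ^ k - 1 : ℕ) : ℝ) + 1) ^ 2 := by
      rw [hc, h4]; gcongr; linarith
    have h3 : (dirichletPoly (2 ^ k - 1)).eval y ^ 2 * (4 ^ k * (1 - y)) ≤
        (dirichletPoly (2 ^ k - 1)).eval y ^ 2 *
          ((2 * ((2 ^ k - 1 : ℕ) : ℝ) + 1) ^ 2 * (1 - y)) := by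
      gcongr
    linarith
  rw [scalePoly, eval_pow, ← pow_mul, mul_comm M 2, pow_mul, ← mul_pow]
  have : 0 ≤ 1 - y := by linarith
  exact pow_le_pow_left₀ (by positivity) hD M

theorem abs_one_sub_scalePoly_le (M k : ℕ) {y : ℝ} (h1 : -1 ≤ y) (h2 : y ≤ 1) :
    |1 - (scalePoly M k).eval y| ≤ M * (4 ^ k * (1 - y)) := by
  set D := (dirichletPoly (2 ^ k - 1)).eval y with hD
  have hab := abs_le.1 (abs_dirichletPoly_le_one (2 ^ k - 1) h1 h2)
  have hq : (scalePoly M k).eval y = D ^ M := by simp [scalePoly, hD]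
  have hle : |D ^ M| ≤ 1 := by
    rw [abs_pow]; exact pow_le_one₀ (abs_nonneg _) (abs_dirichletPoly_le_one _ h1 h2)
  rw [hq, abs_of_nonneg (by linarith [abs_le.1 hle])]
  have hb := one_add_mul_le_pow (a := D - 1) (by linarith [hab.1]) M
  have hd := one_sub_dirichletPoly_le (2 ^ k - 1) h1 h2
  have hk : (1 : ℕ) ≤ 2 ^ k := Nat.one_le_two_pow
  have hc : ((2 ^ k - 1 : ℕ) : ℝ) = 2 ^ k - 1 := by push_cast [hk]; ring
  have hk' : (1 : ℝ) ≤ 2 ^ k := one_le_pow₀ (by norm_num)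
  have h4 : (4 : ℝ) ^ k = (2 ^ k) ^ 2 := by rw [← pow_mul, mul_comm, pow_mul]; norm_num
  have hy : 0 ≤ 1 - y := by linarith
  have h5 : ((2 ^ k - 1 : ℕ) : ℝ) ^ 2 * (1 - y) ≤ 4 ^ k * (1 - y) := by
    rw [hc, h4]; gcongr
    linarith
  have h6 : 1 + (M : ℝ) * (D - 1) ≤ D ^ M := by simpa using hb
  have h7 : (M : ℝ) * (1 - D) ≤ M * (4 ^ k * (1 - y)) := by gcongr; linarith
  linarith

/-- The constant in the bounds on the band-pass filters `scalePoly M k - scalePoly M (k + 1)`. -/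
noncomputable def filterConst (M : ℕ) : ℝ := 50 * (M + 1) ^ 2 * 6 ^ M

theorem filterConst_pos (M : ℕ) : 0 < filterConst M := by unfold filterConst; positivity

theorem scalePoly_sq_mul_one_add_le (M k : ℕ) {y : ℝ} (h1 : -1 ≤ y) (h2 : y ≤ 1)
    (hy : 1 / 2 ≤ 4 ^ k * (1 - y)) :
    (scalePoly M k).eval y ^ 2 * (1 + 4 ^ k * (1 - y)) ^ (M + 1) ≤
      filterConst M * (4 ^ k * (1 - y)) := by
  have h := scalePoly_sq_mul_le M k h1 h2
  set z := 4 ^ k * (1 - y) with hz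
  calc (scalePoly M k).eval y ^ 2 * (1 + z) ^ (M + 1)
      ≤ (scalePoly M k).eval y ^ 2 * (3 * z) ^ (M + 1) := by gcongr; linarith
    _ = ((scalePoly M k).eval y ^ 2 * z ^ M) * (3 ^ (M + 1) * z) := by ring
    _ ≤ 2 ^ M * (3 ^ (M + 1) * z) := by gcongr
    _ = 3 * 6 ^ M * z := by
        rw [pow_succ, show (6 : ℝ) = 2 * 3 by norm_num, mul_pow]; ring
    _ ≤ filterConst M * z := by
        unfold filterConst
        gcongr
        nlinarith [(Nat.cast_nonneg M : (0 : ℝ) ≤ M)]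

theorem scalePoly_sub_sq_mul_one_add_le (M k : ℕ) {y : ℝ} (h1 : -1 ≤ y) (h2 : y ≤ 1) :
    ((scalePoly M k).eval y - (scalePoly M (k + 1)).eval y) ^ 2 *
      (1 + 4 ^ k * (1 - y)) ^ (M + 1) ≤ filterConst M * (4 ^ k * (1 - y)) := by
  have ha := scalePoly_sq_mul_le M k h1 h2
  have hb := scalePoly_sq_mul_le M (k + 1) h1 h2
  have ha1 := abs_one_sub_scalePoly_le M k h1 h2
  have hb1 := abs_one_sub_scalePoly_le M (k + 1) h1 h2
  have hz4 : (4 : ℝ) ^ (k + 1) * (1 - y) = 4 * (4 ^ k * (1 - y)) := by ring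
  rw [hz4] at hb hb1
  have hz0 : 0 ≤ 4 ^ k * (1 - y) := mul_nonneg (by positivity) (by linarith)
  set z := 4 ^ k * (1 - y) with hz
  set a := (scalePoly M k).eval y
  set b := (scalePoly M (k + 1)).eval y
  have h26 : (2 : ℝ) ^ M ≤ 6 ^ M := by gcongr; norm_num
  have hM : (0 : ℝ) ≤ M := Nat.cast_nonneg M
  rcases le_total z 1 with hz1 | hz1
  · have hab : |a - b| ≤ 5 * M * z := by
      have : a - b = (1 - b) - (1 - a) := by ring
      rw [this]
      refine (abs_sub _ _).trans ?_
      linarith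
    have hsq : (a - b) ^ 2 ≤ (5 * M * z) ^ 2 := by
      rw [← sq_abs]; gcongr
    calc (a - b) ^ 2 * (1 + z) ^ (M + 1) ≤ (5 * M * z) ^ 2 * 2 ^ (M + 1) := by
          gcongr; linarith
      _ = (50 * (M : ℝ) ^ 2 * 2 ^ M) * (z * z) := by ring
      _ ≤ (50 * (M + 1 : ℝ) ^ 2 * 6 ^ M) * (z * 1) := by
          gcongr
          · linarith
      _ = filterConst M * z := by unfold filterConst; ring
  · have hb' : b ^ 2 * z ^ M ≤ 2 ^ M := by
      refine le_trans ?_ hb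
      gcongr
      linarith
    have hab : (a - b) ^ 2 ≤ 2 * (a ^ 2 + b ^ 2) := by nlinarith [sq_nonneg (a + b)]
    calc (a - b) ^ 2 * (1 + z) ^ (M + 1) ≤ (2 * (a ^ 2 + b ^ 2)) * (2 * z) ^ (M + 1) := by
          gcongr; linarith
      _ = (a ^ 2 * z ^ M + b ^ 2 * z ^ M) * (4 * 2 ^ M * z) := by ring
      _ ≤ (2 ^ M + 2 ^ M) * (4 * 2 ^ M * z) := by gcongr
      _ = 8 * 4 ^ M * z := by
          rw [show (4 : ℝ) = 2 * 2 by norm_num, mul_pow]; ring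
      _ ≤ filterConst M * z := by
          unfold filterConst
          have : (4 : ℝ) ^ M ≤ 6 ^ M := by gcongr; norm_num
          gcongr
          nlinarith

/-- The band-pass filter at scale `2 ^ k` is divisible by `1 - X`, with a quotient of degree at most
`M 2 ^ (k + 1)`: this is what makes the potentials of the multiscale decomposition local. -/
theorem exists_bandPoly (M k : ℕ) : ∃ g : ℝ[X],
    (1 - X) * g = scalePoly M k - scalePoly M (k + 1) ∧ g.natDegree ≤ M * 2 ^ (k + 1) := by
  have hroot : (scalePoly M k - scalePoly M (k + 1)).IsRoot 1 := by
    simp [scalePoly_eval_one]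
  obtain ⟨g, hg⟩ := dvd_iff_isRoot.2 hroot
  refine ⟨-g, by rw [hg]; simp; ring, ?_⟩
  rw [natDegree_neg]
  by_cases h0 : g = 0
  · simp [h0]
  have hdeg : (scalePoly M k - scalePoly M (k + 1)).natDegree = 1 + g.natDegree := by
    rw [hg, natDegree_mul (X_sub_C_ne_zero 1) h0, natDegree_X_sub_C]
  have hle : (scalePoly M k - scalePoly M (k + 1)).natDegree ≤ M * 2 ^ (k + 1) := by
    refine (natDegree_sub_le _ _).trans (max_le ?_ (natDegree_scalePoly_le _ _))
    refine (natDegree_scalePoly_le _ _).trans ?_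
    gcongr <;> omega
  omega

end DirichletPolynomials

/-! ### The sine modes of the box -/

section SineModes

open Finset

theorem sin_half_mul_two_sum_cos (n : ℕ) (x : ℝ) :
    Real.sin (x / 2) * (2 * ∑ y ∈ range n, Real.cos (y * x)) =
      Real.sin (n * x - x / 2) + Real.sin (x / 2) := by
  induction n with
  | zero => simp
  | succ n ih =>
    rw [sum_range_succ]
    have h2 : (((n + 1 : ℕ) : ℝ) * x) - x / 2 = (n : ℝ) * x + x / 2 := by push_cast; ring
    rw [Real.sin_sub] at ih
    rw [h2, Real.sin_add]
    linear_combination ih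

theorem two_mul_sum_cos_pi {N : ℕ} {m : ℝ} (h0 : 0 < m) (h1 : m < 2 * N) (hs : Real.sin (Real.pi * m) = 0) :
    2 * ∑ y ∈ range N, Real.cos (y * (Real.pi * m / N)) = 1 - Real.cos (Real.pi * m) := by
  have hN : (0 : ℝ) < N := by linarith
  have hpos : 0 < Real.sin (Real.pi * m / N / 2) := by
    apply Real.sin_pos_of_pos_of_lt_pi
    · have := Real.pi_pos; positivity
    · rw [div_div, div_lt_iff₀ (by positivity)]
      have := mul_lt_mul_of_pos_left h1 Real.pi_pos
      linarith
  have h := sin_half_mul_two_sum_cos N (Real.pi * m / N)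
  have e : (N : ℝ) * (Real.pi * m / N) = Real.pi * m := by field_simp
  rw [e, Real.sin_sub, hs] at h
  apply mul_left_cancel₀ hpos.ne'
  rw [h]; ring

theorem sum_sin_mul_sin {N a b : ℕ} (ha : a ∈ Ioo 0 N) (hb : b ∈ Ioo 0 N) :
    ∑ y ∈ Ioo 0 N, Real.sin (Real.pi * a * y / N) * Real.sin (Real.pi * b * y / N) =
      if a = b then (N : ℝ) / 2 else 0 := by
  have hrange : ∑ y ∈ Ioo 0 N, Real.sin (Real.pi * a * y / N) * Real.sin (Real.pi * b * y / N) =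
      ∑ y ∈ range N, Real.sin (Real.pi * a * y / N) * Real.sin (Real.pi * b * y / N) := by
    refine sum_subset (fun y hy => ?_) fun y hy hy' => ?_
    · simp only [mem_Ioo, mem_range] at *; exact hy.2
    · have : y = 0 := by simp only [mem_Ioo, mem_range] at *; omega
      simp [this]
  rw [hrange]
  -- the case of two ordered frequencies; the cosines of the sum and of the difference both telescope
  have key : ∀ a b : ℕ, 0 < a → a ≤ b → b < N →
      ∑ y ∈ range N, Real.sin (Real.pi * a * y / N) * Real.sin (Real.pi * b * y / N) =
        if a = b then (N : ℝ) / 2 else 0 := by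
    intro a b h0 hab hbN
    have hN : (0 : ℝ) < N := by exact_mod_cast (by omega : 0 < N)
    have ht : ∀ y : ℕ, Real.sin (Real.pi * a * y / N) * Real.sin (Real.pi * b * y / N) =
        (Real.cos (y * (Real.pi * ((b : ℝ) - a) / N)) -
          Real.cos (y * (Real.pi * ((b : ℝ) + a) / N))) / 2 := by
      intro y
      have e1 : (y : ℝ) * (Real.pi * ((b : ℝ) - a) / N) =
        Real.pi * b * y / N - Real.pi * a * y / N := by ring
      have e2 : (y : ℝ) * (Real.pi * ((b : ℝ) + a) / N) =
        Real.pi * b * y / N + Real.pi * a * y / N := by ring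
      rw [e1, e2, Real.cos_sub, Real.cos_add]; ring
    simp only [ht]
    rw [← sum_div, sum_sub_distrib]
    have haR : (0 : ℝ) < a := by exact_mod_cast h0
    have hbR : (b : ℝ) < N := by exact_mod_cast hbN
    have habR : (a : ℝ) ≤ b := by exact_mod_cast hab
    have hadd := two_mul_sum_cos_pi (N := N) (m := (b : ℝ) + a) (by linarith) (by linarith)
      (by have := Real.sin_nat_mul_pi (b + a); push_cast at this; rw [mul_comm]; exact this)
    split_ifs with h
    · subst h
      have hc : Real.cos (Real.pi * ((a : ℝ) + a)) = 1 := by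
        have := Real.cos_nat_mul_two_pi a
        rw [← this]; ring_nf
      rw [hc] at hadd
      simp only [sub_self, mul_zero, zero_div, Real.cos_zero, sum_const, card_range, nsmul_eq_mul,
        mul_one]
      linarith
    · have hlt : (a : ℝ) < b := by exact_mod_cast lt_of_le_of_ne hab h
      have hsub := two_mul_sum_cos_pi (N := N) (m := (b : ℝ) - a) (by linarith) (by linarith)
        (by have := Real.sin_int_mul_pi ((b : ℤ) - a); push_cast at this; rw [mul_comm]; exact this)
      have hc : Real.cos (Real.pi * ((b : ℝ) - a)) = Real.cos (Real.pi * ((b : ℝ) + a)) := by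
        have := Real.cos_add_nat_mul_two_pi (Real.pi * ((b : ℝ) - a)) a
        rw [← this]; ring_nf
      rw [hc] at hsub
      linarith
  simp only [mem_Ioo] at ha hb
  rcases le_total a b with h | h
  · exact key a b ha.1 h hb.2
  · have := key b a hb.1 h ha.2
    rw [← ite_congr (propext ⟨Eq.symm, Eq.symm⟩ : (b = a) = (a = b)) (fun _ => rfl) fun _ => rfl,
      ← this]
    exact sum_congr rfl fun y _ => mul_comm _ _

variable {d : ℕ}

/-- The Dirichlet eigenfunctions of the box `{-L, …, L}^d`. They vanish when some coordinate is
`±(L + 1)`. -/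
noncomputable def sineMode (L : ℕ) (k : Fin d → ℕ) (x : Fin d → ℤ) : ℝ :=
  ∏ i, Real.sin (Real.pi * k i * ((x i : ℝ) + (L + 1)) / (2 * (L + 1)))

/-- The frequencies of the sine modes. -/
def modes (d L : ℕ) : Finset (Fin d → ℕ) := Fintype.piFinset fun _ => Ioo 0 (2 * (L + 1))

/-- The eigenvalue of the killed simple random walk at a sine mode. -/
noncomputable def modeEig (L : ℕ) (k : Fin d → ℕ) : ℝ :=
  (∑ i, Real.cos (Real.pi * k i / (2 * (L + 1)))) / d

/-- The box with its outer boundary, `{-L - 1, …, L + 1}^d`. -/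
def InClosedBox (L : ℕ) (x : Fin d → ℤ) : Prop := ∀ i, |x i| ≤ L + 1

theorem mem_box {L : ℕ} {x : Fin d → ℤ} : x ∈ box d L ↔ ∀ i, |x i| ≤ L := by
  simp only [_root_.box, mem_Icc, Pi.le_def, abs_le]
  exact ⟨fun h i => ⟨h.1 i, h.2 i⟩, fun h => ⟨fun i => (h i).1, fun i => (h i).2⟩⟩

theorem inClosedBox_of_mem_box {L : ℕ} {x : Fin d → ℤ} (hx : x ∈ box d L) : InClosedBox L x :=
  fun i => (mem_box.1 hx i).trans (by linarith)

theorem box_eq_piFinset (d L : ℕ) :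
    box d L = Fintype.piFinset fun _ : Fin d => Icc (-(L : ℤ)) (L : ℤ) := by
  ext x
  simp only [mem_box, Fintype.mem_piFinset, mem_Icc, abs_le]

theorem sineMode_eq_zero {L : ℕ} {x : Fin d → ℤ} (hx : InClosedBox L x) (hx' : x ∉ box d L)
    (k : Fin d → ℕ) : sineMode L k x = 0 := by
  rw [mem_box] at hx'
  push Not at hx'
  obtain ⟨i, hi⟩ := hx'
  refine prod_eq_zero (mem_univ i) ?_
  have h1 := hx i
  have habs : |x i| = L + 1 := by omega
  rcases (abs_eq (by positivity : (0 : ℤ) ≤ (L : ℤ) + 1)).1 habs with h | h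
  · rw [h]
    have : Real.pi * k i * ((((L : ℤ) + 1 : ℤ) : ℝ) + (L + 1)) / (2 * (L + 1)) = k i * Real.pi := by
      push_cast
      have : (L : ℝ) + 1 ≠ 0 := by positivity
      field_simp; ring
    rw [this]; exact Real.sin_nat_mul_pi _
  · rw [h]; simp

theorem abs_sineMode_le_one (L : ℕ) (k : Fin d → ℕ) (x : Fin d → ℤ) : |sineMode L k x| ≤ 1 := by
  rw [sineMode, abs_prod]
  exact prod_le_one (fun _ _ => abs_nonneg _) fun _ _ => Real.abs_sin_le_one _

theorem sum_int_Icc_eq (L : ℕ) (f : ℝ → ℝ) :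
    ∑ x ∈ Icc (-(L : ℤ)) (L : ℤ), f ((x : ℝ) + (L + 1)) = ∑ y ∈ Ioo 0 (2 * (L + 1)), f (y : ℕ) := by
  refine sum_nbij' (fun x => (x + (L + 1)).toNat) (fun y => (y : ℤ) - (L + 1)) ?_ ?_ ?_ ?_ ?_
  · intro x hx; simp only [mem_Icc, mem_Ioo] at *; omega
  · intro y hy; simp only [mem_Icc, mem_Ioo] at *; omega
  · intro x hx; simp only [mem_Icc] at hx; omega
  · intro y hy; simp
  · intro x hx
    simp only [mem_Icc] at hx
    have : (((x + (L + 1)).toNat : ℕ) : ℤ) = x + (L + 1) := Int.toNat_of_nonneg (by omega)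
    have h2 : (((x + (L + 1)).toNat : ℕ) : ℝ) = (x : ℝ) + (L + 1) := by exact_mod_cast this
    rw [h2]

theorem sum_sineMode_mul_sineMode {L : ℕ} {k l : Fin d → ℕ} (hk : k ∈ modes d L)
    (hl : l ∈ modes d L) :
    ∑ x ∈ box d L, sineMode L k x * sineMode L l x = if k = l then ((L : ℝ) + 1) ^ d else 0 := by
  simp only [modes, Fintype.mem_piFinset] at hk hl
  simp only [sineMode, ← prod_mul_distrib]
  rw [box_eq_piFinset, ← prod_univ_sum (fun _ => Icc (-(L : ℤ)) (L : ℤ))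
    (fun i y => Real.sin (Real.pi * k i * ((y : ℝ) + (L + 1)) / (2 * (L + 1))) *
      Real.sin (Real.pi * l i * ((y : ℝ) + (L + 1)) / (2 * (L + 1))))]
  have h : ∀ i, ∑ y ∈ Icc (-(L : ℤ)) (L : ℤ),
      Real.sin (Real.pi * k i * ((y : ℝ) + (L + 1)) / (2 * (L + 1))) *
      Real.sin (Real.pi * l i * ((y : ℝ) + (L + 1)) / (2 * (L + 1))) =
      if k i = l i then (L : ℝ) + 1 else 0 := by
    intro i
    rw [sum_int_Icc_eq L fun y => Real.sin (Real.pi * k i * y / (2 * (L + 1))) *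
      Real.sin (Real.pi * l i * y / (2 * (L + 1)))]
    have := sum_sin_mul_sin (hk i) (hl i)
    push_cast at this
    rw [this]
    congr 1; ring
  simp only [h]
  split_ifs with hkl
  · subst hkl; simp
  · obtain ⟨i, hi⟩ := Function.ne_iff.1 hkl
    exact prod_eq_zero (mem_univ i) (if_neg hi)

theorem sum_modes_sineMode {L : ℕ} {x y : Fin d → ℤ} (hx : x ∈ box d L) (hy : y ∈ box d L) :
    ∑ k ∈ modes d L, sineMode L k x * sineMode L k y = if x = y then ((L : ℝ) + 1) ^ d else 0 := by
  rw [mem_box] at hx hy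
  simp only [sineMode, ← prod_mul_distrib]
  rw [modes, ← prod_univ_sum (fun _ => Ioo 0 (2 * (L + 1)))
    (fun i m => Real.sin (Real.pi * (m : ℕ) * ((x i : ℝ) + (L + 1)) / (2 * (L + 1))) *
      Real.sin (Real.pi * m * ((y i : ℝ) + (L + 1)) / (2 * (L + 1))))]
  have h : ∀ i, ∑ m ∈ Ioo 0 (2 * (L + 1)),
      Real.sin (Real.pi * (m : ℕ) * ((x i : ℝ) + (L + 1)) / (2 * (L + 1))) *
      Real.sin (Real.pi * m * ((y i : ℝ) + (L + 1)) / (2 * (L + 1))) =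
      if x i = y i then (L : ℝ) + 1 else 0 := by
    intro i
    have hxi := abs_le.1 (hx i)
    have hyi := abs_le.1 (hy i)
    obtain ⟨a, ha⟩ := Int.eq_ofNat_of_zero_le (by omega : 0 ≤ x i + (L + 1))
    obtain ⟨b, hb⟩ := Int.eq_ofNat_of_zero_le (by omega : 0 ≤ y i + (L + 1))
    have haR : (x i : ℝ) + (L + 1) = a := by exact_mod_cast ha
    have hbR : (y i : ℝ) + (L + 1) = b := by exact_mod_cast hb
    have := sum_sin_mul_sin (N := 2 * (L + 1)) (a := a) (b := b)
      (by rw [mem_Ioo]; omega) (by rw [mem_Ioo]; omega)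
    push_cast at this
    rw [haR, hbR]
    have e : (a = b) = (x i = y i) := propext (by omega)
    simp only [e] at this
    rw [show (L : ℝ) + 1 = 2 * (L + 1) / 2 by ring, show (2 * (2 * ((L : ℝ) + 1) / 2)) = 2 * (L + 1) by ring,
      ← this]
    refine sum_congr rfl fun m _ => ?_
    congr 2 <;> ring
  simp only [h]
  split_ifs with hkl
  · subst hkl; simp
  · obtain ⟨i, hi⟩ := Function.ne_iff.1 hkl
    exact prod_eq_zero (mem_univ i) (if_neg hi)

/-- The negative of the graph Laplacian of `ℤ^d`. -/
noncomputable def negLaplacian (h : (Fin d → ℤ) → ℝ) (x : Fin d → ℤ) : ℝ :=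
  ∑ i, (2 * h x - h (x + Pi.single i 1) - h (x - Pi.single i 1))

theorem sineMode_add_add_sineMode_sub (L : ℕ) (k : Fin d → ℕ) (x : Fin d → ℤ) (i : Fin d) :
    sineMode L k (x + Pi.single i 1) + sineMode L k (x - Pi.single i 1) =
      2 * Real.cos (Real.pi * k i / (2 * (L + 1))) * sineMode L k x := by
  have hL : (2 * ((L : ℝ) + 1)) ≠ 0 := by positivity
  simp only [sineMode]
  rw [← mul_prod_erase univ _ (mem_univ i), ← mul_prod_erase univ _ (mem_univ i),
    ← mul_prod_erase univ (fun i => Real.sin (Real.pi * k i * ((x i : ℝ) + (L + 1)) /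
      (2 * (L + 1)))) (mem_univ i)]
  have h1 : ∏ j ∈ univ.erase i, Real.sin (Real.pi * k j *
        ((((x + Pi.single i 1 : Fin d → ℤ) j : ℤ) : ℝ) + (L + 1)) / (2 * (L + 1))) =
      ∏ j ∈ univ.erase i, Real.sin (Real.pi * k j * ((x j : ℝ) + (L + 1)) / (2 * (L + 1))) := by
    refine prod_congr rfl fun j hj => ?_
    simp [Pi.single_eq_of_ne (ne_of_mem_erase hj)]
  have h2 : ∏ j ∈ univ.erase i, Real.sin (Real.pi * k j *
        ((((x - Pi.single i 1 : Fin d → ℤ) j : ℤ) : ℝ) + (L + 1)) / (2 * (L + 1))) =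
      ∏ j ∈ univ.erase i, Real.sin (Real.pi * k j * ((x j : ℝ) + (L + 1)) / (2 * (L + 1))) := by
    refine prod_congr rfl fun j hj => ?_
    simp [Pi.single_eq_of_ne (ne_of_mem_erase hj)]
  rw [h1, h2, ← add_mul, ← mul_assoc]
  congr 1
  simp only [Pi.add_apply, Pi.sub_apply, Pi.single_eq_same, Int.cast_add, Int.cast_sub, Int.cast_one]
  have e1 : Real.pi * k i * ((x i : ℝ) + 1 + (L + 1)) / (2 * (L + 1)) =
      Real.pi * k i * ((x i : ℝ) + (L + 1)) / (2 * (L + 1)) + Real.pi * k i / (2 * (L + 1)) := by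
    ring
  have e2 : Real.pi * k i * ((x i : ℝ) - 1 + (L + 1)) / (2 * (L + 1)) =
      Real.pi * k i * ((x i : ℝ) + (L + 1)) / (2 * (L + 1)) - Real.pi * k i / (2 * (L + 1)) := by
    ring
  rw [e1, e2, Real.sin_add, Real.sin_sub]
  ring

theorem sum_sineMode_neighbours (hd : 1 ≤ d) (L : ℕ) (k : Fin d → ℕ) (x : Fin d → ℤ) :
    ∑ i, (sineMode L k (x + Pi.single i 1) + sineMode L k (x - Pi.single i 1)) =
      2 * d * modeEig L k * sineMode L k x := by
  simp only [sineMode_add_add_sineMode_sub]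
  rw [← sum_mul, ← mul_sum, modeEig]
  have : (d : ℝ) ≠ 0 := by positivity
  field_simp

theorem negLaplacian_sineMode (hd : 1 ≤ d) (L : ℕ) (k : Fin d → ℕ) (x : Fin d → ℤ) :
    negLaplacian (sineMode L k) x = 2 * d * (1 - modeEig L k) * sineMode L k x := by
  have := sum_sineMode_neighbours hd L k x
  simp only [negLaplacian, sub_sub, sum_sub_distrib, this]
  simp
  ring

/-- The function on the box with sine coefficients `c`, extended by zero. -/
noncomputable def sinePot (L : ℕ) (c : (Fin d → ℕ) → ℝ) (x : Fin d → ℤ) : ℝ :=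
  if x ∈ box d L then (((L : ℝ) + 1) ^ d)⁻¹ * ∑ k ∈ modes d L, c k * sineMode L k x else 0

theorem sinePot_of_inClosedBox {L : ℕ} (c : (Fin d → ℕ) → ℝ) {x : Fin d → ℤ}
    (hx : InClosedBox L x) :
    sinePot L c x = (((L : ℝ) + 1) ^ d)⁻¹ * ∑ k ∈ modes d L, c k * sineMode L k x := by
  unfold sinePot
  split_ifs with h
  · rfl
  · simp [sineMode_eq_zero hx h]

theorem inClosedBox_add_single {L : ℕ} {x : Fin d → ℤ} (hx : x ∈ box d L) (i : Fin d) :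
    InClosedBox L (x + Pi.single i 1) := by
  intro j
  have := mem_box.1 hx j
  by_cases h : j = i
  · subst h; simp only [Pi.add_apply, Pi.single_eq_same]; rw [abs_le] at *; omega
  · simp only [Pi.add_apply, Pi.single_eq_of_ne h]; rw [abs_le] at *; omega

theorem inClosedBox_sub_single {L : ℕ} {x : Fin d → ℤ} (hx : x ∈ box d L) (i : Fin d) :
    InClosedBox L (x - Pi.single i 1) := by
  intro j
  have := mem_box.1 hx j
  by_cases h : j = i
  · subst h; simp only [Pi.sub_apply, Pi.single_eq_same]; rw [abs_le] at *; omega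
  · simp only [Pi.sub_apply, Pi.single_eq_of_ne h]; rw [abs_le] at *; omega

theorem negLaplacian_sinePot (hd : 1 ≤ d) {L : ℕ} (c : (Fin d → ℕ) → ℝ) {x : Fin d → ℤ}
    (hx : x ∈ box d L) :
    negLaplacian (sinePot L c) x = (((L : ℝ) + 1) ^ d)⁻¹ *
      ∑ k ∈ modes d L, c k * (2 * d * (1 - modeEig L k)) * sineMode L k x := by
  have h : negLaplacian (sinePot L c) x = (((L : ℝ) + 1) ^ d)⁻¹ *
      ∑ k ∈ modes d L, c k * negLaplacian (sineMode L k) x := by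
    simp only [negLaplacian, sinePot_of_inClosedBox c (inClosedBox_of_mem_box hx),
      sinePot_of_inClosedBox c (inClosedBox_add_single hx _),
      sinePot_of_inClosedBox c (inClosedBox_sub_single hx _), mul_sum]
    rw [sum_comm]
    refine sum_congr rfl fun i _ => ?_
    rw [← sum_sub_distrib, ← sum_sub_distrib]
    exact sum_congr rfl fun k _ => by ring
  rw [h]
  congr 1
  refine sum_congr rfl fun k _ => ?_
  rw [negLaplacian_sineMode hd]; ring

theorem sum_sinePot_mul_negLaplacian (hd : 1 ≤ d) (L : ℕ) (c : (Fin d → ℕ) → ℝ) :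
    ∑ x ∈ box d L, sinePot L c x * negLaplacian (sinePot L c) x =
      (((L : ℝ) + 1) ^ d)⁻¹ * ∑ k ∈ modes d L, c k ^ 2 * (2 * d * (1 - modeEig L k)) := by
  have hL : (((L : ℝ) + 1) ^ d) ≠ 0 := by positivity
  have h : ∀ x ∈ box d L, sinePot L c x * negLaplacian (sinePot L c) x =
      ∑ k ∈ modes d L, ∑ l ∈ modes d L, (((L : ℝ) + 1) ^ d)⁻¹ ^ 2 *
        (c k * c l * (2 * d * (1 - modeEig L l)) * (sineMode L k x * sineMode L l x)) := by
    intro x hx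
    rw [negLaplacian_sinePot hd c hx, sinePot, if_pos hx, mul_mul_mul_comm, sum_mul_sum, mul_sum]
    refine sum_congr rfl fun k _ => ?_
    rw [mul_sum]
    exact sum_congr rfl fun l _ => by ring
  rw [sum_congr rfl h, sum_comm, mul_sum]
  refine sum_congr rfl fun k hk => ?_
  rw [sum_comm]
  have h2 : ∀ l ∈ modes d L, ∑ x ∈ box d L, (((L : ℝ) + 1) ^ d)⁻¹ ^ 2 *
        (c k * c l * (2 * d * (1 - modeEig L l)) * (sineMode L k x * sineMode L l x)) =
      if k = l then (((L : ℝ) + 1) ^ d)⁻¹ * (c k ^ 2 * (2 * d * (1 - modeEig L k))) else 0 := by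
    intro l hl
    rw [← mul_sum, ← mul_sum, sum_sineMode_mul_sineMode hk hl]
    split_ifs with hkl
    · subst hkl; field_simp
    · simp
  rw [sum_congr rfl h2, sum_ite_eq, if_pos hk]

theorem sum_mul_delta {L : ℕ} (u : (Fin d → ℤ) → ℝ) (hu : ∀ x, x ∉ box d L → u x = 0)
    {v : Fin d → ℤ} (hv : InClosedBox L v) :
    ∑ x ∈ box d L, u x * ((((L : ℝ) + 1) ^ d)⁻¹ *
      ∑ k ∈ modes d L, sineMode L k v * sineMode L k x) = u v := by
  have hL : (((L : ℝ) + 1) ^ d) ≠ 0 := by positivity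
  by_cases h : v ∈ box d L
  · rw [sum_congr rfl fun x hx => by rw [sum_modes_sineMode h hx]]
    rw [sum_eq_single_of_mem v h]
    · simp [hL]
    · intro x _ hxv
      simp [hxv.symm]
  · simp [sineMode_eq_zero hv h, hu v h]

/-- A polynomial of degree at most `R` in the killed walk has range `R`. -/
theorem sum_modes_eval_eq_zero (hd : 1 ≤ d) {L : ℕ} (g : Polynomial ℝ) {x v : Fin d → ℤ}
    (hx : InClosedBox L x) (hv : InClosedBox L v) {i : Fin d}
    (hi : (g.natDegree : ℤ) < |x i - v i|) :
    ∑ k ∈ modes d L, sineMode L k v * g.eval (modeEig L k) * sineMode L k x = 0 := by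
  have hpow : ∀ (j : ℕ) (x : Fin d → ℤ), InClosedBox L x → (∃ i, (j : ℤ) < |x i - v i|) →
      ∑ k ∈ modes d L, sineMode L k v * modeEig L k ^ j * sineMode L k x = 0 := by
    intro j
    induction j with
    | zero =>
      rintro x hx ⟨i, hi⟩
      by_cases hxb : x ∈ box d L
      · by_cases hvb : v ∈ box d L
        · have hne : v ≠ x := by rintro rfl; simp at hi
          simpa [hne] using sum_modes_sineMode hvb hxb
        · simp [sineMode_eq_zero hv hvb]
      · simp [sineMode_eq_zero hx hxb]
    | succ j ih =>
      rintro x hx ⟨i, hi⟩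
      by_cases hxb : x ∈ box d L
      · have hstep : 2 * d * ∑ k ∈ modes d L, sineMode L k v * modeEig L k ^ (j + 1) *
            sineMode L k x = ∑ i, (∑ k ∈ modes d L, sineMode L k v * modeEig L k ^ j *
              sineMode L k (x + Pi.single i 1) + ∑ k ∈ modes d L, sineMode L k v *
              modeEig L k ^ j * sineMode L k (x - Pi.single i 1)) := by
          simp only [← sum_add_distrib, ← mul_add]
          rw [sum_comm, mul_sum]
          refine sum_congr rfl fun k _ => ?_
          rw [← mul_sum, sum_sineMode_neighbours hd]
          ring
        have hz : ∑ i, (∑ k ∈ modes d L, sineMode L k v * modeEig L k ^ j *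
              sineMode L k (x + Pi.single i 1) + ∑ k ∈ modes d L, sineMode L k v *
              modeEig L k ^ j * sineMode L k (x - Pi.single i 1)) = 0 := by
          refine sum_eq_zero fun i' _ => ?_
          have e : ∀ z : ℤ, (z = 0 ∨ z = 1 ∨ z = -1) → (j : ℤ) < |x i + z - v i| := by
            intro z hz
            push_cast at hi
            rw [lt_abs] at *
            omega
          rw [ih _ (inClosedBox_add_single hxb i') ⟨i, ?_⟩,
            ih _ (inClosedBox_sub_single hxb i') ⟨i, ?_⟩, add_zero]
          · by_cases h : i = i'
            · subst h; simpa [sub_eq_add_neg] using e (-1) (by simp)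
            · simpa [Pi.single_eq_of_ne h] using e 0 (by simp)
          · by_cases h : i = i'
            · subst h; simpa using e 1 (by simp)
            · simpa [Pi.single_eq_of_ne h] using e 0 (by simp)
        rw [hz] at hstep
        have : (2 * (d : ℝ)) ≠ 0 := by positivity
        exact (mul_eq_zero.1 hstep).resolve_left this
      · simp [sineMode_eq_zero hx hxb]
  simp only [Polynomial.eval_eq_sum_range, mul_sum, sum_mul]
  rw [sum_comm]
  refine sum_eq_zero fun j hj => ?_
  have h := hpow j x hx ⟨i, lt_of_le_of_lt (by
    have := mem_range.1 hj; exact_mod_cast Nat.lt_succ_iff.1 this) hi⟩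
  calc ∑ k ∈ modes d L, sineMode L k v * (g.coeff j * modeEig L k ^ j) * sineMode L k x
      = g.coeff j * ∑ k ∈ modes d L, sineMode L k v * modeEig L k ^ j * sineMode L k x := by
        rw [mul_sum]; exact sum_congr rfl fun k _ => by ring
    _ = 0 := by rw [h, mul_zero]

end SineModes

/-! ### Multiscale decomposition of a difference of point evaluations -/

section Multiscale

open Finset

theorem abs_prod_sub_prod_le {ι : Type*} (s : Finset ι) (a b : ι → ℝ) (ha : ∀ i, |a i| ≤ 1)
    (hb : ∀ i, |b i| ≤ 1) : |∏ i ∈ s, a i - ∏ i ∈ s, b i| ≤ ∑ i ∈ s, |a i - b i| := by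
  classical
  induction s using Finset.induction_on with
  | empty => simp
  | insert i s hi ih =>
    rw [prod_insert hi, prod_insert hi, sum_insert hi]
    have e : a i * ∏ j ∈ s, a j - b i * ∏ j ∈ s, b j =
        (a i - b i) * ∏ j ∈ s, a j + b i * (∏ j ∈ s, a j - ∏ j ∈ s, b j) := by ring
    rw [e]
    refine (abs_add_le _ _).trans ?_
    rw [abs_mul, abs_mul]
    have hp : |∏ j ∈ s, a j| ≤ 1 := by
      rw [abs_prod]; exact prod_le_one (fun _ _ => abs_nonneg _) fun j _ => ha j
    have h1 : |a i - b i| * |∏ j ∈ s, a j| ≤ |a i - b i| * 1 := by gcongr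
    have h2 : |b i| * |∏ j ∈ s, a j - ∏ j ∈ s, b j| ≤ 1 * ∑ i ∈ s, |a i - b i| := by
      gcongr
      exact hb i
    linarith

theorem abs_sin_sub_sin_le (x y : ℝ) : |Real.sin x - Real.sin y| ≤ |x - y| := by
  rw [Real.sin_sub_sin]
  rw [abs_mul, abs_mul, abs_two]
  have h1 : |Real.sin ((x - y) / 2)| ≤ |(x - y) / 2| := Real.abs_sin_le_abs
  have h2 := Real.abs_cos_le_one ((x + y) / 2)
  rw [abs_div, abs_two] at h1
  nlinarith [abs_nonneg (Real.sin ((x - y) / 2)), abs_nonneg (Real.cos ((x + y) / 2))]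

theorem sum_inv_one_add_sq_le {A : ℝ} (hA : 0 < A) (n : ℕ) :
    ∑ k ∈ Ioo 0 n, (1 + ((k : ℝ) / A) ^ 2)⁻¹ ≤ 2 * A := by
  have hind : ∀ m : ℕ, ∑ k ∈ range m, (1 + (((k + 1 : ℕ) : ℝ) / A) ^ 2)⁻¹ ≤
      2 * A - 2 * A ^ 2 / (A + m) := by
    intro m
    induction m with
    | zero => simp; field_simp; simp
    | succ m ih =>
      rw [sum_range_succ]
      have hm : (0 : ℝ) ≤ m := Nat.cast_nonneg m
      have : (1 + (((m + 1 : ℕ) : ℝ) / A) ^ 2)⁻¹ ≤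
          2 * A ^ 2 / (A + m) - 2 * A ^ 2 / (A + (m + 1 : ℕ)) := by
        push_cast
        have e : 2 * A ^ 2 / (A + m) - 2 * A ^ 2 / (A + (m + 1)) =
            2 * A ^ 2 / ((A + m) * (A + (m + 1))) := by
          have : A + m ≠ 0 := by positivity
          have : A + (m + 1) ≠ 0 := by positivity
          field_simp; ring
        have e2 : (1 + (((m : ℝ) + 1) / A) ^ 2)⁻¹ = A ^ 2 / (A ^ 2 + (m + 1) ^ 2) := by
          field_simp
        rw [e, e2, div_le_div_iff₀ (by positivity) (by positivity)]
        have h : (A + m) * (A + (m + 1)) ≤ 2 * (A ^ 2 + (m + 1) ^ 2) := by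
          nlinarith [sq_nonneg (A - (m + 1))]
        nlinarith [mul_le_mul_of_nonneg_left h (sq_nonneg A)]
      linarith
  have e : ∑ k ∈ Ioo 0 n, (1 + ((k : ℝ) / A) ^ 2)⁻¹ =
      ∑ k ∈ range (n - 1), (1 + (((k + 1 : ℕ) : ℝ) / A) ^ 2)⁻¹ := by
    have : Ioo 0 n = Ico 1 n := by ext; simp only [mem_Ioo, mem_Ico]; omega
    rw [this, sum_Ico_eq_sum_range]
    exact sum_congr rfl fun k _ => by rw [add_comm 1 k]
  rw [e]
  have : 0 ≤ 2 * A ^ 2 / (A + (n - 1 : ℕ)) := by positivity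
  linarith [hind (n - 1)]

variable {d : ℕ}

theorem abs_sineMode_sub_le (L : ℕ) (k : Fin d → ℕ) {v w : Fin d → ℤ} {D : ℝ}
    (hD : ∀ i, |((v i - w i : ℤ) : ℝ)| ≤ D) :
    |sineMode L k v - sineMode L k w| ≤ Real.pi * D / (2 * (L + 1)) * ∑ i, (k i : ℝ) := by
  refine (abs_prod_sub_prod_le _ _ _ (fun _ => Real.abs_sin_le_one _)
    fun _ => Real.abs_sin_le_one _).trans ?_
  rw [mul_sum]
  refine sum_le_sum fun i _ => (abs_sin_sub_sin_le _ _).trans ?_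
  have e : Real.pi * k i * ((v i : ℝ) + (L + 1)) / (2 * (L + 1)) -
      Real.pi * k i * ((w i : ℝ) + (L + 1)) / (2 * (L + 1)) =
      Real.pi * k i / (2 * (L + 1)) * ((v i - w i : ℤ) : ℝ) := by push_cast; ring
  have hp : 0 ≤ Real.pi * k i / (2 * ((L : ℝ) + 1)) := by have := Real.pi_pos; positivity
  rw [e, abs_mul, abs_of_nonneg hp]
  calc Real.pi * k i / (2 * ((L : ℝ) + 1)) * |((v i - w i : ℤ) : ℝ)|
      ≤ Real.pi * k i / (2 * ((L : ℝ) + 1)) * D := by gcongr; exact hD i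
    _ = Real.pi * D / (2 * (L + 1)) * k i := by ring

theorem one_sub_modeEig_ge (hd : 1 ≤ d) {L : ℕ} {k : Fin d → ℕ} (hk : k ∈ modes d L) :
    2 / d * ∑ i, ((k i : ℝ) / (2 * (L + 1))) ^ 2 ≤ 1 - modeEig L k := by
  have hd' : (0 : ℝ) < d := by positivity
  simp only [modes, Fintype.mem_piFinset, mem_Ioo] at hk
  have h : ∑ i, 2 * ((k i : ℝ) / (2 * (L + 1))) ^ 2 ≤
      ∑ i : Fin d, (1 - Real.cos (Real.pi * k i / (2 * (L + 1)))) := by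
    refine sum_le_sum fun i _ => ?_
    set y := (k i : ℝ) / (2 * (L + 1)) with hy
    have hy0 : 0 ≤ y := by positivity
    have hy1 : y ≤ 1 := by
      rw [hy, div_le_one (by positivity)]
      have := (hk i).2.le
      exact_mod_cast this
    have e : Real.pi * k i / (2 * (L + 1)) = Real.pi * y := by rw [hy]; ring
    rw [e]
    have hc := Real.cos_le_one_sub_mul_cos_sq (x := Real.pi * y)
      (by rw [abs_of_nonneg (by have := Real.pi_pos; positivity)]
          nlinarith [Real.pi_pos])
    have : 2 / Real.pi ^ 2 * (Real.pi * y) ^ 2 = 2 * y ^ 2 := by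
      have := Real.pi_ne_zero
      field_simp
    rw [this] at hc
    linarith
  rw [sum_sub_distrib] at h
  simp only [sum_const, card_univ, Fintype.card_fin, nsmul_eq_mul, mul_one] at h
  rw [← mul_sum] at h
  rw [modeEig, div_mul_eq_mul_div, div_le_iff₀ hd', sub_mul, div_mul_cancel₀ _ hd'.ne']
  linarith

theorem modeEig_mem (hd : 1 ≤ d) (L : ℕ) (k : Fin d → ℕ) :
    -1 ≤ modeEig L k ∧ modeEig L k ≤ 1 := by
  have hd' : (0 : ℝ) < d := by positivity
  rw [← abs_le, modeEig, abs_div, abs_of_pos hd', div_le_one hd']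
  refine (abs_sum_le_sum_abs _ _).trans ?_
  calc ∑ i : Fin d, |Real.cos (Real.pi * k i / (2 * (L + 1)))| ≤ ∑ i : Fin d, 1 :=
        sum_le_sum fun _ _ => Real.abs_cos_le_one _
    _ = d := by simp

/-- The constant in the on-diagonal bound `sum_sineMode_sub_sq_le`. -/
noncomputable def kernelConst (d : ℕ) : ℝ := 10 * d ^ (d + 2) * 4 ^ d

theorem sineMode_sub_sq_le (hd : 1 ≤ d) (L : ℕ) (k : Fin d → ℕ) {v w : Fin d → ℤ} {D : ℝ}
    (hD : ∀ i, |((v i - w i : ℤ) : ℝ)| ≤ D) {s : ℝ} (hs : 0 < s) :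
    (sineMode L k v - sineMode L k w) ^ 2 ≤
      10 * d * min 1 (D / s) ^ 2 * (1 + ∑ i, (s * (k i / (2 * (L + 1)))) ^ 2) := by
  have hd1 : (1 : ℝ) ≤ d := by exact_mod_cast hd
  have hD0 : 0 ≤ D := (abs_nonneg _).trans (hD ⟨0, hd⟩)
  set U := ∑ i : Fin d, (s * ((k i : ℝ) / (2 * (L + 1)))) ^ 2 with hU
  have hU0 : 0 ≤ U := sum_nonneg fun _ _ => sq_nonneg _
  rcases le_total 1 (D / s) with h | h
  · rw [min_eq_left h]
    have h1 := abs_le.1 (abs_sineMode_le_one L k v)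
    have h2 := abs_le.1 (abs_sineMode_le_one L k w)
    have : (sineMode L k v - sineMode L k w) ^ 2 ≤ 4 := by nlinarith
    nlinarith
  · rw [min_eq_right h]
    have h1 := abs_sineMode_sub_le L k hD
    have hcs : (∑ i : Fin d, s * ((k i : ℝ) / (2 * (L + 1)))) ^ 2 ≤ d * U := by
      have := sq_sum_le_card_mul_sum_sq (s := (univ : Finset (Fin d)))
        (f := fun i => s * ((k i : ℝ) / (2 * (L + 1))))
      simpa using this
    have e : Real.pi * D / (2 * (L + 1)) * ∑ i, (k i : ℝ) =
        Real.pi * (D / s) * ∑ i : Fin d, s * ((k i : ℝ) / (2 * (L + 1))) := by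
      rw [← mul_sum, ← sum_div]
      field_simp
    have hpi : Real.pi ^ 2 ≤ 10 := by nlinarith [Real.pi_lt_d2, Real.pi_pos]
    calc (sineMode L k v - sineMode L k w) ^ 2
        ≤ (Real.pi * (D / s) * ∑ i : Fin d, s * ((k i : ℝ) / (2 * (L + 1)))) ^ 2 := by
          rw [← sq_abs, ← e]; gcongr
      _ = Real.pi ^ 2 * (D / s) ^ 2 * (∑ i : Fin d, s * ((k i : ℝ) / (2 * (L + 1)))) ^ 2 := by ring
      _ ≤ 10 * (D / s) ^ 2 * (d * U) := by gcongr
      _ = 10 * d * (D / s) ^ 2 * U := by ring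
      _ ≤ 10 * d * (D / s) ^ 2 * (1 + U) := by gcongr; linarith

/-- A smoothed on-diagonal Green kernel bound. The first alternative in the minimum is the heat kernel
decay at scale `s`, the second one the gain from taking a difference over a distance `D`. -/
theorem sum_sineMode_sub_sq_le (hd : 1 ≤ d) (L : ℕ) {v w : Fin d → ℤ} {D : ℝ}
    (hD : ∀ i, |((v i - w i : ℤ) : ℝ)| ≤ D) {s : ℝ} (hs : 0 < s) :
    (((L : ℝ) + 1) ^ d)⁻¹ * ∑ k ∈ modes d L, (sineMode L k v - sineMode L k w) ^ 2 *
      ((1 + s ^ 2 * (1 - modeEig L k)) ^ (d + 1))⁻¹ ≤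
      kernelConst d * min 1 (D / s) ^ 2 * (s ^ d)⁻¹ := by
  have hd1 : (1 : ℝ) ≤ d := by exact_mod_cast hd
  have hd0 : (0 : ℝ) < d := by linarith
  set m := min 1 (D / s) ^ 2 with hm
  have hm0 : 0 ≤ m := sq_nonneg _
  have hterm : ∀ k ∈ modes d L, (sineMode L k v - sineMode L k w) ^ 2 *
      ((1 + s ^ 2 * (1 - modeEig L k)) ^ (d + 1))⁻¹ ≤
      10 * d ^ (d + 2) * m * ∏ i : Fin d, (1 + ((k i : ℝ) / (2 * (L + 1) / s)) ^ 2)⁻¹ := by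
    intro k hk
    set U := ∑ i : Fin d, (s * ((k i : ℝ) / (2 * (L + 1)))) ^ 2 with hU
    have hU0 : 0 ≤ U := sum_nonneg fun _ _ => sq_nonneg _
    have h1 : (sineMode L k v - sineMode L k w) ^ 2 ≤ 10 * d * m * (1 + U) :=
      sineMode_sub_sq_le hd L k hD hs
    have h2 : (1 + U) / d ≤ 1 + s ^ 2 * (1 - modeEig L k) := by
      have h3 := mul_le_mul_of_nonneg_left (one_sub_modeEig_ge hd hk) (sq_nonneg s)
      have e : s ^ 2 * (2 / d * ∑ i, ((k i : ℝ) / (2 * (L + 1))) ^ 2) = 2 * U / d := by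
        rw [hU]; simp only [mul_pow, ← mul_sum]; ring
      rw [e] at h3
      have h4 : 1 / (d : ℝ) ≤ 1 := by rw [div_le_one hd0]; exact hd1
      have h5 : U / d ≤ 2 * U / d := by gcongr; linarith
      rw [add_div]; linarith
    have h3 : ((1 + s ^ 2 * (1 - modeEig L k)) ^ (d + 1))⁻¹ ≤ (((1 + U) / d) ^ (d + 1))⁻¹ := by
      gcongr
    have h4 : ((1 + U) ^ d)⁻¹ ≤ ∏ i : Fin d, (1 + ((k i : ℝ) / (2 * (L + 1) / s)) ^ 2)⁻¹ := by
      rw [prod_inv_distrib]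
      apply inv_anti₀
      · exact prod_pos fun i _ => by positivity
      · have : ∀ i ∈ (univ : Finset (Fin d)), (1 + ((k i : ℝ) / (2 * (L + 1) / s)) ^ 2) ≤ 1 + U := by
          intro i hi
          have e : ((k i : ℝ) / (2 * (L + 1) / s)) = s * ((k i : ℝ) / (2 * (L + 1))) := by
            field_simp
          rw [e]
          have := single_le_sum (f := fun i : Fin d => (s * ((k i : ℝ) / (2 * (L + 1)))) ^ 2)
            (fun _ _ => sq_nonneg _) hi
          simpa [hU] using this
        have h := prod_le_prod (s := (univ : Finset (Fin d))) (fun i _ => by positivity) this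
        simpa using h
    calc (sineMode L k v - sineMode L k w) ^ 2 * ((1 + s ^ 2 * (1 - modeEig L k)) ^ (d + 1))⁻¹
        ≤ (10 * d * m * (1 + U)) * (((1 + U) / d) ^ (d + 1))⁻¹ := by
          have : 0 ≤ 1 + s ^ 2 * (1 - modeEig L k) := le_trans (by positivity) h2
          exact mul_le_mul h1 h3 (by positivity) (by positivity)
      _ = 10 * d ^ (d + 2) * m * ((1 + U) ^ d)⁻¹ := by
          have : 1 + U ≠ 0 := by positivity
          rw [div_pow]
          field_simp
          ring
      _ ≤ _ := by gcongr
  have hsum : ∑ k ∈ modes d L, ∏ i : Fin d, (1 + ((k i : ℝ) / (2 * (L + 1) / s)) ^ 2)⁻¹ ≤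
      (2 * (2 * (L + 1) / s)) ^ d := by
    rw [modes, ← prod_univ_sum (fun _ => Ioo 0 (2 * (L + 1)))
      (fun _ n => (1 + (((n : ℕ) : ℝ) / (2 * (L + 1) / s)) ^ 2)⁻¹)]
    have h := prod_le_prod (s := (univ : Finset (Fin d)))
      (f := fun _ => ∑ n ∈ Ioo 0 (2 * (L + 1)), (1 + (((n : ℕ) : ℝ) / (2 * (L + 1) / s)) ^ 2)⁻¹)
      (g := fun _ => 2 * (2 * ((L : ℝ) + 1) / s)) (fun i _ => sum_nonneg fun _ _ => by positivity)
      (fun i _ => sum_inv_one_add_sq_le (by positivity) _)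
    simpa using h
  calc (((L : ℝ) + 1) ^ d)⁻¹ * ∑ k ∈ modes d L, (sineMode L k v - sineMode L k w) ^ 2 *
        ((1 + s ^ 2 * (1 - modeEig L k)) ^ (d + 1))⁻¹
      ≤ (((L : ℝ) + 1) ^ d)⁻¹ * ∑ k ∈ modes d L, 10 * d ^ (d + 2) * m *
        ∏ i : Fin d, (1 + ((k i : ℝ) / (2 * (L + 1) / s)) ^ 2)⁻¹ := by
        exact mul_le_mul_of_nonneg_left (sum_le_sum hterm) (by positivity)
    _ ≤ (((L : ℝ) + 1) ^ d)⁻¹ * (10 * d ^ (d + 2) * m * (2 * (2 * (L + 1) / s)) ^ d) := by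
        rw [← mul_sum]; gcongr
    _ = kernelConst d * m * (s ^ d)⁻¹ := by
        have : (2 * (2 * ((L : ℝ) + 1) / s)) = 4 * (L + 1) / s := by ring
        rw [this, div_pow, mul_pow, kernelConst]
        field_simp

/-- If the spectral multiplier `m` is a filter at scale `2 ^ j`, then the potential with multiplier `m`
of the difference of two point charges has Dirichlet energy of order `2 ^ (j (2 - d))`. -/
theorem energy_sinePot_le (hd : 1 ≤ d) (L j : ℕ) {v w : Fin d → ℤ} {D : ℝ}
    (hD : ∀ i, |((v i - w i : ℤ) : ℝ)| ≤ D) (m : (Fin d → ℕ) → ℝ) {F : ℝ} (hF : 0 ≤ F)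
    (hm : ∀ k ∈ modes d L, m k ^ 2 * (2 * d * (1 - modeEig L k)) *
      (1 + 4 ^ j * (1 - modeEig L k)) ^ (d + 1) ≤ F * 4 ^ j) :
    ∑ x ∈ box d L, sinePot L (fun k => (sineMode L k v - sineMode L k w) * m k) x *
      negLaplacian (sinePot L fun k => (sineMode L k v - sineMode L k w) * m k) x ≤
      F * kernelConst d * (4 ^ j * ((2 ^ j) ^ d)⁻¹ * min 1 (D / 2 ^ j) ^ 2) := by
  rw [sum_sinePot_mul_negLaplacian hd]
  have h4 : ((2 : ℝ) ^ j) ^ 2 = 4 ^ j := by rw [← pow_mul, mul_comm, pow_mul]; norm_num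
  have hk := sum_sineMode_sub_sq_le hd L hD (s := 2 ^ j) (by positivity)
  rw [h4] at hk
  have hle : ∀ k ∈ modes d L, ((sineMode L k v - sineMode L k w) * m k) ^ 2 *
      (2 * d * (1 - modeEig L k)) ≤ F * 4 ^ j * ((sineMode L k v - sineMode L k w) ^ 2 *
      ((1 + 4 ^ j * (1 - modeEig L k)) ^ (d + 1))⁻¹) := by
    intro k hk
    have hpos : 0 < (1 + 4 ^ j * (1 - modeEig L k)) ^ (d + 1) := by
      have : 0 ≤ 1 - modeEig L k := by linarith [(modeEig_mem hd L k).2]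
      positivity
    have := hm k hk
    rw [← le_div_iff₀ hpos] at this
    calc ((sineMode L k v - sineMode L k w) * m k) ^ 2 * (2 * d * (1 - modeEig L k))
        = (sineMode L k v - sineMode L k w) ^ 2 * (m k ^ 2 * (2 * d * (1 - modeEig L k))) := by ring
      _ ≤ (sineMode L k v - sineMode L k w) ^ 2 *
          (F * 4 ^ j / (1 + 4 ^ j * (1 - modeEig L k)) ^ (d + 1)) := by gcongr
      _ = _ := by rw [div_eq_mul_inv]; ring
  calc (((L : ℝ) + 1) ^ d)⁻¹ * ∑ k ∈ modes d L, ((sineMode L k v - sineMode L k w) * m k) ^ 2 *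
        (2 * d * (1 - modeEig L k))
      ≤ (((L : ℝ) + 1) ^ d)⁻¹ * ∑ k ∈ modes d L, F * 4 ^ j *
        ((sineMode L k v - sineMode L k w) ^ 2 *
        ((1 + 4 ^ j * (1 - modeEig L k)) ^ (d + 1))⁻¹) := by
        exact mul_le_mul_of_nonneg_left (sum_le_sum hle) (by positivity)
    _ = F * 4 ^ j * ((((L : ℝ) + 1) ^ d)⁻¹ * ∑ k ∈ modes d L,
        (sineMode L k v - sineMode L k w) ^ 2 *
        ((1 + 4 ^ j * (1 - modeEig L k)) ^ (d + 1))⁻¹) := by rw [← mul_sum]; ring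
    _ ≤ F * 4 ^ j * (kernelConst d * min 1 (D / 2 ^ j) ^ 2 * ((2 ^ j) ^ d)⁻¹) := by gcongr
    _ = _ := by ring

end Multiscale

section Decomposition

open Finset

variable {d : ℕ}

theorem one_sub_modeEig_ge_inv_sq (hd : 1 ≤ d) {L : ℕ} {k : Fin d → ℕ} (hk : k ∈ modes d L) :
    2 / (2 * ((L : ℝ) + 1)) ^ 2 ≤ 1 - modeEig L k := by
  refine le_trans ?_ (one_sub_modeEig_ge hd hk)
  simp only [modes, Fintype.mem_piFinset, mem_Ioo] at hk
  have hd0 : (0 : ℝ) < d := by positivity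
  have h : ∑ i : Fin d, (1 / (2 * ((L : ℝ) + 1))) ^ 2 ≤
      ∑ i : Fin d, ((k i : ℝ) / (2 * (L + 1))) ^ 2 := by
    refine sum_le_sum fun i _ => ?_
    have : (1 : ℝ) ≤ k i := by exact_mod_cast (hk i).1
    gcongr
  simp only [sum_const, card_univ, Fintype.card_fin, nsmul_eq_mul] at h
  calc 2 / (2 * ((L : ℝ) + 1)) ^ 2 = 2 / d * (d * (1 / (2 * ((L : ℝ) + 1))) ^ 2) := by
        field_simp
    _ ≤ _ := by gcongr

/-- The index of the coarsest scale of the box: `2 ^ topScale L` is comparable to `L`. -/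
def topScale (L : ℕ) : ℕ := Nat.log 2 (2 * (L + 1))

theorem two_pow_topScale_le (L : ℕ) : 2 ^ topScale L ≤ 2 * (L + 1) :=
  Nat.pow_log_le_self 2 (by omega)

theorem lt_two_pow_topScale (L : ℕ) : L + 1 < 2 ^ topScale L := by
  have h : 2 * (L + 1) < 2 ^ (topScale L + 1) := Nat.lt_pow_succ_log_self (by norm_num) _
  rw [pow_succ] at h
  omega

open Classical in
theorem card_filter_near_le (L R : ℕ) (v : Fin d → ℤ) :
    #{x ∈ box d L | ∀ i, |x i - v i| ≤ (R : ℤ)} ≤ (2 * R + 1) ^ d := by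
  calc #{x ∈ box d L | ∀ i, |x i - v i| ≤ (R : ℤ)}
      ≤ #(Fintype.piFinset fun i => Icc (v i - R) (v i + R)) := by
        refine card_le_card fun x hx => ?_
        simp only [mem_filter, Fintype.mem_piFinset, mem_Icc] at hx ⊢
        intro i
        have := abs_le.1 (hx.2 i)
        omega
    _ = (2 * R + 1) ^ d := by
        rw [Fintype.card_piFinset]
        have : ∀ i, #(Icc (v i - R) (v i + R)) = 2 * R + 1 := by
          intro i; rw [Int.card_Icc]; omega
        simp [this]

/-- The constant in the bound on the support of the potential at scale `2 ^ j`. -/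
def supportConst (d : ℕ) : ℕ := 2 * (5 * d) ^ d

open Classical in
/-- The difference of the point evaluations at `v` and `w` is a sum, over the dyadic scales up to the
size of the box, of the Laplacians of potentials `h j` supported in `O(2 ^ (j d))` points. Their
energy has the order of a unit charge at scale `2 ^ j`, reduced at scales above the distance of
`v` and `w`. -/
theorem exists_multiscale_potentials (hd : 1 ≤ d) (L : ℕ) {v w : Fin d → ℤ} {D : ℝ}
    (hv : InClosedBox L v) (hw : InClosedBox L w) (hD : ∀ i, |((v i - w i : ℤ) : ℝ)| ≤ D) :
    ∃ h : ℕ → (Fin d → ℤ) → ℝ,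
      (∀ j x, x ∉ box d L → h j x = 0) ∧
      (∀ j ≤ topScale L, ∑ x ∈ box d L, h j x * negLaplacian (h j) x ≤
        filterConst d * kernelConst d * (4 ^ j * ((2 ^ j) ^ d)⁻¹ * min 1 (D / 2 ^ j) ^ 2)) ∧
      (∀ j ≤ topScale L, #{x ∈ box d L | h j x ≠ 0} ≤ supportConst d * (2 ^ j) ^ d) ∧
      ∀ u : (Fin d → ℤ) → ℝ, (∀ x, x ∉ box d L → u x = 0) →
        ∑ j ∈ range (topScale L + 1), ∑ x ∈ box d L, u x * negLaplacian (h j) x = u v - u w := by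
  choose g hg hdeg using exists_bandPoly d
  set J := topScale L with hJ
  have hd0 : (0 : ℝ) < d := by positivity
  have hd1 : (1 : ℝ) ≤ d := by exact_mod_cast hd
  -- evaluated form of the divisibility of the band-pass filters
  have hgev : ∀ j y, (1 - y) * (g j).eval y =
      (scalePoly d j).eval y - (scalePoly d (j + 1)).eval y := by
    intro j y
    have := congrArg (Polynomial.eval y) (hg j)
    simpa using this
  have hlam : ∀ k ∈ modes d L, 0 < 1 - modeEig L k := fun k hk =>
    lt_of_lt_of_le (by positivity) (one_sub_modeEig_ge_inv_sq hd hk)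
  let m : ℕ → (Fin d → ℕ) → ℝ := fun j k =>
    if j < J then (g j).eval (modeEig L k) / (2 * d)
    else (scalePoly d J).eval (modeEig L k) / (2 * d * (1 - modeEig L k))
  refine ⟨fun j => sinePot L fun k => (sineMode L k v - sineMode L k w) * m j k, ?_, ?_, ?_, ?_⟩
  · intro j x hx
    simp [sinePot, hx]
  · intro j hj
    refine energy_sinePot_le hd L j hD (m j) (filterConst_pos d).le fun k hk => ?_
    obtain ⟨e1, e2⟩ := modeEig_mem hd L k
    have hl := hlam k hk
    have h2d : (1 : ℝ) ≤ 2 * d := by linarith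
    have hF := filterConst_pos d
    -- both cases reduce to a bound on `(multiplier * 2d (1 - y)) ^ 2 / (2d (1 - y))`
    have key : ∀ a : ℝ, a ^ 2 * (1 + 4 ^ j * (1 - modeEig L k)) ^ (d + 1) ≤
        filterConst d * (4 ^ j * (1 - modeEig L k)) →
        a ^ 2 / (2 * d * (1 - modeEig L k)) * (1 + 4 ^ j * (1 - modeEig L k)) ^ (d + 1) ≤
        filterConst d * 4 ^ j := by
      intro a ha
      rw [div_mul_eq_mul_div, div_le_iff₀ (by positivity)]
      refine ha.trans ?_
      have : filterConst d * 4 ^ j * (1 - modeEig L k) * 1 ≤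
          filterConst d * 4 ^ j * (1 - modeEig L k) * (2 * d) := by gcongr
      linarith
    by_cases hjJ : j < J
    · have := key _ (scalePoly_sub_sq_mul_one_add_le d j e1 e2)
      rw [← hgev] at this
      convert this using 2
      simp only [m, if_pos hjJ]
      field_simp
    · have hjJ' : j = J := le_antisymm hj (not_lt.1 hjJ)
      subst hjJ'
      have hhalf : 1 / 2 ≤ (4 : ℝ) ^ J * (1 - modeEig L k) := by
        have h1 := one_sub_modeEig_ge_inv_sq hd hk
        have h2 : ((L : ℝ) + 1) ≤ 2 ^ J := by exact_mod_cast (lt_two_pow_topScale L).le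
        have h4 : ((2 : ℝ) ^ J) ^ 2 = 4 ^ J := by rw [← pow_mul, mul_comm, pow_mul]; norm_num
        calc (1 : ℝ) / 2 = ((L : ℝ) + 1) ^ 2 * (2 / (2 * ((L : ℝ) + 1)) ^ 2) := by
              field_simp
          _ ≤ (2 ^ J) ^ 2 * (1 - modeEig L k) := by gcongr
          _ = _ := by rw [h4]
      have := key _ (scalePoly_sq_mul_one_add_le d J e1 e2 hhalf)
      convert this using 2
      simp only [m, if_neg hjJ]
      field_simp
  · intro j hj
    by_cases hjJ : j < J
    · set R := d * 2 ^ (j + 1) with hR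
      have hsub : {x ∈ box d L | sinePot L (fun k => (sineMode L k v - sineMode L k w) * m j k) x ≠ 0}
          ⊆ {x ∈ box d L | ∀ i, |x i - v i| ≤ (R : ℤ)} ∪
            {x ∈ box d L | ∀ i, |x i - w i| ≤ (R : ℤ)} := by
        intro x hx
        rw [mem_filter] at hx
        obtain ⟨hxb, hx0⟩ := hx
        by_contra hcon
        apply hx0
        simp only [mem_union, mem_filter, hxb, true_and, not_or, not_forall, not_le] at hcon
        obtain ⟨⟨i, hi⟩, i', hi'⟩ := hcon
        have hdegj : ((g j).natDegree : ℤ) ≤ R := by exact_mod_cast hdeg j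
        have z1 := sum_modes_eval_eq_zero hd (g j) (inClosedBox_of_mem_box hxb) hv
          (lt_of_le_of_lt hdegj hi)
        have z2 := sum_modes_eval_eq_zero hd (g j) (inClosedBox_of_mem_box hxb) hw
          (lt_of_le_of_lt hdegj hi')
        rw [sinePot, if_pos hxb]
        have : ∑ k ∈ modes d L, (sineMode L k v - sineMode L k w) * m j k * sineMode L k x =
            (2 * d : ℝ)⁻¹ * (∑ k ∈ modes d L, sineMode L k v * (g j).eval (modeEig L k) *
              sineMode L k x - ∑ k ∈ modes d L, sineMode L k w * (g j).eval (modeEig L k) *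
              sineMode L k x) := by
          rw [← sum_sub_distrib, mul_sum]
          refine sum_congr rfl fun k _ => ?_
          simp only [m, if_pos hjJ]
          ring
        rw [this, z1, z2]; simp
      refine (card_le_card hsub).trans ((card_union_le _ _).trans ?_)
      have h1 := card_filter_near_le L R v
      have h2 := card_filter_near_le L R w
      have h3 : (2 * R + 1) ^ d ≤ (5 * d) ^ d * (2 ^ j) ^ d := by
        rw [← mul_pow]
        gcongr
        have : 1 ≤ d * 2 ^ j := Nat.mul_pos hd (by positivity)
        rw [hR, pow_succ]
        nlinarith
      rw [supportConst]
      nlinarith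
    · have hjJ' : j = J := le_antisymm hj (not_lt.1 hjJ)
      subst hjJ'
      refine (card_filter_le _ _).trans ?_
      have hcard : #(box d L) = (2 * L + 1) ^ d := by
        rw [box_eq_piFinset, Fintype.card_piFinset]
        simp only [Int.card_Icc, prod_const, card_univ, Fintype.card_fin]
        congr 1; omega
      rw [hcard, supportConst]
      have h2 := lt_two_pow_topScale L
      calc (2 * L + 1) ^ d ≤ (5 * d * 2 ^ J) ^ d := by
            gcongr
            have : 1 * 2 ^ J ≤ d * 2 ^ J := Nat.mul_le_mul_right _ hd
            rw [← hJ] at h2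
            nlinarith
        _ = (5 * d) ^ d * (2 ^ J) ^ d := by rw [mul_pow]
        _ ≤ 2 * (5 * d) ^ d * (2 ^ J) ^ d := by gcongr; omega
  · intro u hu
    have hone : ∀ k ∈ modes d L, ∑ j ∈ range (J + 1), m j k * (2 * d * (1 - modeEig L k)) = 1 := by
      intro k hk
      have hl := hlam k hk
      rw [sum_range_succ]
      have h1 : ∑ j ∈ range J, m j k * (2 * d * (1 - modeEig L k)) =
          ∑ j ∈ range J, ((scalePoly d j).eval (modeEig L k) -
            (scalePoly d (j + 1)).eval (modeEig L k)) := by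
        refine sum_congr rfl fun j hj => ?_
        rw [← hgev]
        simp only [m, if_pos (mem_range.1 hj)]
        field_simp
      rw [h1, sum_range_sub', scalePoly_zero]
      simp only [m, lt_irrefl, if_false, Polynomial.eval_one]
      field_simp
      ring
    rw [← sum_mul_delta u hu hv, ← sum_mul_delta u hu hw, ← sum_sub_distrib, sum_comm]
    refine sum_congr rfl fun x hx => ?_
    rw [← mul_sum, ← mul_sub, ← mul_sub, ← sum_sub_distrib]
    congr 1
    simp only [negLaplacian_sinePot hd _ hx]
    rw [← mul_sum, sum_comm]
    congr 1
    refine sum_congr rfl fun k hk => ?_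
    calc ∑ j ∈ range (J + 1), (sineMode L k v - sineMode L k w) * m j k *
          (2 * d * (1 - modeEig L k)) * sineMode L k x
        = (sineMode L k v - sineMode L k w) * sineMode L k x *
          ∑ j ∈ range (J + 1), m j k * (2 * d * (1 - modeEig L k)) := by
          rw [mul_sum]; exact sum_congr rfl fun j _ => by ring
      _ = _ := by rw [hone k hk]; ring

end Decomposition

/-! ### Shifts of the ground energy -/

section Shift

open Finset

variable {d n : ℕ}

theorem sum_gradient_mul_gradient (Λ : Finset (Fin d → ℤ)) (u h : (Fin d → ℤ) → ℝ)
    (hu : ∀ v, v ∉ Λ → u v = 0) :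
    ∑ i : Fin d, ∑ v ∈ Λ ∪ Λ.image (fun w => w - Pi.single i 1),
      (u (v + Pi.single i 1) - u v) * (h (v + Pi.single i 1) - h v) =
      ∑ v ∈ Λ, u v * negLaplacian h v := by
  simp only [negLaplacian, mul_sum]
  rw [sum_comm (s := Λ)]
  refine sum_congr rfl fun i _ => ?_
  simp only [sub_mul]
  rw [sum_sub_distrib]
  have h1 : ∑ v ∈ Λ ∪ Λ.image (fun w => w - Pi.single i 1),
      u (v + Pi.single i 1) * (h (v + Pi.single i 1) - h v) =
      ∑ v ∈ Λ, u v * (h v - h (v - Pi.single i 1)) := by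
    rw [← sum_subset (subset_union_right (s₁ := Λ)) fun v _ hv => ?_]
    · rw [sum_image fun x _ y _ hxy => by simpa using hxy]
      simp
    · rw [hu _ fun hmem => hv (mem_image.2 ⟨_, hmem, by simp⟩), zero_mul]
  have h2 : ∑ v ∈ Λ ∪ Λ.image (fun w => w - Pi.single i 1),
      u v * (h (v + Pi.single i 1) - h v) = ∑ v ∈ Λ, u v * (h (v + Pi.single i 1) - h v) := by
    rw [← sum_subset (subset_union_left (s₁ := Λ)) fun v _ hv => ?_]
    rw [hu _ hv, zero_mul]
  rw [h1, h2, ← sum_sub_distrib]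
  exact sum_congr rfl fun v _ => by ring

/-- The shift by `a h` in the `j`-th coordinate direction. -/
noncomputable def coordShift (j : Fin n) (a : ℝ) (h : (Fin d → ℤ) → ℝ) : Config d n :=
  fun v => EuclideanSpace.single j (a * h v)

theorem dirichletEnergy_add_coordShift (Λ : Finset (Fin d → ℤ)) {φ : Config d n}
    (hφ : ∀ v, v ∉ Λ → φ v = 0) (j : Fin n) (a : ℝ) {h : (Fin d → ℤ) → ℝ}
    (hh : ∀ v, v ∉ Λ → h v = 0) :
    dirichletEnergy Λ (φ + coordShift j a h) = dirichletEnergy Λ φ +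
      2 * a * ∑ v ∈ Λ, φ v j * negLaplacian h v + a ^ 2 * ∑ v ∈ Λ, h v * negLaplacian h v := by
  rw [← sum_gradient_mul_gradient Λ (fun v => φ v j) h fun v hv => by simp [hφ v hv],
    ← sum_gradient_mul_gradient Λ h h hh]
  simp only [dirichletEnergy, mul_sum, ← sum_add_distrib]
  refine sum_congr rfl fun i _ => sum_congr rfl fun v _ => ?_
  have e : (φ + coordShift j a h) (v + Pi.single i 1) - (φ + coordShift j a h) v =
      (φ (v + Pi.single i 1) - φ v) +
        EuclideanSpace.single j (a * (h (v + Pi.single i 1) - h v)) := by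
    ext l
    simp only [coordShift, Pi.add_apply, PiLp.sub_apply, PiLp.add_apply, PiLp.single_apply]
    split_ifs <;> ring
  rw [e, norm_add_sq_real, EuclideanSpace.inner_single_right, PiLp.norm_single]
  simp only [PiLp.sub_apply, conj_trivial, Real.norm_eq_abs, sq_abs]
  ring

theorem hamiltonian_shiftEnv_add (η : Environment d n) (lam : ℝ) (Λ : Finset (Fin d → ℤ))
    (φ s : Config d n) :
    hamiltonian (shiftEnv s η) lam Λ (φ + s) =
      ((1 / 2 * dirichletEnergy Λ (φ + s) : ℝ) : WithTop ℝ) +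
        (lam : WithTop ℝ) * ∑ v ∈ Λ, η v (φ v) := by
  simp [hamiltonian, shiftEnv]

theorem groundEnergy_eq_hamiltonian {η : Environment d n} {lam : ℝ} {Λ : Finset (Fin d → ℤ)}
    {τ φ : Config d n} (h : IsGroundConfig η lam Λ τ φ) :
    groundEnergy η lam Λ τ = hamiltonian η lam Λ φ := by
  have hex : ∃ φ, IsGroundConfig η lam Λ τ φ := ⟨φ, h⟩
  rw [groundEnergy, dif_pos hex]
  exact le_antisymm (hex.choose_spec.2 φ h.1) (h.2 _ hex.choose_spec.1)

/-- The ground energy of the shifted environment is at most the shifted energy of the original ground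
configuration. -/
theorem groundEnergyReal_shiftEnv_le {η : Environment d n} {lam : ℝ} {Λ : Finset (Fin d → ℤ)}
    {φ : Config d n} (hφ : IsGroundConfig η lam Λ 0 φ) (hfin : groundEnergy η lam Λ 0 < ⊤)
    (j : Fin n) (a : ℝ) {h : (Fin d → ℤ) → ℝ} (hh : ∀ v, v ∉ Λ → h v = 0)
    (hex : ∃ ψ, IsGroundConfig (shiftEnv (coordShift j a h) η) lam Λ 0 ψ) :
    groundEnergyReal (shiftEnv (coordShift j a h) η) lam Λ 0 ≤ groundEnergyReal η lam Λ 0 +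
      a * ∑ v ∈ Λ, φ v j * negLaplacian h v + a ^ 2 / 2 * ∑ v ∈ Λ, h v * negLaplacian h v := by
  obtain ⟨ψ, hψ⟩ := hex
  set s := coordShift (d := d) j a h with hs
  have hφ0 : ∀ v, v ∉ Λ → φ v = 0 := fun v hv => by simpa using hφ.1 v hv
  have hmem : φ + s ∈ configSpace Λ 0 := by
    intro v hv
    simp [hs, coordShift, hφ0 v hv, hh v hv]
  have hle := hψ.2 _ hmem
  rw [hamiltonian_shiftEnv_add] at hle
  rw [groundEnergy_eq_hamiltonian hφ] at hfin
  rw [groundEnergyReal, groundEnergyReal, groundEnergy_eq_hamiltonian hφ,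
    groundEnergy_eq_hamiltonian hψ]
  obtain ⟨y, hy⟩ := WithTop.ne_top_iff_exists.1 (WithTop.add_lt_top.1 hfin).2.ne
  have hH : hamiltonian η lam Λ φ = ((1 / 2 * dirichletEnergy Λ φ + y : ℝ) : WithTop ℝ) := by
    rw [hamiltonian, ← hy, ← WithTop.coe_add]
  rw [← hy, ← WithTop.coe_add] at hle
  obtain ⟨z, hz⟩ := WithTop.ne_top_iff_exists.1 (hle.trans_lt (WithTop.coe_lt_top _)).ne
  rw [← hz] at hle
  have := WithTop.coe_le_coe.1 hle
  rw [dirichletEnergy_add_coordShift Λ hφ0 j a hh] at this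
  rw [← hz, hH]
  simp only [WithTop.untopD_coe]
  linarith

end Shift

/-! ### Concentration and measurability of linear functionals of the ground configuration -/

section Concentration

open Finset Filter Topology

variable {d n : ℕ} [MeasurableSpace (Potential n)]

theorem sigmaOf_le (A : Set (Fin d → ℤ)) :
    sigmaOf (n := n) A ≤ (MeasurableSpace.pi : MeasurableSpace (Environment d n)) := by
  refine iSup₂_le fun v _ => ?_
  exact (measurable_pi_apply v).comap_le

/-- A function of the environment on `A` takes the same value at environments that agree on `A`. -/
theorem eq_of_measurable_sigmaOf {A : Set (Fin d → ℤ)} {f : Environment d n → ℝ}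
    (hf : Measurable[sigmaOf A] f) {η η' : Environment d n} (h : ∀ v ∈ A, η v = η' v) :
    f η = f η' := by
  have hle : sigmaOf (n := n) A ≤
      MeasurableSpace.comap (fun (ζ : Environment d n) (v : A) => ζ v) ⊤ := by
    refine iSup₂_le fun v hv => ?_
    rintro _ ⟨B, -, rfl⟩
    exact ⟨{ζ | ζ ⟨v, hv⟩ ∈ B}, trivial, rfl⟩
  obtain ⟨B, -, hB⟩ := hle _ (hf (measurableSet_singleton (f η)))
  have h1 : η ∈ f ⁻¹' {f η} := rfl
  rw [← hB] at h1
  have h2 : η' ∈ f ⁻¹' {f η} := by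
    rw [← hB]
    have : (fun v : A => η' v) = fun v : A => η v := funext fun v => (h v v.2).symm
    simpa only [Set.mem_preimage, this] using h1
  exact h2.symm

variable {μ : Measure (Environment d n)} {K κ lam : ℝ}

theorem measure_deviation_le [IsProbabilityMeasure μ] (hC : Conc μ K κ) (hlam : 0 < lam)
    {Δ Λ : Finset (Fin d → ℤ)} (hΔ : Δ.Nonempty) (hΔΛ : Δ ⊆ Λ) (τ : Config d n) {ρ : ℝ}
    (hρ : 0 < ρ) :
    NullMeasurableSet {η | ρ * lam * √(#Δ : ℝ) ≤ |groundEnergyReal η lam Λ τ -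
      (μ[fun η' => groundEnergyReal η' lam Λ τ | sigmaOf (Δ : Set (Fin d → ℤ))ᶜ]) η|} μ ∧
    μ {η | ρ * lam * √(#Δ : ℝ) ≤ |groundEnergyReal η lam Λ τ -
      (μ[fun η' => groundEnergyReal η' lam Λ τ | sigmaOf (Δ : Set (Fin d → ℤ))ᶜ]) η|} ≤
      ENNReal.ofReal (K * Real.exp (-κ * ρ ^ 2)) := by
  have hm := sigmaOf_le (n := n) (Δ : Set (Fin d → ℤ))ᶜ
  have hint := hC.integrable lam hlam Λ τ
  have hconc := hC.concentration lam hlam Δ Λ hΔ hΔΛ τ ρ hρ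
  set W := fun η => groundEnergyReal η lam Λ τ with hW
  set A := {η | ρ * lam * √(#Δ : ℝ) ≤ |W η - (μ[W | sigmaOf (Δ : Set (Fin d → ℤ))ᶜ]) η|} with hA
  have hnull : NullMeasurableSet A μ := by
    have h1 : AEMeasurable (fun η => |W η - (μ[W | sigmaOf (Δ : Set (Fin d → ℤ))ᶜ]) η|) μ := by
      have := (hint.aestronglyMeasurable.sub
        (integrable_condExp (m := sigmaOf (Δ : Set (Fin d → ℤ))ᶜ) (f := W)).aestronglyMeasurable)
      exact this.norm.aemeasurable
    exact nullMeasurableSet_le aemeasurable_const h1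
  refine ⟨hnull, ?_⟩
  have h1 : ∫ η, (A.indicator (fun _ => (1 : ℝ))) η ∂μ ≤ K * Real.exp (-κ * ρ ^ 2) := by
    rw [← integral_condExp hm]
    calc ∫ η, (μ[A.indicator fun _ => (1 : ℝ) | sigmaOf (Δ : Set (Fin d → ℤ))ᶜ]) η ∂μ
        ≤ ∫ _, K * Real.exp (-κ * ρ ^ 2) ∂μ :=
          integral_mono_ae integrable_condExp (integrable_const _) hconc
      _ = _ := by simp
  have h2 : ∫ η, (A.indicator (fun _ => (1 : ℝ))) η ∂μ = μ.real A := by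
    rw [integral_indicator₀ hnull]; simp
  rw [h2] at h1
  rw [← ofReal_measureReal]
  exact ENNReal.ofReal_le_ofReal h1

/-- The conditional expectation given the environment off `Δ` does not feel a shift supported in `Δ`,
so the concentration bound applies to the increment of the ground energy under the shift. -/
theorem measure_sub_shift_ge_le [IsProbabilityMeasure μ] (hC : Conc μ K κ) (hS : Stat μ) (hK : 0 < K) (hlam : 0 < lam)
    {Δ Λ : Finset (Fin d → ℤ)} (hΔ : Δ.Nonempty) (hΔΛ : Δ ⊆ Λ) (τ : Config d n) {ρ : ℝ}
    (hρ : 0 < ρ) {s : Config d n} (hs : ∀ v, v ∉ Δ → s v = 0) :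
    μ {η | 2 * (ρ * lam * √(#Δ : ℝ)) ≤
      groundEnergyReal η lam Λ τ - groundEnergyReal (shiftEnv s η) lam Λ τ} ≤
      ENNReal.ofReal (2 * K * Real.exp (-κ * ρ ^ 2)) := by
  obtain ⟨hnull, hle⟩ := measure_deviation_le hC hlam hΔ hΔΛ τ hρ
  set m := (μ[fun η' => groundEnergyReal η' lam Λ τ | sigmaOf (Δ : Set (Fin d → ℤ))ᶜ]) with hm
  set A := {η | ρ * lam * √(#Δ : ℝ) ≤ |groundEnergyReal η lam Λ τ - m η|} with hA
  have hmap : μ.map (shiftEnv s) = μ := by simpa using (hS s).map_eq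
  have hmshift : ∀ η, m (shiftEnv s η) = m η := by
    intro η
    refine eq_of_measurable_sigmaOf stronglyMeasurable_condExp.measurable fun v hv => ?_
    funext t
    simp [shiftEnv, hs v (by simpa using hv)]
  have hA' : μ (shiftEnv s ⁻¹' A) = μ A := by
    conv_rhs => rw [← hmap]
    rw [Measure.map_apply₀ (hS s).aemeasurable_fst (by rw [hmap]; exact hnull)]
  have hsub : {η | 2 * (ρ * lam * √(#Δ : ℝ)) ≤
      groundEnergyReal η lam Λ τ - groundEnergyReal (shiftEnv s η) lam Λ τ} ⊆
      A ∪ shiftEnv s ⁻¹' A := by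
    intro η hη
    by_contra hcon
    simp only [Set.mem_union, Set.mem_preimage, hA, Set.mem_ofPred_eq, not_or, not_le,
      hmshift] at hcon hη
    have h1 := (abs_lt.1 hcon.1).2
    have h2 := (abs_lt.1 hcon.2).1
    linarith
  calc μ _ ≤ μ (A ∪ shiftEnv s ⁻¹' A) := measure_mono hsub
    _ ≤ μ A + μ (shiftEnv s ⁻¹' A) := measure_union_le _ _
    _ ≤ ENNReal.ofReal (K * Real.exp (-κ * ρ ^ 2)) + ENNReal.ofReal (K * Real.exp (-κ * ρ ^ 2)) := by
        rw [hA']; gcongr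
    _ = _ := by rw [← ENNReal.ofReal_add (by positivity) (by positivity)]; ring_nf

theorem ae_exists_isGroundConfig_shiftEnv (hE : ExiMin μ) (hS : Stat μ) (hlam : 0 < lam)
    (Λ : Finset (Fin d → ℤ)) (s : Config d n) :
    ∀ᵐ η ∂μ, ∃ ψ, IsGroundConfig (shiftEnv s η) lam Λ 0 ψ := by
  have h : ∀ᵐ η ∂μ, ∃ ψ, IsGroundConfig η lam Λ 0 ψ := by
    filter_upwards [hE.attains_min lam hlam Λ 0] with η hη
    have hclosed : IsClosed (configSpace (n := n) Λ 0) := by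
      simp only [configSpace, Set.ofPred_forall]
      exact isClosed_iInter fun v => isClosed_iInter fun _ =>
        isClosed_eq (continuous_apply v) continuous_const
    exact hη _ subset_rfl hclosed ⟨0, fun _ _ => rfl⟩
  have hmap : μ.map (shiftEnv s) = μ := by simpa using (hS s).map_eq
  rw [← hmap] at h
  exact ae_of_ae_map (hS s).aemeasurable_fst h

variable {Ω : Type*} [MeasurableSpace Ω] {P : Measure Ω}
  {η : Ω → Environment d n} {Λ : Finset (Fin d → ℤ)} {φ : Ω → Config d n}

theorem ae_groundEnergyReal_shift_le (hη : Measurable η) (hE : ExiMin (P.map η))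
    (hS : Stat (P.map η)) (hlam : 0 < lam)
    (hφ : ∀ᵐ ω ∂P, IsGroundConfig (η ω) lam Λ 0 (φ ω)) (j : Fin n) (a : ℝ)
    {h : (Fin d → ℤ) → ℝ} (hh : ∀ v, v ∉ Λ → h v = 0) :
    ∀ᵐ ω ∂P, groundEnergyReal (shiftEnv (coordShift j a h) (η ω)) lam Λ 0 ≤
      groundEnergyReal (η ω) lam Λ 0 + a * ∑ v ∈ Λ, φ ω v j * negLaplacian h v +
        a ^ 2 / 2 * ∑ v ∈ Λ, h v * negLaplacian h v := by
  filter_upwards [hφ, ae_of_ae_map hη.aemeasurable (hE.groundEnergy_lt_top lam hlam Λ 0),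
    ae_of_ae_map hη.aemeasurable
      (ae_exists_isGroundConfig_shiftEnv hE hS hlam Λ (coordShift j a h))] with ω h1 h2 h3
  exact groundEnergyReal_shiftEnv_le h1 h2 j a hh h3

/-- A linear functional `(φ, -Δh)` of the ground configuration has quartic-exponential tails, at a scale
given by the Dirichlet energy of `h` and by the size of its support. -/
theorem measure_abs_pairing_ge_le [IsProbabilityMeasure P] (hη : Measurable η) (hE : ExiMin (P.map η))
    (hS : Stat (P.map η)) (hC : Conc (P.map η) K κ) (hK : 0 < K) (hlam : 0 < lam)
    (hφ : ∀ᵐ ω ∂P, IsGroundConfig (η ω) lam Λ 0 (φ ω)) (j : Fin n)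
    {h : (Fin d → ℤ) → ℝ} (hh : ∀ v, v ∉ Λ → h v = 0) {V E : ℝ} (hV0 : 0 < V)
    (hV : (#{v ∈ Λ | h v ≠ 0} : ℝ) ≤ V) (hE0 : 0 < E)
    (hEh : ∑ v ∈ Λ, h v * negLaplacian h v ≤ E) {t : ℝ} (ht : 0 < t) :
    P {ω | t * (2 * √lam * √√V * √E) ≤ |∑ v ∈ Λ, φ ω v j * negLaplacian h v|} ≤
      ENNReal.ofReal (4 * K * Real.exp (-κ * t ^ 4)) := by
  have hprob : IsProbabilityMeasure (P.map η) := Measure.isProbabilityMeasure_map hη.aemeasurable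
  set X := fun ω => ∑ v ∈ Λ, φ ω v j * negLaplacian h v with hX
  set B := t * (2 * √lam * √√V * √E) with hB
  have hsV : 0 < √V := Real.sqrt_pos.2 hV0
  have hssV : 0 < √√V := Real.sqrt_pos.2 hsV
  have hsE : 0 < √E := Real.sqrt_pos.2 hE0
  have hsl : 0 < √lam := Real.sqrt_pos.2 hlam
  have hB0 : 0 < B := by positivity
  set Δ := {v ∈ Λ | h v ≠ 0} with hΔ
  rcases Δ.eq_empty_or_nonempty with hemp | hne
  · -- then `h = 0` and the event is empty
    have h0 : h = 0 := by
      funext v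
      by_contra hv
      have hvΛ : v ∈ Λ := by by_contra hv'; exact hv (hh v hv')
      have : v ∈ Δ := mem_filter.2 ⟨hvΛ, hv⟩
      simp [hemp] at this
    have : {ω | B ≤ |X ω|} = ∅ := by
      ext ω
      simp [hX, h0, negLaplacian, hB0]
    rw [this]; simp
  · have hΔΛ : Δ ⊆ Λ := filter_subset _ _
    -- the amplitude of the shift optimizes `a * B - a ^ 2 * E / 2`
    set a := B / E with ha
    have haB : a * B - a ^ 2 / 2 * E = 2 * (t ^ 2 * lam * √V) := by
      have h1 : B ^ 2 = t ^ 2 * (4 * lam * √V * E) := by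
        rw [hB, mul_pow, mul_pow, mul_pow, mul_pow, Real.sq_sqrt hlam.le, Real.sq_sqrt hsV.le,
          Real.sq_sqrt hE0.le]; ring
      rw [ha]
      field_simp
      rw [h1]; ring
    have ha0 : 0 < a := by positivity
    have hcard : 2 * (t ^ 2 * lam * √(#Δ : ℝ)) ≤ 2 * (t ^ 2 * lam * √V) := by gcongr
    have hone : ∀ b : ℝ, |b| = a →
        P {ω | a * B ≤ -b * X ω} ≤ ENNReal.ofReal (2 * K * Real.exp (-κ * t ^ 4)) := by
      intro b hb
      have hs : ∀ v, v ∉ Δ → coordShift (n := n) j b h v = 0 := by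
        intro v hv
        have : h v = 0 := by
          by_contra hv0
          by_cases hvΛ : v ∈ Λ
          · exact hv (mem_filter.2 ⟨hvΛ, hv0⟩)
          · exact hv0 (hh v hvΛ)
        simp [coordShift, this]
      have hmeas := measure_sub_shift_ge_le hC hS hK hlam hne hΔΛ 0 (by positivity : 0 < t ^ 2) hs
      have hpre : P (η ⁻¹' {ζ | 2 * (t ^ 2 * lam * √(#Δ : ℝ)) ≤
          groundEnergyReal ζ lam Λ 0 - groundEnergyReal (shiftEnv (coordShift j b h) ζ) lam Λ 0}) ≤
          ENNReal.ofReal (2 * K * Real.exp (-κ * (t ^ 2) ^ 2)) :=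
        (Measure.le_map_apply hη.aemeasurable _).trans hmeas
      rw [← pow_mul] at hpre
      refine le_trans (measure_mono_ae ?_) hpre
      filter_upwards [ae_groundEnergyReal_shift_le hη hE hS hlam hφ j b hh] with ω hω hmem
      change a * B ≤ -b * X ω at hmem
      change 2 * (t ^ 2 * lam * √(#Δ : ℝ)) ≤ _
      have hb2 : b ^ 2 = a ^ 2 := by rw [← sq_abs, hb]
      rw [hb2] at hω
      have : a ^ 2 / 2 * ∑ v ∈ Λ, h v * negLaplacian h v ≤ a ^ 2 / 2 * E := by gcongr
      change _ ≤ groundEnergyReal (η ω) lam Λ 0 + b * X ω + _ at hω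
      linarith
    have hsub : {ω | B ≤ |X ω|} ⊆ {ω | a * B ≤ -(-a) * X ω} ∪ {ω | a * B ≤ -a * X ω} := by
      intro ω hω
      rcases le_abs.1 (show B ≤ |X ω| from hω) with h1 | h1
      · left
        change a * B ≤ -(-a) * X ω
        nlinarith
      · right
        change a * B ≤ -a * X ω
        nlinarith
    calc P {ω | B ≤ |X ω|} ≤ _ := measure_mono hsub
      _ ≤ _ := measure_union_le _ _
      _ ≤ ENNReal.ofReal (2 * K * Real.exp (-κ * t ^ 4)) +
          ENNReal.ofReal (2 * K * Real.exp (-κ * t ^ 4)) := by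
          gcongr
          · exact hone (-a) (by rw [abs_neg, abs_of_pos ha0])
          · exact hone a (abs_of_pos ha0)
      _ = _ := by rw [← ENNReal.ofReal_add (by positivity) (by positivity)]; ring_nf

/-- A function squeezed between integrable functions with arbitrarily small gap is measurable. -/
theorem aemeasurable_of_squeeze {X : Ω → ℝ} {A B : ℕ → Ω → ℝ} {c : ℝ}
    (hA : ∀ m, Integrable (A m) P) (hB : ∀ m, Integrable (B m) P)
    (hAX : ∀ m, A m ≤ᵐ[P] X) (hXB : ∀ m, X ≤ᵐ[P] B m)
    (hgap : ∀ m, ∫ ω, (B m ω - A m ω) ∂P ≤ c * (1 / 2) ^ m) : AEMeasurable X P := by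
  have hae : ∀ᵐ ω ∂P, ∀ m, A m ω ≤ X ω ∧ X ω ≤ B m ω := by
    rw [ae_all_iff]
    intro m
    filter_upwards [hAX m, hXB m] with ω h1 h2 using ⟨h1, h2⟩
  have hmeas : ∀ m, AEMeasurable (fun ω => ENNReal.ofReal (B m ω - A m ω)) P := fun m =>
    ((hB m).sub (hA m)).aestronglyMeasurable.aemeasurable.ennreal_ofReal
  have hfin : ∫⁻ ω, ∑' m, ENNReal.ofReal (B m ω - A m ω) ∂P ≠ ⊤ := by
    rw [lintegral_tsum hmeas]
    have hle : ∀ m, ∫⁻ ω, ENNReal.ofReal (B m ω - A m ω) ∂P ≤ ENNReal.ofReal (|c| * (1 / 2) ^ m) := by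
      intro m
      have hi : Integrable (fun ω => B m ω - A m ω) P := (hB m).sub (hA m)
      rw [← ofReal_integral_eq_lintegral_ofReal hi]
      · refine ENNReal.ofReal_le_ofReal ((hgap m).trans ?_)
        gcongr
        exact le_abs_self c
      · filter_upwards [hae] with ω hω
        have := hω m
        simp only [Pi.zero_apply]
        linarith
    have hs : Summable fun m : ℕ => |c| * (1 / 2 : ℝ) ^ m :=
      (summable_geometric_of_lt_one (by norm_num) (by norm_num)).mul_left _
    exact ne_top_of_le_ne_top hs.tsum_ofReal_ne_top (ENNReal.tsum_le_tsum hle)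
  have htop := ae_lt_top' (AEMeasurable.tsum hmeas) hfin
  refine aemeasurable_of_tendsto_metrizable_ae (u := atTop)
    (fun m => (hA m).aestronglyMeasurable.aemeasurable) ?_
  filter_upwards [hae, htop] with ω hω hlt
  have h0 := ENNReal.tendsto_atTop_zero_of_tsum_ne_top hlt.ne
  have h1 : Tendsto (fun m => B m ω - A m ω) atTop (𝓝 0) := by
    have := (ENNReal.tendsto_toReal ENNReal.zero_ne_top).comp h0
    refine (this.congr fun m => ?_)
    have := hω m
    simp only [Function.comp]
    exact ENNReal.toReal_ofReal (by linarith)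
  have h2 : Tendsto (fun m => X ω - A m ω) atTop (𝓝 0) :=
    squeeze_zero (fun m => by linarith [(hω m).1]) (fun m => by linarith [(hω m).2]) h1
  simpa using (tendsto_const_nhds (x := X ω)).sub h2

/-- No measurability of the choice of the ground configuration is assumed. It follows from stationarity:
the one-sided difference quotients of the ground energy bound each linear functional of any ground
configuration from both sides, and by stationarity they have the same mean up to a vanishing error. -/
theorem aemeasurable_pairing [IsProbabilityMeasure P] (hη : Measurable η) (hE : ExiMin (P.map η))
    (hS : Stat (P.map η)) (hC : Conc (P.map η) K κ) (hlam : 0 < lam)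
    (hφ : ∀ᵐ ω ∂P, IsGroundConfig (η ω) lam Λ 0 (φ ω)) (j : Fin n)
    {h : (Fin d → ℤ) → ℝ} (hh : ∀ v, v ∉ Λ → h v = 0) :
    AEMeasurable (fun ω => ∑ v ∈ Λ, φ ω v j * negLaplacian h v) P := by
  set E := ∑ v ∈ Λ, h v * negLaplacian h v with hEdef
  set G := fun (a : ℝ) (ω : Ω) => groundEnergyReal (shiftEnv (coordShift j a h) (η ω)) lam Λ 0 with hG
  have hint0 := hC.integrable lam hlam Λ 0
  have hmap : ∀ s : Config d n, (P.map η).map (shiftEnv s) = P.map η := fun s => by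
    simpa using (hS s).map_eq
  have hGint : ∀ a, Integrable (G a) P := by
    intro a
    have h1 := hint0
    rw [← hmap (coordShift j a h)] at h1
    exact (h1.comp_aemeasurable (hS _).aemeasurable_fst).comp_measurable hη
  have hGmean : ∀ a, ∫ ω, G a ω ∂P = ∫ ζ, groundEnergyReal ζ lam Λ 0 ∂(P.map η) := by
    intro a
    have h1 := hint0
    rw [← hmap (coordShift j a h)] at h1
    have h2 := h1.comp_aemeasurable (hS _).aemeasurable_fst
    conv_rhs => rw [← hmap (coordShift j a h)]
    rw [integral_map (hS _).aemeasurable_fst h1.aestronglyMeasurable]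
    exact (integral_map hη.aemeasurable h2.aestronglyMeasurable).symm
  have hint1 : Integrable (fun ω => groundEnergyReal (η ω) lam Λ 0) P := hint0.comp_measurable hη
  have hmean1 : ∫ ω, groundEnergyReal (η ω) lam Λ 0 ∂P =
      ∫ ζ, groundEnergyReal ζ lam Λ 0 ∂(P.map η) :=
    (integral_map hη.aemeasurable hint0.aestronglyMeasurable).symm
  have hhalf : ∀ m : ℕ, (0 : ℝ) < (1 / 2) ^ m := fun m => by positivity
  refine aemeasurable_of_squeeze (c := E)
    (A := fun m ω => (G ((1 / 2) ^ m) ω - groundEnergyReal (η ω) lam Λ 0) / (1 / 2) ^ m -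
      (1 / 2) ^ m / 2 * E)
    (B := fun m ω => (groundEnergyReal (η ω) lam Λ 0 - G (-(1 / 2) ^ m) ω) / (1 / 2) ^ m +
      (1 / 2) ^ m / 2 * E)
    (fun m => (((hGint _).sub hint1).div_const _).sub (integrable_const _))
    (fun m => ((hint1.sub (hGint _)).div_const _).add (integrable_const _)) ?_ ?_ ?_
  · intro m
    filter_upwards [ae_groundEnergyReal_shift_le hη hE hS hlam hφ j ((1 / 2) ^ m) hh] with ω hω
    have hp := hhalf m
    rw [tsub_le_iff_right, div_le_iff₀ hp]
    simp only [hG]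
    nlinarith
  · intro m
    filter_upwards [ae_groundEnergyReal_shift_le hη hE hS hlam hφ j (-(1 / 2) ^ m) hh] with ω hω
    have hp := hhalf m
    rw [← sub_le_iff_le_add, le_div_iff₀ hp]
    simp only [hG]
    nlinarith
  · intro m
    have hp := hhalf m
    set a : ℝ := (1 / 2) ^ m with ha
    set g := fun ω => groundEnergyReal (η ω) lam Λ 0 with hg
    have e : ∀ ω, (g ω - G (-a) ω) / a + a / 2 * E - ((G a ω - g ω) / a - a / 2 * E) =
        ((g - G (-a)) + (g - G a)) ω * a⁻¹ + a * E := by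
      intro ω
      simp only [Pi.add_apply, Pi.sub_apply]
      ring
    have hi1 : Integrable (g - G (-a)) P := hint1.sub (hGint _)
    have hi2 : Integrable (g - G a) P := hint1.sub (hGint _)
    have hz : ∫ ω, ((g - G (-a)) + (g - G a)) ω ∂P = 0 := by
      rw [integral_add' hi1 hi2, integral_sub' hint1 (hGint _), integral_sub' hint1 (hGint _),
        hGmean, hGmean, hmean1]
      ring
    refine (integral_congr_ae (ae_of_all _ e)).trans_le ?_
    rw [integral_add ((hi1.add hi2).mul_const _) (integrable_const _), integral_mul_const, hz]
    simp
    linarith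

end Concentration

/-! ### Quartic exponential moments -/

section QuarticMoments

open Finset

variable {Ω : Type*} [MeasurableSpace Ω] {P : Measure Ω} {θ A K κ b : ℝ} {X Y : Ω → ℝ}

/-- The random variable `X` has scale at most `b` in the sense that the mean of `exp (θ (X / b) ^ 4)` is at
most `A`. For fixed `θ` and `A` this is, up to constants, an Orlicz norm bound; in particular the
scales of the terms of a sum add up. -/
structure QuarticBound (P : Measure Ω) (θ A : ℝ) (X : Ω → ℝ) (b : ℝ) : Prop where
  aemeasurable : AEMeasurable X P
  lintegral_le : ∫⁻ ω, ENNReal.ofReal (Real.exp (θ * (X ω / b) ^ 4)) ∂P ≤ ENNReal.ofReal A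

theorem QuarticBound.of_abs_le (h : QuarticBound P θ A X b) (hθ : 0 ≤ θ) {b' : ℝ} (hb : 0 < b)
    (hbb' : b ≤ b') (hY : AEMeasurable Y P) (hYX : ∀ᵐ ω ∂P, |Y ω| ≤ |X ω|) :
    QuarticBound P θ A Y b' := by
  refine ⟨hY, (lintegral_mono_ae ?_).trans h.lintegral_le⟩
  filter_upwards [hYX] with ω hω
  have hb' : 0 < b' := hb.trans_le hbb'
  have e : ∀ z c : ℝ, (z / c) ^ 4 = (|z| / |c|) ^ 4 := fun z c => by
    rw [← abs_div, Even.pow_abs (by decide)]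
  rw [e (Y ω), e (X ω), abs_of_pos hb, abs_of_pos hb']
  gcongr

theorem QuarticBound.congr (h : QuarticBound P θ A X b) (hXY : X =ᵐ[P] Y) :
    QuarticBound P θ A Y b := by
  refine ⟨h.aemeasurable.congr hXY, (lintegral_congr_ae ?_).trans_le h.lintegral_le⟩
  filter_upwards [hXY] with ω hω
  rw [hω]

theorem QuarticBound.abs (h : QuarticBound P θ A X b) :
    QuarticBound P θ A (fun ω => |X ω|) b := by
  refine ⟨continuous_abs.measurable.comp_aemeasurable h.aemeasurable, ?_⟩
  refine le_trans (le_of_eq ?_) h.lintegral_le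
  refine lintegral_congr fun ω => ?_
  rw [div_pow, div_pow, Even.pow_abs (by decide)]

theorem QuarticBound.sum {ι : Type*} {s : Finset ι} (hs : s.Nonempty) {X : ι → Ω → ℝ} {b : ι → ℝ}
    (hb : ∀ i ∈ s, 0 < b i) (hθ : 0 ≤ θ)
    (h : ∀ i ∈ s, QuarticBound P θ A (X i) (b i)) :
    QuarticBound P θ A (fun ω => ∑ i ∈ s, X i ω) (∑ i ∈ s, b i) := by
  have hB : 0 < ∑ i ∈ s, b i := sum_pos hb hs
  set B := ∑ i ∈ s, b i with hBdef
  have hw0 : ∀ i ∈ s, 0 ≤ b i / B := fun i hi => div_nonneg (hb i hi).le hB.le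
  have hw1 : ∑ i ∈ s, b i / B = 1 := by rw [← sum_div, div_self hB.ne']
  refine ⟨aemeasurable_fun_sum s fun i hi => (h i hi).aemeasurable, ?_⟩
  have hmeas : ∀ i ∈ s, AEMeasurable
      (fun ω => ENNReal.ofReal (b i / B) * ENNReal.ofReal (Real.exp (θ * (X i ω / b i) ^ 4))) P := by
    intro i hi
    exact ((Real.measurable_exp.comp_aemeasurable
      ((((h i hi).aemeasurable.div_const _).pow_const 4).const_mul θ)).ennreal_ofReal).const_mul _
  calc ∫⁻ ω, ENNReal.ofReal (Real.exp (θ * ((∑ i ∈ s, X i ω) / B) ^ 4)) ∂P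
      ≤ ∫⁻ ω, ∑ i ∈ s, ENNReal.ofReal (b i / B) *
        ENNReal.ofReal (Real.exp (θ * (X i ω / b i) ^ 4)) ∂P := by
        refine lintegral_mono fun ω => ?_
        have e : (∑ i ∈ s, X i ω) / B = ∑ i ∈ s, b i / B * (X i ω / b i) := by
          rw [sum_div]
          refine sum_congr rfl fun i hi => ?_
          have := (hb i hi).ne'
          field_simp
        have h4 := Real.pow_arith_mean_le_arith_mean_pow_of_even s (fun i => b i / B)
          (fun i => X i ω / b i) hw0 hw1 (n := 4) (by decide)
        have hexp := convexOn_exp.map_sum_le (t := s) (w := fun i => b i / B)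
          (p := fun i => θ * (X i ω / b i) ^ 4) hw0 hw1 (fun _ _ => Set.mem_univ _)
        simp only [smul_eq_mul] at hexp
        have hle : Real.exp (θ * ((∑ i ∈ s, X i ω) / B) ^ 4) ≤
            ∑ i ∈ s, b i / B * Real.exp (θ * (X i ω / b i) ^ 4) := by
          refine le_trans (Real.exp_le_exp.2 ?_) hexp
          rw [e]
          refine (mul_le_mul_of_nonneg_left h4 hθ).trans (le_of_eq ?_)
          rw [mul_sum]
          exact sum_congr rfl fun i _ => by ring
        refine (ENNReal.ofReal_le_ofReal hle).trans (le_of_eq ?_)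
        rw [ENNReal.ofReal_sum_of_nonneg fun i hi => mul_nonneg (hw0 i hi) (Real.exp_pos _).le]
        exact sum_congr rfl fun i hi => ENNReal.ofReal_mul (hw0 i hi)
    _ = ∑ i ∈ s, ENNReal.ofReal (b i / B) *
        ∫⁻ ω, ENNReal.ofReal (Real.exp (θ * (X i ω / b i) ^ 4)) ∂P := by
        rw [lintegral_finsetSum' s hmeas]
        exact sum_congr rfl fun i hi => lintegral_const_mul' _ _ ENNReal.ofReal_ne_top
    _ ≤ ∑ i ∈ s, ENNReal.ofReal (b i / B) * ENNReal.ofReal A := by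
        gcongr with i hi
        exact (h i hi).lintegral_le
    _ = ENNReal.ofReal A := by
        rw [← sum_mul, ← ENNReal.ofReal_sum_of_nonneg hw0, hw1]; simp

theorem QuarticBound.measure_ge_le (h : QuarticBound P θ A X b) (hθ : 0 ≤ θ)
    (hb : 0 < b) {t : ℝ} (ht : 0 ≤ t) :
    P {ω | t * b ≤ |X ω|} ≤ ENNReal.ofReal (A * Real.exp (-θ * t ^ 4)) := by
  have hmeas : AEMeasurable (fun ω => ENNReal.ofReal (Real.exp (θ * (X ω / b) ^ 4))) P :=
    (Real.measurable_exp.comp_aemeasurable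
      (((h.aemeasurable.div_const _).pow_const 4).const_mul θ)).ennreal_ofReal
  have hm := mul_meas_ge_le_lintegral₀ hmeas (ENNReal.ofReal (Real.exp (θ * t ^ 4)))
  have hsub : {ω | t * b ≤ |X ω|} ⊆ {ω | ENNReal.ofReal (Real.exp (θ * t ^ 4)) ≤
      ENNReal.ofReal (Real.exp (θ * (X ω / b) ^ 4))} := by
    intro ω hω
    refine ENNReal.ofReal_le_ofReal (Real.exp_le_exp.2 ?_)
    have h1 : t ≤ |X ω / b| := by
      rw [abs_div, abs_of_pos hb, le_div_iff₀ hb]; exact hω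
    have h2 : t ^ 4 ≤ (X ω / b) ^ 4 := by
      rw [← Even.pow_abs (by decide : Even 4) (X ω / b)]; gcongr
    gcongr
  have h3 := (mul_le_mul_right (measure_mono (μ := P) hsub)
    (ENNReal.ofReal (Real.exp (θ * t ^ 4)))).trans (hm.trans h.lintegral_le)
  have hne : ENNReal.ofReal (Real.exp (θ * t ^ 4)) ≠ 0 := by
    simp [Real.exp_pos]
  rw [mul_comm, ← ENNReal.le_div_iff_mul_le (Or.inl hne) (Or.inl ENNReal.ofReal_ne_top),
    ← ENNReal.ofReal_div_of_pos (Real.exp_pos _)] at h3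
  refine h3.trans (le_of_eq ?_)
  rw [neg_mul, Real.exp_neg, div_eq_mul_inv]

theorem QuarticBound.integrable_and_integral_le (h : QuarticBound P θ A X b) (hθ : 0 < θ)
    (hA : 0 ≤ A) (hb : 0 < b) :
    Integrable X P ∧ ∫ ω, |X ω| ∂P ≤ b * (1 + 1 / θ) * A := by
  have hpt : ∀ ω, ENNReal.ofReal |X ω| ≤ ENNReal.ofReal (b * (1 + 1 / θ)) *
      ENNReal.ofReal (Real.exp (θ * (X ω / b) ^ 4)) := by
    intro ω
    rw [← ENNReal.ofReal_mul (by positivity)]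
    refine ENNReal.ofReal_le_ofReal ?_
    set y := |X ω| / b with hy
    have hy0 : 0 ≤ y := by positivity
    have hX : |X ω| = b * y := by rw [hy]; field_simp
    have hy4 : (X ω / b) ^ 4 = y ^ 4 := by
      rw [hy, div_pow, div_pow, Even.pow_abs (by decide)]
    rw [hy4, hX, mul_assoc]
    gcongr
    have h1 : y ≤ 1 + y ^ 4 := by nlinarith [sq_nonneg (y ^ 2 - 1), sq_nonneg (y - 1)]
    have h2 : θ * y ^ 4 + 1 ≤ Real.exp (θ * y ^ 4) := Real.add_one_le_exp _
    have h4 : 0 ≤ θ * y ^ 4 := by positivity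
    have h3 : y ^ 4 ≤ 1 / θ * Real.exp (θ * y ^ 4) := by
      rw [one_div_mul_eq_div, le_div_iff₀ hθ]; linarith
    linarith
  have hle : ∫⁻ ω, ENNReal.ofReal |X ω| ∂P ≤ ENNReal.ofReal (b * (1 + 1 / θ) * A) := by
    refine (lintegral_mono hpt).trans ?_
    rw [lintegral_const_mul' _ _ ENNReal.ofReal_ne_top, ENNReal.ofReal_mul (p := b * (1 + 1 / θ)) (by positivity)]
    exact mul_le_mul_right h.lintegral_le _
  have hint : Integrable X P := by
    refine ⟨h.aemeasurable.aestronglyMeasurable, ?_⟩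
    rw [hasFiniteIntegral_iff_norm]
    exact hle.trans_lt ENNReal.ofReal_lt_top
  refine ⟨hint, ?_⟩
  rw [integral_eq_lintegral_of_nonneg_ae (Filter.Eventually.of_forall fun ω => abs_nonneg _)
    hint.abs.aestronglyMeasurable]
  exact ENNReal.toReal_le_of_le_ofReal (by positivity) hle

/-- The exponential moment furnished by a tail bound `4 K exp (-κ t ^ 4)`. -/
noncomputable def momentConst (K κ : ℝ) : ℝ :=
  (1 + 4 * K) * Real.exp (κ / 2) * (1 - Real.exp (-(κ / 2)))⁻¹

theorem momentConst_pos (hK : 0 < K) (hκ : 0 < κ) : 0 < momentConst K κ := by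
  have : Real.exp (-(κ / 2)) < 1 := Real.exp_lt_one_iff.2 (by linarith)
  have : 0 < 1 - Real.exp (-(κ / 2)) := by linarith
  unfold momentConst
  positivity

theorem QuarticBound.of_tail [IsProbabilityMeasure P] (hK : 0 < K) (hκ : 0 < κ)
    (hX : AEMeasurable X P) (hb : 0 < b) (h : ∀ t : ℝ, 0 < t →
      P {ω | t * b ≤ |X ω|} ≤ ENNReal.ofReal (4 * K * Real.exp (-κ * t ^ 4))) :
    QuarticBound P (κ / 2) (momentConst K κ) X b := by
  refine ⟨hX, ?_⟩
  have hYm : AEMeasurable (fun ω => (X ω / b) ^ 4) P := (hX.div_const _).pow_const 4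
  have hY0 : ∀ ω, 0 ≤ (X ω / b) ^ 4 := fun ω => by positivity
  set S : ℕ → Set Ω := fun i => {ω | (i : ℝ) ≤ (X ω / b) ^ 4} with hS
  have hSm : ∀ i, NullMeasurableSet (S i) P := fun i =>
    nullMeasurableSet_le aemeasurable_const hYm
  have hSP : ∀ i, P (S i) ≤ ENNReal.ofReal ((1 + 4 * K) * Real.exp (-κ * i)) := by
    intro i
    rcases Nat.eq_zero_or_pos i with rfl | hi
    · refine prob_le_one.trans ?_
      rw [← ENNReal.ofReal_one]
      refine ENNReal.ofReal_le_ofReal ?_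
      simp; linarith
    · have hi' : (0 : ℝ) < i := by exact_mod_cast hi
      have ht4 : √√(i : ℝ) ^ 4 = i := by
        rw [show (4 : ℕ) = 2 * 2 from rfl, pow_mul, Real.sq_sqrt (Real.sqrt_nonneg _),
          Real.sq_sqrt hi'.le]
      have hsub : S i ⊆ {ω | √√(i : ℝ) * b ≤ |X ω|} := by
        intro ω hω
        change (i : ℝ) ≤ (X ω / b) ^ 4 at hω
        change √√(i : ℝ) * b ≤ |X ω|
        rw [← le_div_iff₀ hb]
        have : (X ω / b) ^ 4 = (|X ω| / b) ^ 4 := by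
          rw [div_pow, div_pow, Even.pow_abs (by decide)]
        rw [this, ← ht4] at hω
        exact le_of_pow_le_pow_left₀ (by norm_num) (by positivity) hω
      refine (measure_mono hsub).trans ((h _ (by positivity)).trans ?_)
      rw [ht4]
      refine ENNReal.ofReal_le_ofReal ?_
      gcongr
      linarith
  have hpt : ∀ ω, ENNReal.ofReal (Real.exp (κ / 2 * (X ω / b) ^ 4)) ≤
      ∑' i : ℕ, (S i).indicator (fun _ => ENNReal.ofReal (Real.exp (κ / 2 * (i + 1)))) ω := by
    intro ω
    set i := ⌊(X ω / b) ^ 4⌋₊ with hi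
    have hmem : ω ∈ S i := Nat.floor_le (hY0 ω)
    refine le_trans ?_ (ENNReal.le_tsum i)
    rw [Set.indicator_of_mem hmem]
    refine ENNReal.ofReal_le_ofReal (Real.exp_le_exp.2 ?_)
    have := (Nat.lt_floor_add_one ((X ω / b) ^ 4)).le
    gcongr
  have hq : Real.exp (-(κ / 2)) < 1 := Real.exp_lt_one_iff.2 (by linarith)
  have hterm : ∀ i : ℕ, ENNReal.ofReal (Real.exp (κ / 2 * (i + 1))) * P (S i) ≤
      ENNReal.ofReal ((1 + 4 * K) * Real.exp (κ / 2) * Real.exp (-(κ / 2)) ^ i) := by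
    intro i
    refine (mul_le_mul_right (hSP i) _).trans (le_of_eq ?_)
    rw [← ENNReal.ofReal_mul (Real.exp_pos _).le]
    congr 1
    rw [← Real.exp_nat_mul, mul_left_comm, ← Real.exp_add, mul_assoc, ← Real.exp_add]
    congr 2
    ring
  have hgeo := hasSum_geometric_of_lt_one (Real.exp_pos (-(κ / 2))).le hq
  calc ∫⁻ ω, ENNReal.ofReal (Real.exp (κ / 2 * (X ω / b) ^ 4)) ∂P
      ≤ ∫⁻ ω, ∑' i : ℕ, (S i).indicator
          (fun _ => ENNReal.ofReal (Real.exp (κ / 2 * (i + 1)))) ω ∂P := lintegral_mono hpt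
    _ = ∑' i : ℕ, ENNReal.ofReal (Real.exp (κ / 2 * (i + 1))) * P (S i) := by
        rw [lintegral_tsum fun i => (aemeasurable_const.indicator₀ (hSm i))]
        congr 1
        funext i
        rw [lintegral_indicator_const₀ (hSm i)]
    _ ≤ ∑' i : ℕ, ENNReal.ofReal ((1 + 4 * K) * Real.exp (κ / 2) * Real.exp (-(κ / 2)) ^ i) :=
        ENNReal.tsum_le_tsum hterm
    _ = ENNReal.ofReal (momentConst K κ) := by
        have hsum := hgeo.mul_left ((1 + 4 * K) * Real.exp (κ / 2))
        rw [← ENNReal.ofReal_tsum_of_nonneg (fun i => by positivity) hsum.summable, hsum.tsum_eq,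
          momentConst]

end QuarticMoments

/-! ### The two-point estimate -/

section TwoPoint

open Finset

variable {d n : ℕ}

/-- The sum over scales of the typical size of the multiscale increments between points at distance
`D`. -/
noncomputable def scaleSum (d J : ℕ) (D : ℝ) : ℝ :=
  ∑ j ∈ range (J + 1), ((2 : ℝ) ^ j) ^ ((4 - (d : ℝ)) / 4) * min 1 (D / 2 ^ j)

theorem scaleSum_pos (d J : ℕ) {D : ℝ} (hD : 0 < D) : 0 < scaleSum d J D :=
  sum_pos (fun j _ => by positivity) ⟨0, by simp⟩

theorem sqrt_sqrt_mul_sqrt_eq (d : ℕ) {S F x m : ℝ} (hS : 0 ≤ S) (hF : 0 ≤ F) (hx : 0 < x)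
    (hm : 0 ≤ m) :
    √√(S * x ^ d) * √(F * (x ^ 2 * (x ^ d)⁻¹ * m ^ 2)) =
      √√S * √F * (x ^ ((4 - (d : ℝ)) / 4) * m) := by
  rw [Real.sqrt_mul hS, Real.sqrt_mul (Real.sqrt_nonneg _), Real.sqrt_mul hF,
    Real.sqrt_mul (by positivity), Real.sqrt_sq hm]
  have h1 : √√(x ^ d) = x ^ ((d : ℝ) / 4) := by
    rw [Real.sqrt_eq_rpow, Real.sqrt_eq_rpow, ← Real.rpow_natCast, ← Real.rpow_mul hx.le,
      ← Real.rpow_mul hx.le]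
    ring_nf
  have h2 : √(x ^ 2 * (x ^ d)⁻¹) = x ^ (1 - (d : ℝ) / 2) := by
    rw [Real.sqrt_eq_rpow, ← Real.rpow_natCast, ← Real.rpow_natCast, ← Real.rpow_neg hx.le,
      ← Real.rpow_add hx, ← Real.rpow_mul hx.le]
    congr 1
    push_cast
    ring
  rw [h1, h2]
  have h3 : x ^ ((4 - (d : ℝ)) / 4) = x ^ ((d : ℝ) / 4) * x ^ (1 - (d : ℝ) / 2) := by
    rw [← Real.rpow_add hx]; ring_nf
  rw [h3]; ring

/-- The dimensional constant of the two-point estimate. -/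
noncomputable def twoPointConst (d n : ℕ) : ℝ :=
  n * (2 * √√(supportConst d : ℝ) * √(filterConst d * kernelConst d))

theorem kernelConst_pos (hd : 1 ≤ d) : 0 < kernelConst d := by unfold kernelConst; positivity

theorem supportConst_pos (hd : 1 ≤ d) : 0 < supportConst d := by unfold supportConst; positivity

theorem twoPointConst_pos (hd : 1 ≤ d) (hn : 1 ≤ n) : 0 < twoPointConst d n := by
  have h1 := kernelConst_pos hd
  have h2 := filterConst_pos d
  have h3 : (0 : ℝ) < supportConst d := by exact_mod_cast supportConst_pos hd
  have h4 : (0 : ℝ) < n := by exact_mod_cast hn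
  unfold twoPointConst
  positivity

theorem norm_le_sum_abs (x : EuclideanSpace ℝ (Fin n)) : ‖x‖ ≤ ∑ l, |x l| := by
  have h : x = ∑ l, EuclideanSpace.single l (x l) := by
    ext i
    simp
  calc ‖x‖ = ‖∑ l, EuclideanSpace.single l (x l)‖ := by rw [← h]
    _ ≤ ∑ l, ‖EuclideanSpace.single l (x l)‖ := norm_sum_le _ _
    _ = _ := by simp

variable [MeasurableSpace (Potential n)] {K κ lam : ℝ} {Ω : Type*} [MeasurableSpace Ω]
  {P : Measure Ω} {η : Ω → Environment d n} {φ : Ω → Config d n}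

theorem quarticBound_coord_sub [IsProbabilityMeasure P] (hd : 1 ≤ d) (hη : Measurable η)
    (hE : ExiMin (P.map η)) (hS : Stat (P.map η)) (hC : Conc (P.map η) K κ) (hK : 0 < K)
    (hκ : 0 < κ) (hlam : 0 < lam) {L : ℕ}
    (hφ : ∀ᵐ ω ∂P, IsGroundConfig (η ω) lam (box d L) 0 (φ ω)) {v w : Fin d → ℤ} {D : ℝ}
    (hv : InClosedBox L v) (hw : InClosedBox L w) (hD : ∀ i, |((v i - w i : ℤ) : ℝ)| ≤ D)
    (hD0 : 0 < D) (l : Fin n) :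
    QuarticBound P (κ / 2) (momentConst K κ) (fun ω => φ ω v l - φ ω w l)
      (2 * √√(supportConst d : ℝ) * √(filterConst d * kernelConst d) * √lam *
        scaleSum d (topScale L) D) := by
  obtain ⟨h, hsupp, henergy, hcard, hsum⟩ := exists_multiscale_potentials hd L hv hw hD
  set J := topScale L with hJ
  have hS0 : (0 : ℝ) < supportConst d := by exact_mod_cast supportConst_pos hd
  have hF0 : 0 < filterConst d * kernelConst d := mul_pos (filterConst_pos d) (kernelConst_pos hd)
  have hsl : 0 < √lam := Real.sqrt_pos.2 hlam
  set c := 2 * √√(supportConst d : ℝ) * √(filterConst d * kernelConst d) * √lam with hc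
  have hc0 : 0 < c := by positivity
  have hterm : ∀ j ∈ range (J + 1), QuarticBound P (κ / 2) (momentConst K κ)
      (fun ω => ∑ x ∈ box d L, φ ω x l * negLaplacian (h j) x)
      (c * (((2 : ℝ) ^ j) ^ ((4 - (d : ℝ)) / 4) * min 1 (D / 2 ^ j))) := by
    intro j hj
    have hjJ : j ≤ J := Nat.lt_succ_iff.1 (mem_range.1 hj)
    have hmin : 0 < min 1 (D / 2 ^ j) := by positivity
    have h4 : (4 : ℝ) ^ j = ((2 : ℝ) ^ j) ^ 2 := by
      rw [← pow_mul, mul_comm, pow_mul]; norm_num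
    have he := henergy j hjJ
    rw [h4] at he
    refine QuarticBound.of_tail hK hκ (aemeasurable_pairing hη hE hS hC hlam hφ l (hsupp j))
      (by positivity) fun t ht => ?_
    have hcardR : (#{x ∈ box d L | h j x ≠ 0} : ℝ) ≤ supportConst d * ((2 : ℝ) ^ j) ^ d := by
      have := hcard j hjJ
      refine le_trans (le_of_eq ?_) (Nat.cast_le (α := ℝ).2 this |>.trans (le_of_eq ?_))
      · congr!
      · push_cast; ring
    have htail := measure_abs_pairing_ge_le hη hE hS hC hK hlam hφ l (hsupp j)
      (by positivity) hcardR (by positivity) he ht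
    have e := sqrt_sqrt_mul_sqrt_eq d hS0.le hF0.le (by positivity : (0 : ℝ) < 2 ^ j) hmin.le
    rw [mul_assoc (2 * √lam), e] at htail
    convert htail using 6
    rw [hc]; ring
  have htot := QuarticBound.sum (s := range (J + 1)) ⟨0, by simp⟩ (fun j _ => by positivity)
    (by positivity) hterm
  rw [← mul_sum] at htot
  refine htot.congr ?_
  filter_upwards [hφ] with ω hω
  exact hsum (fun x => φ ω x l) fun x hx => by
    have := hω.1 x hx
    simp [this]

/-- The increments of the ground configuration have quartic-exponential moments. One of the two points may
be taken on the outer boundary of the box, where the configuration vanishes. -/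
theorem quarticBound_norm_sub [IsProbabilityMeasure P] (hd : 1 ≤ d) (hn : 1 ≤ n)
    (hη : Measurable η)
    (hE : ExiMin (P.map η)) (hS : Stat (P.map η)) (hC : Conc (P.map η) K κ) (hK : 0 < K)
    (hκ : 0 < κ) (hlam : 0 < lam) {L : ℕ}
    (hφ : ∀ᵐ ω ∂P, IsGroundConfig (η ω) lam (box d L) 0 (φ ω)) {v w : Fin d → ℤ} {D : ℝ}
    (hv : InClosedBox L v) (hw : InClosedBox L w) (hD : ∀ i, |((v i - w i : ℤ) : ℝ)| ≤ D)
    (hD0 : 0 < D) :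
    QuarticBound P (κ / 2) (momentConst K κ) (fun ω => ‖φ ω v - φ ω w‖)
      (twoPointConst d n * √lam * scaleSum d (topScale L) D) := by
  set b := 2 * √√(supportConst d : ℝ) * √(filterConst d * kernelConst d) * √lam *
        scaleSum d (topScale L) D with hb
  have hb0 : 0 < b := by
    have h1 := kernelConst_pos hd
    have h2 := filterConst_pos d
    have h3 : (0 : ℝ) < supportConst d := by exact_mod_cast supportConst_pos hd
    have h4 := scaleSum_pos d (topScale L) hD0
    positivity
  have hcoord := fun l : Fin n => quarticBound_coord_sub hd hη hE hS hC hK hκ hlam hφ hv hw hD hD0 l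
  have hsum := QuarticBound.sum (s := (univ : Finset (Fin n))) ⟨⟨0, hn⟩, mem_univ _⟩
    (fun _ _ => hb0) (by positivity) (fun l _ => (hcoord l).abs)
  have hbn : ∑ _l : Fin n, b = twoPointConst d n * √lam * scaleSum d (topScale L) D := by
    simp [twoPointConst, hb]; ring
  rw [← hbn]
  refine hsum.of_abs_le (by positivity) (sum_pos (fun _ _ => hb0) ⟨⟨0, hn⟩, mem_univ _⟩) le_rfl ?_ ?_
  · have hmeas : AEMeasurable (fun ω => √(∑ l, (φ ω v l - φ ω w l) ^ 2)) P :=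
      (Finset.aemeasurable_fun_sum univ fun l _ => ((hcoord l).aemeasurable.pow_const 2)).sqrt
    refine hmeas.congr (Filter.Eventually.of_forall fun ω => ?_)
    simp [EuclideanSpace.norm_eq]
  · refine Filter.Eventually.of_forall fun ω => ?_
    rw [abs_norm]
    refine (norm_le_sum_abs _).trans ((le_abs_self _).trans (le_of_eq ?_))
    simp

end TwoPoint

section ScaleSum

open Finset

theorem exists_scaleSum_le_heightScale {d : ℕ} (hd : 1 ≤ d) : ∃ C : ℝ, 0 < C ∧ ∀ (J : ℕ) (D : ℝ),
    1 ≤ D → scaleSum d J D ≤ C * heightScale d D := by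
  set α : ℝ := (4 - (d : ℝ)) / 4 with hα
  have hd1 : (1 : ℝ) ≤ d := by exact_mod_cast hd
  set r : ℝ := 2 ^ α with hr
  have hr0 : 0 < r := by positivity
  have hr2 : r / 2 < 1 := by
    rw [div_lt_one (by norm_num)]
    calc r < (2 : ℝ) ^ (1 : ℝ) := Real.rpow_lt_rpow_of_exponent_lt (by norm_num) (by linarith)
      _ = 2 := Real.rpow_one 2
  set c := (1 - r / 2)⁻¹ with hc
  have hc0 : 0 < c := inv_pos.2 (by linarith)
  have hpow : ∀ j : ℕ, ((2 : ℝ) ^ j) ^ α = r ^ j := by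
    intro j
    rw [hr, ← Real.rpow_natCast, ← Real.rpow_natCast, ← Real.rpow_mul (by norm_num),
      ← Real.rpow_mul (by norm_num), mul_comm]
  -- split at the largest `m` with `2 ^ m ≤ D`
  have hsplit : ∀ (J : ℕ) (D : ℝ), 1 ≤ D → ∃ m : ℕ, (2 : ℝ) ^ m ≤ D ∧
      scaleSum d J D ≤ ∑ j ∈ range (m + 1), r ^ j + c * D ^ α := by
    intro J D hD
    obtain ⟨m, hm1, hm2⟩ := exists_nat_pow_near hD (by norm_num : (1 : ℝ) < 2)
    refine ⟨m, hm1, ?_⟩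
    have hD0 : 0 < D := by linarith
    have h1 : scaleSum d J D ≤ ∑ j ∈ range (m + 1), r ^ j +
        ∑ j ∈ Ico (m + 1) (J + 1), D * (r / 2) ^ j := by
      calc scaleSum d J D = ∑ j ∈ range (J + 1), r ^ j * min 1 (D / 2 ^ j) := by
            simp only [scaleSum, ← hα, hpow]
        _ ≤ ∑ j ∈ range (m + 1) ∪ Ico (m + 1) (J + 1), r ^ j * min 1 (D / 2 ^ j) := by
            refine sum_le_sum_of_subset_of_nonneg (fun j hj => ?_) fun j _ _ => by positivity
            simp only [mem_union, mem_range, mem_Ico] at *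
            omega
        _ = ∑ j ∈ range (m + 1), r ^ j * min 1 (D / 2 ^ j) +
            ∑ j ∈ Ico (m + 1) (J + 1), r ^ j * min 1 (D / 2 ^ j) := by
            refine sum_union (disjoint_left.2 fun j hj hj' => ?_)
            simp only [mem_range, mem_Ico] at *
            omega
        _ ≤ _ := by
            refine add_le_add (sum_le_sum fun j _ => ?_) (sum_le_sum fun j _ => ?_)
            · exact mul_le_of_le_one_right (by positivity) (min_le_left _ _)
            · calc r ^ j * min 1 (D / 2 ^ j) ≤ r ^ j * (D / 2 ^ j) := by
                    gcongr; exact min_le_right _ _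
                _ = D * (r / 2) ^ j := by rw [div_pow]; ring
    refine h1.trans ?_
    gcongr
    rw [← mul_sum]
    have h2 := geom_sum_Ico_le_of_lt_one (m := m + 1) (n := J + 1) (by positivity) hr2
    have h3 : D * (r / 2) ^ (m + 1) ≤ D ^ α := by
      have e : (r / 2) ^ (m + 1) = ((2 : ℝ) ^ (m + 1)) ^ (α - 1) := by
        rw [Real.rpow_sub (by positivity), hpow, Real.rpow_one, div_pow]
      have h4 : ((2 : ℝ) ^ (m + 1)) ^ (α - 1) ≤ D ^ (α - 1) :=
        Real.rpow_le_rpow_of_nonpos hD0 hm2.le (by rw [hα]; linarith)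
      calc D * (r / 2) ^ (m + 1) ≤ D * D ^ (α - 1) := by rw [e]; gcongr
        _ = D ^ α := by
          rw [Real.rpow_sub hD0, Real.rpow_one]; field_simp
    calc D * ∑ j ∈ Ico (m + 1) (J + 1), (r / 2) ^ j ≤ D * ((r / 2) ^ (m + 1) / (1 - r / 2)) := by
          gcongr
      _ = c * (D * (r / 2) ^ (m + 1)) := by rw [hc]; ring
      _ ≤ c * D ^ α := by gcongr
  rcases lt_trichotomy d 4 with h4 | h4 | h4
  · -- low dimensions: the largest scale dominates
    have hd3 : (d : ℝ) ≤ 3 := by exact_mod_cast Nat.lt_succ_iff.1 h4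
    have hr1 : 1 < r := Real.one_lt_rpow (by norm_num) (by linarith)
    refine ⟨r / (r - 1) + c, by have : 0 < r - 1 := by linarith
                                positivity, fun J D hD => ?_⟩
    obtain ⟨m, hm, hle⟩ := hsplit J D hD
    have hh : heightScale d D = D ^ α := by rw [heightScale, if_pos (by omega)]
    rw [hh]
    have h1 : r ^ m ≤ D ^ α := by
      rw [← hpow]; exact Real.rpow_le_rpow (by positivity) hm (by linarith)
    have h2 : ∑ j ∈ range (m + 1), r ^ j ≤ r / (r - 1) * D ^ α := by
      rw [geom_sum_eq hr1.ne', div_mul_eq_mul_div]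
      have : 0 < r - 1 := by linarith
      gcongr
      calc r ^ (m + 1) - 1 ≤ r * r ^ m := by rw [pow_succ]; linarith
        _ ≤ _ := by gcongr
    linarith
  · -- critical dimension: all scales up to `D` contribute equally
    have hα0 : α = 0 := by rw [hα, h4]; norm_num
    have hr1 : r = 1 := by rw [hr, hα0, Real.rpow_zero]
    have hl2 : 0 < Real.log 2 := Real.log_pos (by norm_num)
    refine ⟨(2 + c) / Real.log 2, by positivity, fun J D hD => ?_⟩
    obtain ⟨m, hm, hle⟩ := hsplit J D hD
    have hh : heightScale d D = Real.log (D + 1) := by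
      rw [heightScale, if_neg (by omega), if_pos h4]
    rw [hr1, hα0, Real.rpow_zero] at hle
    simp only [one_pow, sum_const, card_range, nsmul_eq_mul, mul_one, Nat.cast_add,
      Nat.cast_one] at hle
    have h1 : m * Real.log 2 ≤ Real.log (D + 1) := by
      rw [← Real.log_pow]
      exact Real.log_le_log (by positivity) (by linarith)
    have h2 : Real.log 2 ≤ Real.log (D + 1) := Real.log_le_log (by norm_num) (by linarith)
    rw [hh, div_mul_eq_mul_div, le_div_iff₀ hl2]
    calc scaleSum d J D * Real.log 2 ≤ ((m : ℝ) + 1 + c) * Real.log 2 := by gcongr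
      _ = m * Real.log 2 + (1 + c) * Real.log 2 := by ring
      _ ≤ Real.log (D + 1) + (1 + c) * Real.log (D + 1) := by gcongr
      _ = _ := by ring
  · -- high dimensions: the smallest scale dominates
    have hd5 : (5 : ℝ) ≤ d := by exact_mod_cast h4
    have hr1 : r < 1 := Real.rpow_lt_one_of_one_lt_of_neg (by norm_num) (by rw [hα]; linarith)
    refine ⟨(1 - r)⁻¹ + c, by have : 0 < 1 - r := by linarith
                              positivity, fun J D hD => ?_⟩
    obtain ⟨m, hm, hle⟩ := hsplit J D hD
    have hh : heightScale d D = 1 := by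
      rw [heightScale, if_neg (by omega), if_neg (by omega)]
    have h1 := geom_sum_Ico_le_of_lt_one (m := 0) (n := m + 1) hr0.le hr1
    rw [Nat.Ico_zero_eq_range, pow_zero, one_div] at h1
    have h2 : c * D ^ α ≤ c * 1 := by
      gcongr
      exact Real.rpow_le_one_of_one_le_of_nonpos hD (by rw [hα]; linarith)
    rw [hh]
    linarith

end ScaleSum

/-! ### The mean height -/

section MeanHeight

open Finset

variable {d n : ℕ}

/-- The distance of `v` to the complement of the box is the integer `min (L + 1 - |v i|)`, and it is
attained on the outer boundary of the box. -/
theorem exists_boundaryDist_eq (hd : 1 ≤ d) {L : ℕ} {v : Fin d → ℤ} (hv : v ∈ box d L) :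
    ∃ r : ℕ, boundaryDist d L v = r ∧ 1 ≤ r ∧ r ≤ L + 1 ∧ (∃ i, |v i| + r = L + 1) ∧
      ∃ w, w ∉ box d L ∧ InClosedBox L w ∧ ∀ i, |((v i - w i : ℤ) : ℝ)| ≤ r := by
  have hne : (univ : Finset (Fin d)).Nonempty := ⟨⟨0, hd⟩, mem_univ _⟩
  obtain ⟨i, -, hi⟩ := exists_max_image univ (fun i => |v i|) hne
  have hvb := hv
  rw [mem_box] at hv
  obtain ⟨r, hr⟩ := Int.eq_ofNat_of_zero_le (by have := hv i; omega : 0 ≤ (L : ℤ) + 1 - |v i|)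
  have hvi := hv i
  have hvi0 := abs_nonneg (v i)
  obtain ⟨s, hs1, hs2⟩ : ∃ s : ℤ, |s| = L + 1 ∧ |v i - s| = r := by
    rcases le_total 0 (v i) with h | h
    · refine ⟨L + 1, abs_of_nonneg (by positivity), ?_⟩
      rw [abs_of_nonneg h] at hr hvi
      rw [abs_sub_comm, abs_of_nonneg (by omega)]; omega
    · refine ⟨-(L + 1), by rw [abs_neg]; exact abs_of_nonneg (by positivity), ?_⟩
      rw [abs_of_nonpos h] at hr hvi
      rw [abs_of_nonneg (by omega)]; omega
  have hvw : ∀ j, |((v j - Function.update v i s j : ℤ) : ℝ)| ≤ r := by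
    intro j
    by_cases h : j = i
    · subst h
      rw [Function.update_self, ← Int.cast_abs, hs2]
      simp
    · rw [Function.update_of_ne h]; simp
  have hw : Function.update v i s ∈ (box d L : Set (Fin d → ℤ))ᶜ := by
    intro hmem
    have := mem_box.1 (mem_coe.1 hmem) i
    rw [Function.update_self, hs1] at this
    omega
  refine ⟨r, ?_, by omega, by omega, ⟨i, by omega⟩, Function.update v i s,
    fun h => hw (mem_coe.2 h), fun j => ?_, hvw⟩
  swap
  · by_cases h : j = i
    · subst h; rw [Function.update_self, hs1]
    · rw [Function.update_of_ne h]
      exact inClosedBox_of_mem_box hvb j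
  apply le_antisymm
  · refine (Metric.infDist_le_dist_of_mem hw).trans ?_
    rw [dist_pi_le_iff (by positivity)]
    intro j
    rw [Int.dist_eq, ← Int.cast_sub]
    exact hvw j
  · refine (Metric.le_infDist ⟨_, hw⟩).2 fun y hy => ?_
    have hy' : y ∉ box d L := fun h => hy (mem_coe.2 h)
    rw [mem_box] at hy'
    push Not at hy'
    obtain ⟨j, hj⟩ := hy'
    refine le_trans ?_ (dist_le_pi_dist v y j)
    rw [Int.dist_eq, ← Int.cast_sub, ← Int.cast_abs]
    have h1 := hi j (mem_univ j)
    have h2 : |y j| - |v j| ≤ |v j - y j| := by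
      rw [abs_sub_comm]; exact abs_sub_abs_le_abs_sub _ _
    exact_mod_cast (by omega : (r : ℤ) ≤ |v j - y j|)

/-- The height of the ground configuration at distance `r` from the boundary. -/
theorem exists_mean_height_bound (hd : 1 ≤ d) (hn : 1 ≤ n) {K κ : ℝ} (hK : 0 < K) (hκ : 0 < κ) :
    ∃ C : ℝ, 0 < C ∧ ∀ (Ω : Type*) [MeasurableSpace Ω] (P : Measure Ω) [IsProbabilityMeasure P]
      [MeasurableSpace (Potential n)] (η : Ω → Environment d n), Measurable η →
      ExiMin (P.map η) → Stat (P.map η) → Conc (P.map η) K κ →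
      ∀ (L : ℕ) (lam : ℝ), 0 < lam →
      ∀ (φ : Ω → Config d n), (∀ᵐ ω ∂P, IsGroundConfig (η ω) lam (box d L) 0 (φ ω)) →
      ∀ v ∈ box d L, Integrable (fun ω => ‖φ ω v‖) P ∧
        ∫ ω, ‖φ ω v‖ ∂P ≤ C * √lam * heightScale d (boundaryDist d L v) := by
  obtain ⟨C, hC0, hCle⟩ := exists_scaleSum_le_heightScale hd
  have hT := twoPointConst_pos hd hn
  have hM := momentConst_pos hK hκ
  refine ⟨twoPointConst d n * C * (1 + 1 / (κ / 2)) * momentConst K κ, by positivity, ?_⟩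
  intro Ω _ P _ _ η hη hE hS hC L lam hlam φ hφ v hv
  obtain ⟨r, hrr, hr1, -, -, w, hwb, hwc, hvw⟩ := exists_boundaryDist_eq hd hv
  have hr : 1 ≤ boundaryDist d L v := by rw [hrr]; exact_mod_cast hr1
  rw [← hrr] at hvw
  have hr0 : 0 < boundaryDist d L v := by linarith
  have hsl : 0 < √lam := Real.sqrt_pos.2 hlam
  have hq := quarticBound_norm_sub hd hn hη hE hS hC hK hκ hlam hφ (inClosedBox_of_mem_box hv)
    hwc hvw hr0
  have hq' : QuarticBound P (κ / 2) (momentConst K κ) (fun ω => ‖φ ω v‖) _ := hq.congr (by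
    filter_upwards [hφ] with ω hω
    have : φ ω w = 0 := hω.1 w hwb
    rw [this, sub_zero])
  have hsp := scaleSum_pos d (topScale L) hr0
  obtain ⟨h1, h2⟩ := hq'.integrable_and_integral_le (by positivity) hM.le (by positivity)
  refine ⟨h1, ?_⟩
  simp only [abs_norm] at h2
  refine h2.trans ?_
  calc twoPointConst d n * √lam * scaleSum d (topScale L) (boundaryDist d L v) *
        (1 + 1 / (κ / 2)) * momentConst K κ
      ≤ twoPointConst d n * √lam * (C * heightScale d (boundaryDist d L v)) *
        (1 + 1 / (κ / 2)) * momentConst K κ := by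
        gcongr
        exact hCle _ _ hr
    _ = _ := by ring

end MeanHeight

/-! ### Chaining towards the boundary -/

section Chaining

open Finset

variable {d n : ℕ}

/-- The point of the closed box whose distances to the coordinate faces on the side given by the signs
`σ` are `b`. -/
def facePoint (L : ℕ) (σ : Fin d → Bool) (b : Fin d → ℕ) (i : Fin d) : ℤ :=
  if σ i then (L : ℤ) + 1 - b i else (b i : ℤ) - (L + 1)

theorem abs_facePoint {L : ℕ} (σ : Fin d → Bool) {b : Fin d → ℕ} (hb : ∀ i, b i ≤ L + 1) (i : Fin d) :
    |facePoint L σ b i| = L + 1 - b i := by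
  have := hb i
  unfold facePoint
  split_ifs
  · rw [abs_of_nonneg (by omega)]
  · rw [abs_of_nonpos (by omega)]; ring

theorem inClosedBox_facePoint {L : ℕ} (σ : Fin d → Bool) {b : Fin d → ℕ} (hb : ∀ i, b i ≤ L + 1) :
    InClosedBox L (facePoint L σ b) := fun i => by
  rw [abs_facePoint σ hb]; omega

theorem facePoint_not_mem_box {L : ℕ} (σ : Fin d → Bool) {b : Fin d → ℕ} (hb : ∀ i, b i ≤ L + 1)
    {i : Fin d} (hi : b i = 0) : facePoint L σ b ∉ box d L := fun h => by
  have := mem_box.1 h i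
  rw [abs_facePoint σ hb, hi] at this
  push_cast at this
  omega

theorem exists_facePoint_eq {L : ℕ} {v : Fin d → ℤ} (hv : v ∈ box d L) :
    ∃ (σ : Fin d → Bool) (b : Fin d → ℕ), (∀ i, b i ≤ L + 1) ∧ (∀ i, |v i| + b i = L + 1) ∧
      facePoint L σ b = v := by
  rw [mem_box] at hv
  refine ⟨fun i => decide (0 ≤ v i), fun i => (L + 1 - |v i|).toNat, fun i => ?_, fun i => ?_, ?_⟩
  · have := hv i; have := abs_nonneg (v i); dsimp only; omega
  · have := hv i; dsimp only; omega
  · funext i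
    have := hv i
    by_cases h : 0 ≤ v i
    · simp only [facePoint, h, decide_true, if_true]
      rw [abs_of_nonneg h] at *; omega
    · simp only [facePoint, h, decide_false, Bool.false_eq_true, if_false]
      rw [abs_of_neg (not_le.1 h)] at *; omega

theorem abs_facePoint_sub_le (L k : ℕ) (σ : Fin d → Bool) (a : Fin d → ℕ) (i : Fin d) :
    |((facePoint L σ (fun i => 2 ^ k * a i) i -
      facePoint L σ (fun i => 2 ^ (k + 1) * (a i / 2)) i : ℤ) : ℝ)| ≤ 2 ^ k := by
  have h : |(facePoint L σ (fun i => 2 ^ k * a i) i -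
      facePoint L σ (fun i => 2 ^ (k + 1) * (a i / 2)) i : ℤ)| ≤ 2 ^ k := by
    have hmod : a i = 2 * (a i / 2) + a i % 2 := (Nat.div_add_mod (a i) 2).symm
    have hlt : a i % 2 < 2 := Nat.mod_lt _ (by norm_num)
    have key : ((2 ^ k * a i : ℕ) : ℤ) - ((2 ^ (k + 1) * (a i / 2) : ℕ) : ℤ) =
        2 ^ k * ((a i % 2 : ℕ) : ℤ) := by
      conv_lhs => rw [hmod]
      have e : (2 * (a i / 2) + a i % 2) / 2 = a i / 2 := by omega
      rw [e]; push_cast; ring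
    have hp : (0 : ℤ) < 2 ^ k := by positivity
    have h01 : ((a i % 2 : ℕ) : ℤ) = 0 ∨ ((a i % 2 : ℕ) : ℤ) = 1 := by omega
    have hkey2 : |((2 ^ k * a i : ℕ) : ℤ) - ((2 ^ (k + 1) * (a i / 2) : ℕ) : ℤ)| ≤ 2 ^ k := by
      rw [key]
      rcases h01 with h | h <;> rw [h] <;> simp
    rw [abs_le] at *
    unfold facePoint
    split_ifs <;> constructor <;> linarith [hkey2.1, hkey2.2]
  have := (Int.cast_le (R := ℝ)).2 h
  push_cast at this ⊢
  exact this

/-- Chaining of a function vanishing outside the box along the roundings of a point of the box. -/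
theorem norm_le_sum_chain {E : Type*} [NormedAddCommGroup E] {L : ℕ} (f : (Fin d → ℤ) → E)
    (hf : ∀ x, x ∉ box d L → f x = 0) (σ : Fin d → Bool) {b : Fin d → ℕ} (hb : ∀ i, b i ≤ L + 1)
    {m : ℕ} {i : Fin d} (hi : b i < 2 ^ m) :
    ‖f (facePoint L σ b)‖ ≤ ∑ k ∈ range m,
      ‖f (facePoint L σ fun i => 2 ^ k * (b i / 2 ^ k)) -
        f (facePoint L σ fun i => 2 ^ (k + 1) * (b i / 2 ^ k / 2))‖ := by
  have h0 : f (facePoint L σ fun i => 2 ^ m * (b i / 2 ^ m)) = 0 := by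
    refine hf _ (facePoint_not_mem_box σ (fun j => (Nat.mul_div_le _ _).trans (hb j)) (i := i) ?_)
    simp [Nat.div_eq_of_lt hi]
  have htel := sum_range_sub' (fun k => f (facePoint L σ fun i => 2 ^ k * (b i / 2 ^ k))) m
  have e : f (facePoint L σ b) = ∑ k ∈ range m,
      (f (facePoint L σ fun i => 2 ^ k * (b i / 2 ^ k)) -
        f (facePoint L σ fun i => 2 ^ (k + 1) * (b i / 2 ^ k / 2))) := by
    have : ∀ k, (fun i => 2 ^ (k + 1) * (b i / 2 ^ k / 2)) =
        fun i => 2 ^ (k + 1) * (b i / 2 ^ (k + 1)) := by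
      intro k; funext i; rw [Nat.div_div_eq_div_mul, pow_succ]
    simp only [this]
    rw [htel, h0]
    simp
  rw [e]
  exact norm_sum_le _ _

/-- The rounded positions, in units of the current scale, of points whose distance to the boundary is
below `2 ^ (m + 1)` units while the box has size at most `2 ^ (j + m + 1)` units. -/
def chainIndex (d j m : ℕ) : Finset (Fin d → ℕ) :=
  univ.biUnion fun i => Fintype.piFinset fun i' => range (if i' = i then 2 ^ (m + 1) else 2 ^ (j + m + 1))

theorem card_chainIndex_le (hd : 1 ≤ d) (j m : ℕ) :
    #(chainIndex d j m) ≤ d * 2 ^ d * ((2 ^ (d - 1)) ^ j * (2 ^ d) ^ m) := by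
  refine card_biUnion_le.trans ?_
  have h : ∀ i : Fin d, #(Fintype.piFinset fun i' : Fin d =>
      range (if i' = i then 2 ^ (m + 1) else 2 ^ (j + m + 1))) =
      2 ^ d * ((2 ^ (d - 1)) ^ j * (2 ^ d) ^ m) := by
    intro i
    rw [Fintype.card_piFinset]
    simp only [card_range]
    rw [← mul_prod_erase univ _ (mem_univ i), if_pos rfl]
    rw [prod_congr rfl fun x hx => if_neg (ne_of_mem_erase hx), prod_const, card_erase_of_mem
      (mem_univ i), card_univ, Fintype.card_fin]
    obtain ⟨e, rfl⟩ : ∃ e, d = e + 1 := ⟨d - 1, by omega⟩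
    simp only [Nat.add_sub_cancel, ← pow_mul, ← pow_add]
    congr 1
    ring
  rw [sum_congr rfl fun i _ => h i]
  simp [mul_assoc]

end Chaining

/-! ### The maximal height -/

section MaximalHeight

open Finset

variable {d n : ℕ}

theorem exists_increment_tail (hd : 1 ≤ d) (hd3 : d ≤ 3) (hn : 1 ≤ n) {K κ : ℝ} (hK : 0 < K)
    (hκ : 0 < κ) :
    ∃ C : ℝ, 0 < C ∧ ∀ (Ω : Type*) [MeasurableSpace Ω] (P : Measure Ω) [IsProbabilityMeasure P]
      [MeasurableSpace (Potential n)] (η : Ω → Environment d n), Measurable η →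
      ExiMin (P.map η) → Stat (P.map η) → Conc (P.map η) K κ →
      ∀ (L : ℕ) (lam : ℝ), 0 < lam →
      ∀ (φ : Ω → Config d n), (∀ᵐ ω ∂P, IsGroundConfig (η ω) lam (box d L) 0 (φ ω)) →
      ∀ (v w : Fin d → ℤ) (D : ℝ), InClosedBox L v → InClosedBox L w → 1 ≤ D →
      (∀ i, |((v i - w i : ℤ) : ℝ)| ≤ D) → ∀ t : ℝ, 0 ≤ t →
      P {ω | t * (C * √lam * D ^ ((4 - (d : ℝ)) / 4)) ≤ ‖φ ω v - φ ω w‖} ≤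
        ENNReal.ofReal (momentConst K κ * Real.exp (-(κ / 2) * t ^ 4)) := by
  obtain ⟨C, hC0, hCle⟩ := exists_scaleSum_le_heightScale hd
  have hT := twoPointConst_pos hd hn
  refine ⟨twoPointConst d n * C, by positivity, ?_⟩
  intro Ω _ P _ _ η hη hE hS hC L lam hlam φ hφ v w D hv hw hD hvw t ht
  have hD0 : 0 < D := by linarith
  have hsl : 0 < √lam := Real.sqrt_pos.2 hlam
  have hq := quarticBound_norm_sub hd hn hη hE hS hC hK hκ hlam hφ hv hw hvw hD0
  have hsp := scaleSum_pos d (topScale L) hD0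
  have htail := hq.measure_ge_le (by positivity) (by positivity) ht
  refine (measure_mono fun ω hω => ?_).trans htail
  rw [Set.mem_ofPred_eq, abs_norm]
  refine le_trans ?_ (show t * (twoPointConst d n * C * √lam * D ^ ((4 - (d : ℝ)) / 4)) ≤ _ from hω)
  have h := hCle (topScale L) D hD
  rw [heightScale, if_pos hd3] at h
  calc t * (twoPointConst d n * √lam * scaleSum d (topScale L) D)
      ≤ t * (twoPointConst d n * √lam * (C * D ^ ((4 - (d : ℝ)) / 4))) := by gcongr
    _ = _ := by ring

/-- The ratio `q = 2 ^ (α / 2)` by which increments may grow from scale to scale along a chain. -/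
theorem exists_chain_ratio {α : ℝ} (hα : 1 / 4 ≤ α) : ∃ q : ℝ, 1 < q ∧
    (∀ k : ℕ, ((2 : ℝ) ^ k) ^ α = (q ^ k) ^ 2) ∧ ∀ m : ℕ, 1 + (m : ℝ) / 4 ≤ (q ^ m) ^ 4 := by
  refine ⟨2 ^ (α / 2), Real.one_lt_rpow (by norm_num) (by linarith), fun k => ?_, fun m => ?_⟩
  · rw [← pow_mul]
    simp only [← Real.rpow_natCast]
    rw [← Real.rpow_mul (by norm_num), ← Real.rpow_mul (by norm_num)]
    congr 1; push_cast; ring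
  · have e : ((2 : ℝ) ^ (α / 2)) ^ 4 = 2 ^ (2 * α) := by
      rw [← Real.rpow_natCast, ← Real.rpow_mul (by norm_num)]
      congr 1; push_cast; ring
    have h1 : (2 : ℝ) ^ (1 / 2 : ℝ) ≤ 2 ^ (2 * α) :=
      Real.rpow_le_rpow_of_exponent_le (by norm_num) (by linarith)
    rw [← Real.sqrt_eq_rpow, ← e] at h1
    have h2 : (5 / 4 : ℝ) ≤ √2 := Real.le_sqrt_of_sq_le (by norm_num)
    have h3 := one_add_mul_le_pow (a := (1 / 4 : ℝ)) (by norm_num) m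
    have h4 : (1 + 1 / 4 : ℝ) ^ m ≤ (((2 : ℝ) ^ (α / 2)) ^ 4) ^ m :=
      pow_le_pow_left₀ (by norm_num) (by linarith) m
    rw [← pow_mul, mul_comm m 4, pow_mul]
    linarith

theorem summable_two_pow_mul_exp (hd3 : d ≤ 3) :
    Summable fun m : ℕ => ((2 : ℝ) ^ d) ^ m * Real.exp (-4 * m) := by
  have e : (fun m : ℕ => ((2 : ℝ) ^ d) ^ m * Real.exp (-4 * m)) =
      fun m : ℕ => ((2 : ℝ) ^ d * Real.exp (-4)) ^ m := by
    funext m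
    rw [mul_pow, ← Real.exp_nat_mul]
    congr 2; ring
  rw [e]
  refine summable_geometric_of_lt_one (by positivity) ?_
  have h1 : (2 : ℝ) ^ d ≤ 2 ^ 3 := pow_le_pow_right₀ (by norm_num) hd3
  have h2 : (2 : ℝ) ^ 4 ≤ Real.exp 4 := by
    have := Real.add_one_le_exp (1 : ℝ)
    calc (2 : ℝ) ^ 4 ≤ Real.exp 1 ^ 4 := by gcongr; linarith
      _ = Real.exp 4 := by rw [← Real.exp_nat_mul]; norm_num
  rw [Real.exp_neg, ← div_eq_mul_inv, div_lt_one (Real.exp_pos _)]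
  linarith

theorem sum_range_sum_range_sub_le {y : ℝ} (hy : 0 ≤ y) {f h : ℕ → ℝ} (hf0 : ∀ j, 0 ≤ f j)
    (hh0 : ∀ m, 0 ≤ h m) (hf : Summable f) (hh : Summable h) (J : ℕ) :
    ∑ j ∈ range J, ∑ m ∈ range (J - j), ENNReal.ofReal (y * (f j * h m)) ≤
      ENNReal.ofReal (y * ((∑' j, f j) * ∑' m, h m)) := by
  have h0 : ∀ j m, 0 ≤ y * (f j * h m) := fun j m =>
    mul_nonneg hy (mul_nonneg (hf0 j) (hh0 m))
  calc ∑ j ∈ range J, ∑ m ∈ range (J - j), ENNReal.ofReal (y * (f j * h m))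
      ≤ ∑ j ∈ range J, ∑ m ∈ range J, ENNReal.ofReal (y * (f j * h m)) :=
        sum_le_sum fun j _ => sum_le_sum_of_subset (range_mono (Nat.sub_le _ _))
    _ = ENNReal.ofReal (y * ((∑ j ∈ range J, f j) * ∑ m ∈ range J, h m)) := by
        rw [sum_mul_sum, mul_sum, ENNReal.ofReal_sum_of_nonneg fun j _ =>
          mul_nonneg hy (sum_nonneg fun m _ => mul_nonneg (hf0 j) (hh0 m))]
        refine sum_congr rfl fun j _ => ?_
        rw [mul_sum, ENNReal.ofReal_sum_of_nonneg fun m _ => h0 j m]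
    _ ≤ _ := by
        refine ENNReal.ofReal_le_ofReal (mul_le_mul_of_nonneg_left ?_ hy)
        exact mul_le_mul (hf.sum_le_tsum _ fun j _ => hf0 j) (hh.sum_le_tsum _ fun m _ => hh0 m)
          (sum_nonneg fun m _ => hh0 m) (tsum_nonneg hf0)

/-- Up to dimension three, all heights are of order `r ^ ((4 - d) / 4)`, where `r` is the distance to the
boundary, up to a factor `(1 + g j) ^ (1 / 4)` depending on the ratio `2 ^ j` of the size of the box to
`r`. The summability condition on `g` makes the union bound over the regions at the various distances
from the boundary converge. -/
theorem exists_maximal_height_bound (hd : 1 ≤ d) (hd3 : d ≤ 3) (hn : 1 ≤ n) {K κ : ℝ} (hK : 0 < K)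
    (hκ : 0 < κ) (g : ℕ → ℝ) (hg0 : ∀ j, 0 ≤ g j)
    (hg : Summable fun j => ((2 : ℝ) ^ (d - 1)) ^ j * Real.exp (-4 * g j)) :
    ∃ B C c : ℝ, 0 < B ∧ 0 < C ∧ 0 < c ∧ ∀ (Ω : Type*) [MeasurableSpace Ω] (P : Measure Ω)
      [IsProbabilityMeasure P]
      [MeasurableSpace (Potential n)] (η : Ω → Environment d n), Measurable η →
      ExiMin (P.map η) → Stat (P.map η) → Conc (P.map η) K κ →
      ∀ (L : ℕ) (lam : ℝ), 0 < lam →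
      ∀ (φ : Ω → Config d n), (∀ᵐ ω ∂P, IsGroundConfig (η ω) lam (box d L) 0 (φ ω)) →
      ∀ t : ℝ, 0 < t →
      P {ω | ¬ ∀ v ∈ box d L, ∀ r : ℕ, boundaryDist d L v = r → ‖φ ω v‖ ≤
        t * (B * √lam * (1 + g (topScale L - (Nat.log 2 r + 1))) ^ (1 / 4 : ℝ) *
          (r : ℝ) ^ ((4 - (d : ℝ)) / 4))} ≤ ENNReal.ofReal (C * Real.exp (-c * t ^ 4)) := by
  obtain ⟨C₁, hC₁, hinc⟩ := exists_increment_tail hd hd3 hn hK hκ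
  set α : ℝ := (4 - (d : ℝ)) / 4 with hα
  have hd3' : (d : ℝ) ≤ 3 := by exact_mod_cast hd3
  have hA := momentConst_pos hK hκ
  set A := momentConst K κ with hAdef
  obtain ⟨q, hq1, hqsq, hqm⟩ := exists_chain_ratio (α := α) (by rw [hα]; linarith)
  have hq0 : 0 < q := by linarith
  have hg2 := summable_two_pow_mul_exp hd3
  set S₁ := ∑' j, ((2 : ℝ) ^ (d - 1)) ^ j * Real.exp (-4 * g j) with hS₁
  set S₂ := ∑' m : ℕ, ((2 : ℝ) ^ d) ^ m * Real.exp (-4 * m) with hS₂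
  have hS₁0 : 0 ≤ S₁ := tsum_nonneg fun j => by positivity
  have hS₂0 : 0 ≤ S₂ := tsum_nonneg fun j => by positivity
  have hq10 : 0 < q - 1 := by linarith
  refine ⟨C₁ * (q / (q - 1)), Real.exp 4 + A * (d * 4 ^ d) * (S₁ * S₂), κ / 8, by positivity,
    by positivity, by positivity, ?_⟩
  intro Ω _ P _ _ η hη hE hS hC L lam hlam φ hφ t ht
  have hsl : 0 < √lam := Real.sqrt_pos.2 hlam
  set T := κ / 8 * t ^ 4 with hT
  have hexpT : -(κ / 8) * t ^ 4 = -T := by rw [hT]; ring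
  rw [hexpT]
  rcases lt_or_ge T 4 with hT4 | hT4
  · -- for small `t` the bound is trivial
    refine prob_le_one.trans ?_
    rw [← ENNReal.ofReal_one]
    refine ENNReal.ofReal_le_ofReal ?_
    have h1 : 1 ≤ Real.exp 4 * Real.exp (-T) := by
      rw [← Real.exp_add]; exact Real.one_le_exp (by linarith)
    have h2 : 0 ≤ A * (d * 4 ^ d) * (S₁ * S₂) * Real.exp (-T) := by positivity
    linarith
  set J := topScale L with hJ
  have hLJ : L + 1 < 2 ^ J := lt_two_pow_topScale L
  -- the increment at scale `2 ^ k` over a cell at distance of order `2 ^ (k + m)` from the boundary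
  -- may exceed its typical size by a factor `q ^ m`, still summable against `2 ^ (k α)`
  let bad : ℕ → ℕ → (Fin d → Bool) → (Fin d → ℕ) → Set Ω := fun j m σ a =>
    {ω | t * ((1 + g j) ^ (1 / 4 : ℝ) * q ^ m) *
        (C₁ * √lam * ((2 : ℝ) ^ (J - j - 1 - m)) ^ α) ≤
      ‖φ ω (facePoint L σ fun i => 2 ^ (J - j - 1 - m) * a i) -
        φ ω (facePoint L σ fun i => 2 ^ (J - j - 1 - m + 1) * (a i / 2))‖}
  let idx : ℕ → ℕ → Finset (Fin d → ℕ) := fun j m =>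
    {a ∈ chainIndex d j m | ∀ i, 2 ^ (J - j - 1 - m) * a i ≤ L + 1}
  let Bad : Set Ω := ⋃ j ∈ range J, ⋃ m ∈ range (J - j), ⋃ σ ∈ (univ : Finset (Fin d → Bool)),
    ⋃ a ∈ idx j m, bad j m σ a
  have hbad : ∀ j m σ, ∀ a ∈ idx j m, P (bad j m σ a) ≤
      ENNReal.ofReal (A * (Real.exp (-T) * (Real.exp (-4 * g j) * Real.exp (-4 * m)))) := by
    intro j m σ a ha
    have ha2 := (mem_filter.1 ha).2
    have hg1 : 0 < 1 + g j := by linarith [hg0 j]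
    refine (hinc Ω P η hη hE hS hC L lam hlam φ hφ _ _ _
      (inClosedBox_facePoint σ ha2) (inClosedBox_facePoint σ fun i => ?_)
      (one_le_pow₀ (by norm_num)) (abs_facePoint_sub_le L _ σ a) _ (by positivity)).trans ?_
    · refine le_trans ?_ (ha2 i)
      rw [pow_succ, mul_assoc]
      exact Nat.mul_le_mul_left _ (Nat.mul_div_le _ _)
    · refine ENNReal.ofReal_le_ofReal ?_
      rw [← Real.exp_add, ← Real.exp_add]
      gcongr
      have e : (t * ((1 + g j) ^ (1 / 4 : ℝ) * q ^ m)) ^ 4 = t ^ 4 * ((1 + g j) * (q ^ m) ^ 4) := by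
        have : ((1 + g j) ^ (1 / 4 : ℝ)) ^ 4 = 1 + g j := by
          rw [← Real.rpow_natCast, ← Real.rpow_mul hg1.le]; norm_num
        rw [mul_pow, mul_pow, this]
      have h1 : (1 + g j + m) / 4 ≤ (1 + g j) * (q ^ m) ^ 4 := by
        have h2 := mul_le_mul_of_nonneg_left (hqm m) hg1.le
        have h3 : 0 ≤ g j * m := mul_nonneg (hg0 j) (Nat.cast_nonneg m)
        nlinarith [hg0 j, (Nat.cast_nonneg m : (0 : ℝ) ≤ m)]
      have h2 : T * (1 + g j + m) ≤ κ / 2 * (t ^ 4 * ((1 + g j) * (q ^ m) ^ 4)) := by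
        have := mul_le_mul_of_nonneg_left h1 (by positivity : 0 ≤ κ / 2 * t ^ 4)
        rw [hT]; linarith
      have h3 : 4 * (g j + m) ≤ T * (g j + m) := by
        have : 0 ≤ g j + m := add_nonneg (hg0 j) (Nat.cast_nonneg m)
        gcongr
      rw [e]
      linarith
  have hBad : P Bad ≤ ENNReal.ofReal ((Real.exp 4 + A * (d * 4 ^ d) * (S₁ * S₂)) *
      Real.exp (-T)) := by
    have hcell : ∀ j m, P (⋃ σ ∈ (univ : Finset (Fin d → Bool)), ⋃ a ∈ idx j m, bad j m σ a) ≤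
        ENNReal.ofReal (A * (d * 4 ^ d) * Real.exp (-T) *
          ((((2 : ℝ) ^ (d - 1)) ^ j * Real.exp (-4 * g j)) *
            (((2 : ℝ) ^ d) ^ m * Real.exp (-4 * m)))) := by
      intro j m
      set x := A * (Real.exp (-T) * (Real.exp (-4 * g j) * Real.exp (-4 * m))) with hx
      have hx0 : 0 ≤ x := by positivity
      calc P (⋃ σ ∈ (univ : Finset (Fin d → Bool)), ⋃ a ∈ idx j m, bad j m σ a)
          ≤ ∑ σ : Fin d → Bool, P (⋃ a ∈ idx j m, bad j m σ a) := measure_biUnion_finset_le _ _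
        _ ≤ ∑ σ : Fin d → Bool, ∑ a ∈ idx j m, P (bad j m σ a) :=
            sum_le_sum fun σ _ => measure_biUnion_finset_le _ _
        _ ≤ ∑ σ : Fin d → Bool, ∑ a ∈ idx j m, ENNReal.ofReal x :=
            sum_le_sum fun σ _ => sum_le_sum fun a ha => hbad j m σ a ha
        _ = ENNReal.ofReal (2 ^ d * #(idx j m) * x) := by
            simp only [sum_const, card_univ, Fintype.card_fun, Fintype.card_bool, Fintype.card_fin,
              nsmul_eq_mul]
            rw [mul_assoc ((2 : ℝ) ^ d), ENNReal.ofReal_mul (p := 2 ^ d) (by positivity),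
              ENNReal.ofReal_mul (p := (#(idx j m) : ℝ)) (by positivity),
              ENNReal.ofReal_natCast, ENNReal.ofReal_pow (by norm_num)]
            simp
        _ ≤ _ := by
            refine ENNReal.ofReal_le_ofReal ?_
            have hc : (#(idx j m) : ℝ) ≤ d * 2 ^ d * (((2 : ℝ) ^ (d - 1)) ^ j * (2 ^ d) ^ m) := by
              exact_mod_cast (card_filter_le _ _).trans (card_chainIndex_le hd j m)
            calc 2 ^ d * #(idx j m) * x
                ≤ 2 ^ d * (d * 2 ^ d * (((2 : ℝ) ^ (d - 1)) ^ j * (2 ^ d) ^ m)) * x := by gcongr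
              _ = _ := by
                rw [hx, show (4 : ℝ) = 2 * 2 by norm_num, mul_pow]; ring
    set y := A * (d * 4 ^ d) * Real.exp (-T) with hy
    have hy0 : 0 ≤ y := by positivity
    calc P Bad ≤ ∑ j ∈ range J, P (⋃ m ∈ range (J - j),
            ⋃ σ ∈ (univ : Finset (Fin d → Bool)), ⋃ a ∈ idx j m, bad j m σ a) :=
          measure_biUnion_finset_le _ _
      _ ≤ ∑ j ∈ range J, ∑ m ∈ range (J - j), ENNReal.ofReal (y *
          ((((2 : ℝ) ^ (d - 1)) ^ j * Real.exp (-4 * g j)) *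
            (((2 : ℝ) ^ d) ^ m * Real.exp (-4 * m)))) :=
          sum_le_sum fun j _ => (measure_biUnion_finset_le _ _).trans
            (sum_le_sum fun m _ => hcell j m)
      _ ≤ ENNReal.ofReal (y * (S₁ * S₂)) :=
          sum_range_sum_range_sub_le hy0 (fun j => by positivity) (fun j => by positivity) hg hg2 J
      _ ≤ _ := by
          refine ENNReal.ofReal_le_ofReal ?_
          rw [hy]
          have : 0 ≤ Real.exp 4 * Real.exp (-T) := by positivity
          linarith
  refine (measure_mono_ae ?_).trans hBad
  filter_upwards [hφ] with ω hω hnot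
  change ¬ _ at hnot
  by_contra hgood
  change ω ∉ Bad at hgood
  simp only [Bad, Set.mem_iUnion, not_exists] at hgood
  apply hnot
  intro v hv r hr
  obtain ⟨r', hr', hr1, hrL, ⟨i₀, hi₀⟩, -⟩ := exists_boundaryDist_eq hd hv
  have hrr : r' = r := by exact_mod_cast hr'.symm.trans hr
  subst hrr
  obtain ⟨σ, b, hb, hbv, rfl⟩ := exists_facePoint_eq hv
  have hbi₀ : b i₀ = r' := by have := hbv i₀; omega
  set k₁ := Nat.log 2 r' with hk₁
  have hk₁le : 2 ^ k₁ ≤ r' := Nat.pow_log_le_self 2 (by omega)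
  have hk₁lt : r' < 2 ^ (k₁ + 1) := Nat.lt_pow_succ_log_self (by norm_num) _
  have hMJ : k₁ + 1 ≤ J := by
    have : 2 ^ k₁ < 2 ^ J := by omega
    exact (Nat.pow_lt_pow_iff_right (by norm_num)).1 this
  set j := J - (k₁ + 1) with hj
  have hg1 : 0 < 1 + g j := by linarith [hg0 j]
  have hzero : ∀ x, x ∉ box d L → φ ω x = 0 := fun x hx => hω.1 x hx
  refine (norm_le_sum_chain (φ ω) hzero σ hb (m := k₁ + 1) (i := i₀) (by omega)).trans ?_
  have hstep : ∀ k ∈ range (k₁ + 1), ‖φ ω (facePoint L σ fun i => 2 ^ k * (b i / 2 ^ k)) -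
      φ ω (facePoint L σ fun i => 2 ^ (k + 1) * (b i / 2 ^ k / 2))‖ ≤
      t * (C₁ * √lam * (1 + g j) ^ (1 / 4 : ℝ)) * q ^ k₁ * q ^ k := by
    intro k hk
    have hk' : k ≤ k₁ := Nat.lt_succ_iff.1 (mem_range.1 hk)
    have hjm : J - j - 1 - (k₁ - k) = k := by omega
    have hmem : (fun i => b i / 2 ^ k) ∈ idx j (k₁ - k) := by
      refine mem_filter.2 ⟨mem_biUnion.2 ⟨i₀, mem_univ _, Fintype.mem_piFinset.2 fun i => ?_⟩,
        fun i => ?_⟩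
      · rw [mem_range]
        apply Nat.div_lt_of_lt_mul
        split_ifs with h
        · subst h
          rw [hbi₀, ← pow_add]
          have : k + (k₁ - k + 1) = k₁ + 1 := by omega
          rwa [this]
        · rw [← pow_add]
          have : k + (j + (k₁ - k) + 1) = J := by omega
          rw [this]
          exact (hb i).trans_lt hLJ
      · rw [hjm]
        exact (Nat.mul_div_le _ _).trans (hb i)
    have hng := hgood j (mem_range.2 (by omega)) (k₁ - k) (mem_range.2 (by omega)) σ (mem_univ _)
      _ hmem
    simp only [bad, hjm] at hng
    rw [Set.mem_ofPred_eq, not_le] at hng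
    refine hng.le.trans (le_of_eq ?_)
    rw [hqsq]
    have : q ^ k₁ = q ^ (k₁ - k) * q ^ k := by rw [← pow_add]; congr 1; omega
    rw [this]; ring
  refine (sum_le_sum hstep).trans ?_
  rw [← mul_sum]
  have hgeo : ∑ k ∈ range (k₁ + 1), q ^ k ≤ q ^ k₁ * (q / (q - 1)) := by
    rw [geom_sum_eq hq1.ne', ← mul_div_assoc]
    gcongr
    rw [pow_succ]; linarith
  have hrα : (q ^ k₁) ^ 2 ≤ (r' : ℝ) ^ α := by
    rw [← hqsq]
    have : ((2 : ℝ) ^ k₁) ≤ r' := by exact_mod_cast hk₁le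
    exact Real.rpow_le_rpow (by positivity) this (by rw [hα]; linarith)
  calc t * (C₁ * √lam * (1 + g j) ^ (1 / 4 : ℝ)) * q ^ k₁ * ∑ k ∈ range (k₁ + 1), q ^ k
      ≤ t * (C₁ * √lam * (1 + g j) ^ (1 / 4 : ℝ)) * q ^ k₁ * (q ^ k₁ * (q / (q - 1))) := by gcongr
    _ = t * (C₁ * √lam * (1 + g j) ^ (1 / 4 : ℝ)) * (q / (q - 1)) * (q ^ k₁) ^ 2 := by ring
    _ ≤ t * (C₁ * √lam * (1 + g j) ^ (1 / 4 : ℝ)) * (q / (q - 1)) * (r' : ℝ) ^ α := by gcongr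
    _ = _ := by ring

end MaximalHeight

/-! ### The logarithmic factors -/

section LogFactors

theorem exists_pos_le_of_pos (S : Finset ℝ) : ∃ c : ℝ, 0 < c ∧ ∀ x ∈ S, 0 < x → c ≤ x := by
  induction S using Finset.induction_on with
  | empty => exact ⟨1, one_pos, by simp⟩
  | insert a S _ ih =>
    obtain ⟨c, hc, h⟩ := ih
    refine ⟨if 0 < a then min a c else c, ?_, fun x hx hx0 => ?_⟩
    · split_ifs with ha
      · exact lt_min ha hc
      · exact hc
    · rcases Finset.mem_insert.1 hx with rfl | hx
      · rw [if_pos hx0]; exact min_le_left _ _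
      · split_ifs
        · exact (min_le_right _ _).trans (h x hx hx0)
        · exact h x hx hx0

/-- The positive values of the iterated logarithm occurring in dimension one are bounded below: in large
boxes `3 L / r` exceeds `30 / 11 > e`, and small boxes give finitely many values. -/
theorem exists_logLog_lower_bound : ∃ c : ℝ, 0 < c ∧ ∀ L r : ℕ, 1 ≤ r → r ≤ L + 1 →
    0 < Real.log (Real.log (3 * L / r)) → c ≤ Real.log (Real.log (3 * L / r)) := by
  obtain ⟨c, hc, h⟩ := exists_pos_le_of_pos ((Finset.range 10 ×ˢ Finset.range 11).image
    fun p => Real.log (Real.log (3 * (p.1 : ℝ) / p.2)))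
  have hlog : 1 < Real.log (30 / 11) := by
    rw [Real.lt_log_iff_exp_lt (by norm_num)]
    exact Real.exp_one_lt_d9.trans (by norm_num)
  refine ⟨min c (Real.log (Real.log (30 / 11))), lt_min hc (Real.log_pos hlog), ?_⟩
  intro L r hr hrL hpos
  rcases lt_or_ge L 10 with hL | hL
  · refine (min_le_left _ _).trans (h _ (Finset.mem_image.2 ⟨(L, r), ?_, rfl⟩) hpos)
    simp only [Finset.mem_product, Finset.mem_range]
    omega
  · refine (min_le_right _ _).trans ?_
    have hr0 : (0 : ℝ) < r := by exact_mod_cast hr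
    have h1 : (30 / 11 : ℝ) ≤ 3 * L / r := by
      rw [div_le_div_iff₀ (by norm_num) hr0]
      exact_mod_cast (by omega : 30 * r ≤ 3 * L * 11)
    exact Real.log_le_log (by linarith) (Real.log_le_log (by norm_num) h1)

theorem two_pow_sub_mul_le {L r : ℕ} (hL : 1 ≤ L) (hr : 1 ≤ r) (hrL : r ≤ L + 1) :
    (2 : ℝ) ^ (topScale L - (Nat.log 2 r + 1)) * r ≤ 4 * L := by
  have h1 : r < 2 ^ (Nat.log 2 r + 1) := Nat.lt_pow_succ_log_self (by norm_num) _
  have h2 : 2 ^ Nat.log 2 r ≤ r := Nat.pow_log_le_self 2 (by omega)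
  have h3 := two_pow_topScale_le L
  have h4 := lt_two_pow_topScale L
  have hle : Nat.log 2 r + 1 ≤ topScale L := by
    have : 2 ^ Nat.log 2 r < 2 ^ topScale L := by omega
    exact (Nat.pow_lt_pow_iff_right (by norm_num)).1 this
  have h5 : 2 ^ (topScale L - (Nat.log 2 r + 1)) * r ≤ 2 ^ topScale L := by
    calc 2 ^ (topScale L - (Nat.log 2 r + 1)) * r
        ≤ 2 ^ (topScale L - (Nat.log 2 r + 1)) * 2 ^ (Nat.log 2 r + 1) := by gcongr
      _ = 2 ^ topScale L := by rw [← pow_add]; congr 1; omega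
  exact_mod_cast (by omega : 2 ^ (topScale L - (Nat.log 2 r + 1)) * r ≤ 4 * L)

theorem exists_log_factor : ∃ C : ℝ, 0 < C ∧ ∀ L r : ℕ, 1 ≤ L → 1 ≤ r → r ≤ L + 1 →
    1 + ((topScale L - (Nat.log 2 r + 1) : ℕ) : ℝ) ≤
      C * positiveOrOne (Real.log (2 * L / r)) := by
  have hl2 : 0 < Real.log 2 := Real.log_pos (by norm_num)
  have hl43 : 0 < Real.log (4 / 3) := Real.log_pos (by norm_num)
  refine ⟨2 + (2 / Real.log (4 / 3) + 1 / Real.log 2), by positivity, ?_⟩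
  intro L r hL hr hrL
  have hr0 : (0 : ℝ) < r := by exact_mod_cast hr
  have hL0 : (0 : ℝ) < L := by exact_mod_cast hL
  set j := topScale L - (Nat.log 2 r + 1) with hj
  set x := Real.log (2 * L / r) with hx
  have hjx : j * Real.log 2 ≤ Real.log 2 + x := by
    rw [← Real.log_pow, hx, ← Real.log_mul (by norm_num) (by positivity)]
    refine Real.log_le_log (by positivity) ?_
    rw [← mul_div_assoc, le_div_iff₀ hr0]
    linarith [two_pow_sub_mul_le hL hr hrL]
  have hjx' : (j : ℝ) ≤ 1 + x / Real.log 2 := by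
    rw [← sub_le_iff_le_add', le_div_iff₀ hl2]; linarith
  unfold positiveOrOne
  split_ifs with h
  · have hx43 : Real.log (4 / 3) ≤ x := by
      have h1 : (1 : ℝ) < 2 * L / r := (Real.log_pos_iff (by positivity)).1 h
      rw [lt_div_iff₀ hr0, one_mul] at h1
      have h2 : r < 2 * L := by exact_mod_cast h1
      refine Real.log_le_log (by norm_num) ?_
      rw [div_le_div_iff₀ (by norm_num) hr0]
      exact_mod_cast (by omega : 4 * r ≤ 2 * L * 3)
    have h2 : 2 ≤ 2 / Real.log (4 / 3) * x := by
      rw [div_mul_eq_mul_div, le_div_iff₀ hl43]; linarith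
    have h3 : x / Real.log 2 = 1 / Real.log 2 * x := by ring
    nlinarith
  · have : x / Real.log 2 ≤ 0 := div_nonpos_of_nonpos_of_nonneg (not_lt.1 h) hl2.le
    have : 0 ≤ 2 / Real.log (4 / 3) + 1 / Real.log 2 := by positivity
    linarith

theorem exists_logLog_factor : ∃ C : ℝ, 0 < C ∧ ∀ L r : ℕ, 1 ≤ L → 1 ≤ r → r ≤ L + 1 →
    1 + Real.log (1 + ((topScale L - (Nat.log 2 r + 1) : ℕ) : ℝ)) ≤
      C * positiveOrOne (Real.log (Real.log (3 * L / r))) := by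
  obtain ⟨c, hc, hlow⟩ := exists_logLog_lower_bound
  refine ⟨5 / c + 6, by positivity, ?_⟩
  intro L r hL hr hrL
  have hr0 : (0 : ℝ) < r := by exact_mod_cast hr
  have hL0 : (0 : ℝ) < L := by exact_mod_cast hL
  have hl2 : 1 / 2 < Real.log 2 := by linarith [Real.log_two_gt_d9]
  have hl2' : Real.log 2 < 1 := by linarith [Real.log_two_lt_d9]
  set j := topScale L - (Nat.log 2 r + 1) with hj
  set z := Real.log (3 * L / r) with hz
  have hz0 : 0 < z := by
    refine Real.log_pos ?_
    rw [lt_div_iff₀ hr0]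
    exact_mod_cast (by omega : 1 * r < 3 * L)
  have hjz : j * Real.log 2 ≤ Real.log 2 + z := by
    rw [← Real.log_pow, hz, ← Real.log_mul (by norm_num) (by positivity)]
    refine Real.log_le_log (by positivity) ?_
    rw [← mul_div_assoc, le_div_iff₀ hr0]
    linarith [two_pow_sub_mul_le hL hr hrL]
  have hj0 : (0 : ℝ) ≤ j := Nat.cast_nonneg j
  have hjz' : (j : ℝ) ≤ 2 + 2 * z := by nlinarith
  have hlow' := hlow L r hr hrL
  unfold positiveOrOne
  split_ifs with h
  · have hz1 : 1 < z := (Real.log_pos_iff hz0.le).1 h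
    have h5 : Real.log (1 + j) ≤ 4 + Real.log z := by
      have h6 : Real.log (1 + j) ≤ Real.log (5 * z) := Real.log_le_log (by linarith) (by linarith)
      rw [Real.log_mul (by norm_num) hz0.ne'] at h6
      have := Real.log_le_sub_one_of_pos (by norm_num : (0 : ℝ) < 5)
      linarith
    have h7 := hlow' h
    have h8 : 5 ≤ 5 / c * Real.log z := by
      rw [div_mul_eq_mul_div, le_div_iff₀ hc]; linarith
    nlinarith
  · have hz1 : z ≤ 1 := by
      by_contra hcon
      exact h (Real.log_pos (not_le.1 hcon))
    have h5 := Real.log_le_sub_one_of_pos (by linarith : (0 : ℝ) < 1 + j)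
    have h8 : 0 ≤ 5 / c := by positivity
    linarith

theorem summable_weight_log : Summable fun j : ℕ =>
    ((2 : ℝ) ^ (1 - 1)) ^ j * Real.exp (-4 * Real.log (1 + (j : ℝ))) := by
  have e : (fun j : ℕ => ((2 : ℝ) ^ (1 - 1)) ^ j * Real.exp (-4 * Real.log (1 + (j : ℝ)))) =
      fun j : ℕ => 1 / ((j + 1 : ℕ) : ℝ) ^ 4 := by
    funext j
    have hj : (0 : ℝ) < 1 + j := by positivity
    have h1 : Real.exp (-4 * Real.log (1 + (j : ℝ))) = ((1 + (j : ℝ)) ^ 4)⁻¹ := by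
      rw [neg_mul, Real.exp_neg]
      congr 1
      rw [show (4 : ℝ) = ((4 : ℕ) : ℝ) by norm_num, ← Real.log_pow, Real.exp_log (by positivity)]
    rw [h1]
    simp [add_comm]
  rw [e]
  exact (summable_nat_add_iff 1).2 (Real.summable_one_div_nat_pow.2 (by norm_num))

theorem summable_weight_id {d : ℕ} (hd3 : d ≤ 3) : Summable fun j : ℕ =>
    ((2 : ℝ) ^ (d - 1)) ^ j * Real.exp (-4 * (j : ℝ)) := by
  refine Summable.of_nonneg_of_le (fun j => by positivity) (fun j => ?_)
    (summable_two_pow_mul_exp hd3)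
  gcongr
  · norm_num
  · omega

end LogFactors

/-- An upper bound on the probability of the exceptional event gives the stated lower bound; no
measurability is needed. -/
theorem one_sub_le_measureReal {Ω : Type*} [MeasurableSpace Ω] {P : Measure Ω}
    [IsProbabilityMeasure P] {S T : Set Ω} {x : ℝ} (hx : 0 ≤ x) (hT : P T ≤ ENNReal.ofReal x)
    (hST : Tᶜ ⊆ S) : 1 - x ≤ P.real S := by
  have h1 : P Set.univ ≤ P S + P T := by
    refine (measure_mono fun ω _ => ?_).trans (measure_union_le S T)
    by_cases h : ω ∈ T
    · exact Or.inr h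
    · exact Or.inl (hST h)
  rw [measure_univ] at h1
  have h2 : (1 : ENNReal) ≤ P S + ENNReal.ofReal x := h1.trans (by gcongr)
  have h3 := ENNReal.toReal_mono (by finiteness) h2
  rw [ENNReal.toReal_add (by finiteness) (by finiteness), ENNReal.toReal_ofReal hx,
    ENNReal.toReal_one] at h3
  change _ ≤ (P S).toReal
  linarith

/-- The probability bound on all heights for a given logarithmic factor `F L r` that dominates the
admissible weight `g`. -/
theorem exists_maximal_height_bound_of_factor {d n : ℕ} (hd : 1 ≤ d) (hd3 : d ≤ 3) (hn : 1 ≤ n)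
    {K κ : ℝ} (hK : 0 < K) (hκ : 0 < κ) (g : ℕ → ℝ) (hg0 : ∀ j, 0 ≤ g j)
    (hg : Summable fun j => ((2 : ℝ) ^ (d - 1)) ^ j * Real.exp (-4 * g j))
    (F : ℕ → ℝ → ℝ) (hF0 : ∀ L r, 0 ≤ F L r) (hF : ∃ C : ℝ, 0 < C ∧ ∀ L r : ℕ, 1 ≤ L → 1 ≤ r →
      r ≤ L + 1 → 1 + g (topScale L - (Nat.log 2 r + 1)) ≤ C * F L r) :
    ∃ C c : ℝ, 0 < C ∧ 0 < c ∧ ∀ (Ω : Type*) [MeasurableSpace Ω] (P : Measure Ω)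
      [IsProbabilityMeasure P]
      [MeasurableSpace (Potential n)] (η : Ω → Environment d n), Measurable η →
      ExiMin (P.map η) → Stat (P.map η) → Conc (P.map η) K κ →
      ∀ (L : ℕ), 1 ≤ L → ∀ (lam : ℝ), 0 < lam →
      ∀ (φ : Ω → Config d n), (∀ᵐ ω ∂P, IsGroundConfig (η ω) lam (box d L) 0 (φ ω)) →
      ∀ t : ℝ, 0 < t → 1 - C * Real.exp (-c * t ^ 4) ≤
        P.real {ω | ∀ v ∈ box d L, ‖φ ω v‖ ≤ t * √lam *
          F L (boundaryDist d L v) ^ (1 / 4 : ℝ) *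
            boundaryDist d L v ^ ((4 - (d : ℝ)) / 4)} := by
  obtain ⟨C₁, hC₁, hF⟩ := hF
  obtain ⟨B, C, c, hB, hC0, hc, hmain⟩ := exists_maximal_height_bound hd hd3 hn hK hκ g hg0 hg
  set b := B * C₁ ^ (1 / 4 : ℝ) with hb
  have hb0 : 0 < b := by positivity
  refine ⟨C, c / b ^ 4, hC0, by positivity, ?_⟩
  intro Ω _ P _ _ η hη hE hS hC L hL lam hlam φ hφ t ht
  have h := hmain Ω P η hη hE hS hC L lam hlam φ hφ (t / b) (by positivity)
  have e : -c * (t / b) ^ 4 = -(c / b ^ 4) * t ^ 4 := by rw [div_pow]; ring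
  rw [e] at h
  refine one_sub_le_measureReal (by positivity) h fun ω hω v hv => ?_
  rw [Set.mem_compl_iff, Set.mem_ofPred_eq, not_not] at hω
  obtain ⟨r, hr, hr1, hrL, -⟩ := exists_boundaryDist_eq hd hv
  refine (hω v hv r hr).trans ?_
  rw [hr]
  have h1 := hF L r hL hr1 hrL
  have hgj := hg0 (topScale L - (Nat.log 2 r + 1))
  have h2 : (1 + g (topScale L - (Nat.log 2 r + 1))) ^ (1 / 4 : ℝ) ≤
      C₁ ^ (1 / 4 : ℝ) * F L r ^ (1 / 4 : ℝ) := by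
    rw [← Real.mul_rpow hC₁.le (hF0 _ _)]
    exact Real.rpow_le_rpow (by linarith) h1 (by norm_num)
  calc t / b * (B * √lam * (1 + g (topScale L - (Nat.log 2 r + 1))) ^ (1 / 4 : ℝ) *
        (r : ℝ) ^ ((4 - (d : ℝ)) / 4))
      ≤ t / b * (B * √lam * (C₁ ^ (1 / 4 : ℝ) * F L r ^ (1 / 4 : ℝ)) *
        (r : ℝ) ^ ((4 - (d : ℝ)) / 4)) := by gcongr
    _ = t / b * b * √lam * F L r ^ (1 / 4 : ℝ) * (r : ℝ) ^ ((4 - (d : ℝ)) / 4) := by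
        rw [hb]; ring
    _ = _ := by rw [div_mul_cancel₀ _ hb0.ne']

theorem positiveOrOne_nonneg (x : ℝ) : 0 ≤ positiveOrOne x := by
  unfold positiveOrOne
  split_ifs with h
  · exact h.le
  · exact zero_le_one

/-! ### Localization of the ground configuration -/

theorem theorem1p1 (d n : ℕ) (hd : 1 ≤ d) (hn : 1 ≤ n) (K κ : ℝ) (hK : 0 < K) (hκ : 0 < κ) :
    ∃ C c : ℝ, 0 < C ∧ 0 < c ∧
      ∀ (Ω : Type*) [MeasurableSpace Ω] (P : Measure Ω) [IsProbabilityMeasure P]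
        [MeasurableSpace (Potential n)] (η : Ω → Environment d n), Measurable η →
        ExiMin (P.map η) → Stat (P.map η) → Conc (P.map η) K κ →
        ∀ (L : ℕ), 1 ≤ L → ∀ (lam : ℝ), 0 < lam →
        ∀ (φ : Ω → Config d n), (∀ᵐ ω ∂P, IsGroundConfig (η ω) lam (box d L) 0 (φ ω)) →
          (∀ v ∈ box d L,
            Integrable (fun ω => ‖φ ω v‖) P ∧
            ∫ ω, ‖φ ω v‖ ∂P ≤ C * √lam * heightScale d (boundaryDist d L v)) ∧
          (d = 1 → ∀ t : ℝ, 0 < t →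
            1 - C * Real.exp (-c * t ^ 4) ≤
              P.real {ω | ∀ v ∈ box d L, ‖φ ω v‖ ≤
                t * √lam *
                  positiveOrOne (Real.log (Real.log (3 * L / boundaryDist d L v))) ^ (1 / 4 : ℝ) *
                  boundaryDist d L v ^ ((4 - (d : ℝ)) / 4)}) ∧
          (d = 2 ∨ d = 3 → ∀ t : ℝ, 0 < t →
            1 - C * Real.exp (-c * t ^ 4) ≤
              P.real {ω | ∀ v ∈ box d L, ‖φ ω v‖ ≤
                t * √lam *
                  positiveOrOne (Real.log (2 * L / boundaryDist d L v)) ^ (1 / 4 : ℝ) *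
                  boundaryDist d L v ^ ((4 - (d : ℝ)) / 4)}) := by
  obtain ⟨C₁, hC₁, hmean⟩ := exists_mean_height_bound hd hn hK hκ
  -- outside the dimensions of the two uniform bounds, their constants are arbitrary
  have hone : ∃ C c : ℝ, 0 < C ∧ 0 < c ∧ (d = 1 → ∀ (Ω : Type _) [MeasurableSpace Ω]
      (P : Measure Ω) [IsProbabilityMeasure P]
      [MeasurableSpace (Potential n)] (η : Ω → Environment d n), Measurable η →
      ExiMin (P.map η) → Stat (P.map η) → Conc (P.map η) K κ →
      ∀ (L : ℕ), 1 ≤ L → ∀ (lam : ℝ), 0 < lam →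
      ∀ (φ : Ω → Config d n), (∀ᵐ ω ∂P, IsGroundConfig (η ω) lam (box d L) 0 (φ ω)) →
      ∀ t : ℝ, 0 < t → 1 - C * Real.exp (-c * t ^ 4) ≤
        P.real {ω | ∀ v ∈ box d L, ‖φ ω v‖ ≤ t * √lam *
          positiveOrOne (Real.log (Real.log (3 * L / boundaryDist d L v))) ^ (1 / 4 : ℝ) *
            boundaryDist d L v ^ ((4 - (d : ℝ)) / 4)}) := by
    by_cases h : d = 1
    · subst h
      obtain ⟨C, c, hC, hc, hmain⟩ := exists_maximal_height_bound_of_factor le_rfl (by norm_num) hn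
        hK hκ (fun j => Real.log (1 + (j : ℝ)))
        (fun j => Real.log_nonneg (by linarith [(Nat.cast_nonneg j : (0 : ℝ) ≤ j)]))
        summable_weight_log (fun L r => positiveOrOne (Real.log (Real.log (3 * L / r))))
        (fun _ _ => positiveOrOne_nonneg _) exists_logLog_factor
      exact ⟨C, c, hC, hc, fun _ => hmain⟩
    · exact ⟨1, 1, one_pos, one_pos, fun h' => absurd h' h⟩
  have htwo : ∃ C c : ℝ, 0 < C ∧ 0 < c ∧ (d = 2 ∨ d = 3 → ∀ (Ω : Type _) [MeasurableSpace Ω]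
      (P : Measure Ω) [IsProbabilityMeasure P]
      [MeasurableSpace (Potential n)] (η : Ω → Environment d n), Measurable η →
      ExiMin (P.map η) → Stat (P.map η) → Conc (P.map η) K κ →
      ∀ (L : ℕ), 1 ≤ L → ∀ (lam : ℝ), 0 < lam →
      ∀ (φ : Ω → Config d n), (∀ᵐ ω ∂P, IsGroundConfig (η ω) lam (box d L) 0 (φ ω)) →
      ∀ t : ℝ, 0 < t → 1 - C * Real.exp (-c * t ^ 4) ≤
        P.real {ω | ∀ v ∈ box d L, ‖φ ω v‖ ≤ t * √lam *
          positiveOrOne (Real.log (2 * L / boundaryDist d L v)) ^ (1 / 4 : ℝ) *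
            boundaryDist d L v ^ ((4 - (d : ℝ)) / 4)}) := by
    by_cases h : d = 2 ∨ d = 3
    · have hd3 : d ≤ 3 := by omega
      obtain ⟨C, c, hC, hc, hmain⟩ := exists_maximal_height_bound_of_factor hd hd3 hn
        hK hκ (fun j => (j : ℝ)) (fun j => Nat.cast_nonneg j)
        (summable_weight_id hd3) (fun L r => positiveOrOne (Real.log (2 * L / r)))
        (fun _ _ => positiveOrOne_nonneg _) exists_log_factor
      exact ⟨C, c, hC, hc, fun _ => hmain⟩
    · exact ⟨1, 1, one_pos, one_pos, fun h' => absurd h' h⟩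
  obtain ⟨C₂, c₂, hC₂, hc₂, h2⟩ := hone
  obtain ⟨C₃, c₃, hC₃, hc₃, h3⟩ := htwo
  refine ⟨C₁ + C₂ + C₃, min c₂ c₃, by positivity, lt_min hc₂ hc₃, ?_⟩
  intro Ω _ P _ _ η hη hE hS hC L hL lam hlam φ hφ
  -- enlarging `C` and decreasing `c` weakens the probability bounds
  have hweak : ∀ C' c' t : ℝ, C' ≤ C₁ + C₂ + C₃ → min c₂ c₃ ≤ c' →
      1 - (C₁ + C₂ + C₃) * Real.exp (-min c₂ c₃ * t ^ 4) ≤ 1 - C' * Real.exp (-c' * t ^ 4) := by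
    intro C' c' t hC' hc'
    have : C' * Real.exp (-c' * t ^ 4) ≤
        (C₁ + C₂ + C₃) * Real.exp (-min c₂ c₃ * t ^ 4) := by
      gcongr
    linarith
  refine ⟨fun v hv => ?_, fun h t ht => ?_, fun h t ht => ?_⟩
  · obtain ⟨hint, hle⟩ := hmean Ω P η hη hE hS hC L lam hlam φ hφ v hv
    refine ⟨hint, hle.trans ?_⟩
    obtain ⟨r, hr, hr1, -⟩ := exists_boundaryDist_eq hd hv
    have hheight : 0 ≤ heightScale d (boundaryDist d L v) := by
      rw [hr, heightScale]
      split_ifs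
      · positivity
      · exact Real.log_nonneg (by linarith [(Nat.cast_nonneg r : (0 : ℝ) ≤ r)])
      · exact zero_le_one
    gcongr
    linarith
  · exact (hweak C₂ c₂ t (by linarith) (min_le_left _ _)).trans
      (h2 h Ω P η hη hE hS hC L hL lam hlam φ hφ t ht)
  · exact (hweak C₃ c₃ t (by linarith) (min_le_right _ _)).trans
      (h3 h Ω P η hη hE hS hC L hL lam hlam φ hφ t ht)
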